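/- **Model.** UAVs form a homogeneous Poisson point process of density $\lambda>0$ in the plane $\mathbb R^2$, at altitude $h_v\ge 0$; the typical base station (BS) is at the origin, at altitude $h_b\ge0$. Put $\Delta h=|h_v-h_b|$ and list the UAVs as $v_1,v_2,\dots$ with $r_n=\|v_n\|$, $r_1<r_2<\cdots$. Let $\beta_a,\beta_b,\varepsilon>0$, $\rho=\sqrt{\beta_a\beta_b}$, $\gamma(r)=\lfloor r\rho\rfloor$. Independently for each UAV, given the locations, the link to a UAV at horizontal distance $r$ is in state $\kappa=L$ (LOS) with probability $p_L(\gamma(r))$ and in state $\kappa=N$ (NLOS) with probability $p_N=1-p_L$, where $p_L(0)=1$ and, for $\gamma\ge1$, $$p_L(\gamma)=\prod_{n=0}^{\gamma}\Big(1-\exp\Big(-\frac{(\gamma\max(h_v,h_b)-(n+\frac12)\Delta h)^2}{2\varepsilon^2\gamma^2}\Big)\Big).$$ A link in state $\kappa$ has path loss $C_\kappa(r^2+\Delta h^2)^{-\alpha_\kappa/2}$, where $C_\kappa>0$, $\alpha_L\ge2$, $\alpha_N>2$, and fading power gain $g$ with the Gamma distribution of shape $\mathcal N_\kappa\in\{1,2,\dots\}$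 and mean $1$. Transmitter and receiver ($c=t,r$) have beamwidths $\theta_c^a\in[0,2\pi]$, $\theta_c^e\in[0,\pi]$, main lobe gain $M_c>0$ and side lobe gain $m_c\ge0$; with $q_c=\frac{\theta_c^a}{2\pi}\frac{\theta_c^e}{\pi}$, the directivity gain $G$ of an interfering link equals $o_1=M_tM_r$, $o_2=m_tM_r$, $o_3=M_tm_r$, $o_4=m_tm_r$ with probabilities $p_1=q_tq_r$, $p_2=(1-q_t)q_r$, $p_3=q_t(1-q_r)$, $p_4=(1-q_t)(1-q_r)$; the desired link has gain $o_1$. Fading and antenna gains are independent of each other, across UAVs, and of the locations and link states (except that the fading law depends on the state). The BS is served by the nearest UAV $v_1$; with transmit power $P_v>0$ and noise power $n_0^2>0$, $$\Upsilon_{down}=\frac{C_{\kappa_1}(r_1^2+\Delta h^2)^{-\alpha_{\kappa_1}/2}\,o_1\,g_1}{I+n_0^2/P_v},\qquad I=\sum_{n\ge2}C_{\kappa_n}(r_n^2+\Delta h^2)^{-\alpha_{\kappa_n}/2}\,G_n\,g_n,$$ and $P_{down}(\Upsilon)=\mathbb P[\Upsilon_{down}>\Upsilon]$ for $\Upsilon>0$.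 **The closed form.** Let $f_n(r)=2\pi\lambda r e^{-\pi\lambda r^2}$, $\eta_\kappa=\mathcal N_\kappa(\mathcal N_\kappa!)^{-1/\mathcal N_\kappa}$, and $$\mathcal L_{down}(s|r_1)=\exp\Big(-2\pi\lambda\sum_{i=1}^4p_i\big(\Theta^L(s,o_i|r_1)+\Theta^N(s,o_i|r_1)\big)\Big),$$ $$\Theta^\kappa(s,o|r_1)=p_\kappa(\gamma)\,Z^\kappa\big(s,r_1,\tfrac{\gamma+1}\rho,o\big)+\sum_{j=\gamma+1}^\infty p_\kappa(j)\,Z^\kappa\big(s,\tfrac j\rho,\tfrac{j+1}\rho,o\big),\qquad\gamma=\gamma(r_1),$$ $$Z^\kappa(s,a,b,o)=\tfrac{a^2+\Delta h^2}2F^\kappa\Big(\tfrac{sC_\kappa o}{\mathcal N_\kappa(a^2+\Delta h^2)^{\alpha_\kappa/2}}\Big)-\tfrac{b^2+\Delta h^2}2F^\kappa\Big(\tfrac{sC_\kappa o}{\mathcal N_\kappa(b^2+\Delta h^2)^{\alpha_\kappa/2}}\Big),$$ where $F^\kappa(z)={}_2F_1\big(-\tfrac2{\alpha_\kappa},\mathcal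 N_\kappa;1-\tfrac2{\alpha_\kappa};-z\big)-1$ if $\alpha_\kappa>2$, and, if $\alpha_\kappa=2$, $$F^\kappa(z)=\sum_{c=1}^{\mathcal N_\kappa-1}\frac{z\mathcal N_\kappa}{(z+1)^{\mathcal N_\kappa-c}(\mathcal N_\kappa-c)}-\frac{(z+1)^{\mathcal N_\kappa-1}-1}{(z+1)^{\mathcal N_\kappa-1}}-z\mathcal N_\kappa\ln\Big(1+\frac1z\Big)$$ (with $F^\kappa(0)=0$). Put $$\Psi^\kappa_{down}(r_1,\Upsilon)=\sum_{n=1}^{\mathcal N_\kappa}(-1)^{n+1}\binom{\mathcal N_\kappa}n\exp\Big(-\frac{n\eta_\kappa\Upsilon n_0^2}{P_vo_1C_\kappa(r_1^2+\Delta h^2)^{-\alpha_\kappa/2}}\Big)\mathcal L_{down}\Big(\frac{n\eta_\kappa\Upsilon}{o_1C_\kappa(r_1^2+\Delta h^2)^{-\alpha_\kappa/2}}\Big|r_1\Big)f_n(r_1)$$ and, with the Gauss–Chebyshev nodes $\zeta_k=\cos\big(\frac{2k-1}{2m}\pi\big)$, $$Q_m(\Upsilon)=\frac{\pi}{2m\rho}\sum_{k=1}^m\sqrt{1-\zeta_k^2}\sum_{\gamma=0}^\infty\Big(p_L(\gamma)\Psi^L_{down}\big(\tfrac{\zeta_k+2\gamma+1}{2\rho},\Upsilon\big)+p_N(\gamma)\Psi^N_{down}\big(\tfrac{\zeta_k+2\gamma+1}{2\rho},\Upsilon\big)\Big).$$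 **Theorem.** Almost surely $I<\infty$, and all the series above converge. $Q_m(\Upsilon)$ approximates $P_{down}(\Upsilon)$ in the following sense. As $m\to\infty$, $Q_m(\Upsilon)$ converges to $$Q_\infty(\Upsilon)=\mathbb E\Big[1-\big(1-e^{-\eta_{\kappa_1}T}\big)^{\mathcal N_{\kappa_1}}\Big],\qquad T=\frac{\Upsilon(I+n_0^2/P_v)}{C_{\kappa_1}(r_1^2+\Delta h^2)^{-\alpha_{\kappa_1}/2}o_1},$$ which is the coverage probability with the Gamma distribution function of the desired link's fading replaced by Alzer's expression $(1-e^{-\eta_\kappa x})^{\mathcal N_\kappa}$. Moreover $P_{down}(\Upsilon)\le Q_\infty(\Upsilon)$, and $|P_{down}(\Upsilon)-Q_\infty(\Upsilon)|\le\delta$ whenever $\delta$ bounds the difference between the Gamma distribution function and Alzer's expression, for all $x\ge0$ and both $\kappa$. If $\mathcal N_L=\mathcal N_N=1$, then $Q_m(\Upsilon)\to P_{down}(\Upsilon)$. -/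

import Mathlib

open MeasureTheory ProbabilityTheory Filter Topology
open scoped ENNReal

noncomputable section

namespace UAV

/-- The two states of a link: line of sight, or non line of sight. -/
inductive Link where
  | LOS
  | NLOS

/-- The parameters of the downlink: density `lam` of the UAVs, altitudes `hv` of the UAVs and `hb`
of the base stations, obstacle parameters `βa`, `βb`, `ε`, intercepts `C κ`, path loss exponents
`α κ`, Nakagami parameters `N κ`, the sectorized antenna patterns of the transmitters and of the
receivers (beamwidths in azimuth and elevation, main and side lobe gain), transmit power `Pv` of
the UAVs and noise power `noise` (that is `n₀²`). -/
structure Params where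
  lam : ℝ
  hv : ℝ
  hb : ℝ
  βa : ℝ
  βb : ℝ
  ε : ℝ
  C : Link → ℝ
  α : Link → ℝ
  N : Link → ℕ
  θta : ℝ
  θte : ℝ
  θra : ℝ
  θre : ℝ
  Mt : ℝ
  mt : ℝ
  Mr : ℝ
  mr : ℝ
  Pv : ℝ
  noise : ℝ
  lam_pos : 0 < lam
  hv_nonneg : 0 ≤ hv
  hb_nonneg : 0 ≤ hb
  βa_pos : 0 < βa
  βb_pos : 0 < βb
  ε_pos : 0 < ε
  C_pos : ∀ κ, 0 < C κ
  α_LOS : 2 ≤ α Link.LOS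
  α_NLOS : 2 < α Link.NLOS
  N_pos : ∀ κ, 1 ≤ N κ
  θta_mem : θta ∈ Set.Icc 0 (2 * Real.pi)
  θte_mem : θte ∈ Set.Icc 0 Real.pi
  θra_mem : θra ∈ Set.Icc 0 (2 * Real.pi)
  θre_mem : θre ∈ Set.Icc 0 Real.pi
  Mt_pos : 0 < Mt
  mt_nonneg : 0 ≤ mt
  Mr_pos : 0 < Mr
  mr_nonneg : 0 ≤ mr
  Pv_pos : 0 < Pv
  noise_pos : 0 < noise

namespace Params

variable (p : Params)

/-- The height difference `Δh_d`. -/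
def Δh : ℝ := |p.hv - p.hb|

/-- `√(β_a β_b)`. -/
def ρ : ℝ := Real.sqrt (p.βa * p.βb)

/-- The blockage level `γ(r) = ⌊r √(β_a β_b)⌋` at horizontal distance `r`. -/
def level (r : ℝ) : ℕ := ⌊r * p.ρ⌋₊

/-- The LOS probability at blockage level `γ`. At `γ = 0` the exponent of the only factor has the
denominator `γ² = 0` and is read as `-∞`: a link that meets no obstacle is LOS. -/
def pLOS (γ : ℕ) : ℝ :=
  if γ = 0 then 1
  else ∏ n ∈ Finset.range (γ + 1),
    (1 - Real.exp (-((γ * max p.hv p.hb - (n + 1 / 2) * |p.hv - p.hb|) ^ 2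
      / (2 * p.ε ^ 2 * γ ^ 2))))

/-- The probabilities `p_L(γ)` and `p_N(γ) = 1 - p_L(γ)`. -/
def prob : Link → ℕ → ℝ
  | Link.LOS, γ => p.pLOS γ
  | Link.NLOS, γ => 1 - p.pLOS γ

/-- The path loss of a link of state `κ` over the horizontal distance `r`. -/
def pathLoss (κ : Link) (r : ℝ) : ℝ :=
  p.C κ / Real.sqrt ((r ^ 2 + p.Δh ^ 2) ^ p.α κ)

/-- Main lobe probability of the transmitter. -/
def qt : ℝ := p.θta / (2 * Real.pi) * (p.θte / Real.pi)

/-- Main lobe probability of the receiver. -/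
def qr : ℝ := p.θra / (2 * Real.pi) * (p.θre / Real.pi)

/-- The four values of the directivity gain; `gain 0` is the maximal gain `G₀` (called `o₁`). -/
def gain : Fin 4 → ℝ := ![p.Mt * p.Mr, p.mt * p.Mr, p.Mt * p.mr, p.mt * p.mr]

/-- The probabilities of the four values of the directivity gain. -/
def gainProb : Fin 4 → ℝ :=
  ![p.qt * p.qr, (1 - p.qt) * p.qr, p.qt * (1 - p.qr), (1 - p.qt) * (1 - p.qr)]

/-- The law of the gain pattern of an interferer. -/
def gainLaw : Measure (Fin 4) :=
  ∑ i, ENNReal.ofReal (p.gainProb i) • Measure.dirac i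

/-- The law of the power gain `|ĥ|²` of Nakagami fading: Gamma of shape `N κ` and mean one. -/
def fadingLaw (κ : Link) : Measure ℝ := gammaMeasure (p.N κ) (p.N κ)

end Params

/-- The marks of a UAV: a uniform variable `u` that decides the link state (`u ≤ p_L` realizes the
Bernoulli variable of parameter `p_L`), the antenna pattern, and the fading power gains that apply
in the LOS and in the NLOS state. -/
abbrev Mark : Type := ℝ × Fin 4 × ℝ × ℝ

/-- The law of the marks: the four components are independent. -/
def Params.markLaw (p : Params) : Measure Mark :=
  (volume.restrict (Set.Icc (0 : ℝ) 1)).prod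
    (p.gainLaw.prod ((p.fadingLaw Link.LOS).prod (p.fadingLaw Link.NLOS)))

/-- The fading power gain that applies in state `κ`. -/
def Mark.fading (x : Mark) : Link → ℝ
  | Link.LOS => x.2.2.1
  | Link.NLOS => x.2.2.2

/-- The horizontal plane. -/
abbrev Plane : Type := EuclideanSpace ℝ (Fin 2)

/-- The random points `v 0, v 1, …` form a homogeneous Poisson point process of density `lam`:
the number of points in a Borel set of finite area is Poisson with mean `lam` times the area, and
the numbers of points in disjoint sets are independent. -/
structure IsPPP {Ω : Type*} [MeasurableSpace Ω] (P : Measure Ω) (v : ℕ → Ω → Plane)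
    (lam : ℝ) : Prop where
  measurable : ∀ n, Measurable (v n)
  poisson : ∀ A : Set Plane, MeasurableSet A → volume A < ∞ → ∀ k : ℕ,
    P {ω | {n | v n ω ∈ A}.encard = k} =
      ENNReal.ofReal (Real.exp (-(lam * volume.real A)) * (lam * volume.real A) ^ k / k.factorial)
  indep : ∀ (l : ℕ) (A : Fin l → Set Plane), (∀ i, MeasurableSet (A i)) →
    (∀ i, volume (A i) < ∞) → Pairwise (fun i j => Disjoint (A i) (A j)) →
    iIndepFun (fun i ω => {n | v n ω ∈ A i}.encard) P

/-- The downlink network seen from the typical base station, which is at the origin: the UAVs are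
a Poisson point process, listed by increasing horizontal distance (so that `v 0` is the nearest
one), and carry independent marks of law `p.markLaw`, independent of the locations. -/
structure IsNetwork {Ω : Type*} [MeasurableSpace Ω] (P : Measure Ω) (p : Params)
    (v : ℕ → Ω → Plane) (mark : ℕ → Ω → Mark) : Prop where
  ppp : IsPPP P v p.lam
  ranked : ∀ᵐ ω ∂P, StrictMono (fun n => ‖v n ω‖)
  mark_measurable : ∀ n, Measurable (mark n)
  mark_law : ∀ n, P.map (mark n) = p.markLaw
  mark_indep : iIndepFun mark P
  indep : IndepFun (fun ω n => v n ω) (fun ω n => mark n ω) P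

namespace Params

variable (p : Params)

open Classical in
/-- The state of the link between the typical base station and a UAV at `x` with mark `z`. -/
def state (x : Plane) (z : Mark) : Link :=
  if z.1 ≤ p.pLOS (p.level ‖x‖) then Link.LOS else Link.NLOS

/-- The channel gain of an interfering UAV at `x` with mark `z`. -/
def channelGain (x : Plane) (z : Mark) : ℝ :=
  p.pathLoss (p.state x z) ‖x‖ * p.gain z.2.1 * z.fading (p.state x z)

/-- The channel gain of the desired link, whose antennas are aligned. -/
def desiredGain (x : Plane) (z : Mark) : ℝ :=
  p.pathLoss (p.state x z) ‖x‖ * p.gain 0 * z.fading (p.state x z)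

section Network

variable {Ω : Type*} (v : ℕ → Ω → Plane) (mark : ℕ → Ω → Mark)

/-- The interference: all UAVs but the nearest one. -/
def interference (ω : Ω) : ℝ≥0∞ :=
  ∑' n : ℕ, ENNReal.ofReal (p.channelGain (v (n + 1) ω) (mark (n + 1) ω))

/-- The received SINR at the typical base station. -/
def sinr (ω : Ω) : ℝ≥0∞ :=
  ENNReal.ofReal (p.desiredGain (v 0 ω) (mark 0 ω)) /
    (p.interference v mark ω + ENNReal.ofReal (p.noise / p.Pv))

/-- The coverage probability `P_down(Υ)`. -/
def coverage [MeasurableSpace Ω] (P : Measure Ω) (Υ : ℝ) : ℝ :=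
  P.real {ω | ENNReal.ofReal Υ < p.sinr v mark ω}

/-- The constant `η_κ = N_κ (N_κ !)^(-1 / N_κ)`. -/
def η (κ : Link) : ℝ := p.N κ * ((p.N κ).factorial : ℝ) ^ (-1 / (p.N κ : ℝ))

/-- Alzer's expression `(1 - e^{-η x})^N`, which approximates the distribution function of the
fading power gain. -/
def alzer (κ : Link) (x : ℝ) : ℝ := (1 - Real.exp (-(p.η κ * x))) ^ p.N κ

/-- The value that the fading power gain of the desired link has to exceed for coverage. -/
def required (Υ : ℝ) (ω : Ω) : ℝ :=
  Υ * ((p.interference v mark ω).toReal + p.noise / p.Pv) /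
    (p.pathLoss (p.state (v 0 ω) (mark 0 ω)) ‖v 0 ω‖ * p.gain 0)

/-- `1 - (1 - e^{-η x})^N` at the required value `x` of the fading power gain. -/
def alzerTail (Υ : ℝ) (ω : Ω) : ℝ :=
  1 - p.alzer (p.state (v 0 ω) (mark 0 ω)) (p.required v mark Υ ω)

/-- The coverage probability when the distribution function of the fading power gain of the
desired link is replaced by Alzer's expression. -/
def alzerCoverage [MeasurableSpace Ω] (P : Measure Ω) (Υ : ℝ) : ℝ :=
  ∫ ω, p.alzerTail v mark Υ ω ∂P

end Network

/-- The density of the distance to the nearest UAV. -/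
def nearestPDF (r : ℝ) : ℝ :=
  2 * Real.pi * p.lam * r * Real.exp (-(Real.pi * p.lam * r ^ 2))

end Params

/-- The Gauss hypergeometric function `₂F₁(a, b; c; x)` at real `x ≤ 0`: the Gauss series in the
disc of convergence, and its analytic continuation by Pfaff's transformation, whose argument
`x / (x - 1)` is in `[0, 1)`, outside. -/
def gaussHyp (a b c x : ℝ) : ℝ :=
  if |x| < 1 then ordinaryHypergeometric a b c x
  else (1 - x) ^ (-b) * ordinaryHypergeometric (c - a) b c (x / (x - 1))

/-- The function `F^κ_α` for `α = 2`. -/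
def F2 (N : ℕ) (z : ℝ) : ℝ :=
  ∑ c ∈ Finset.Icc 1 (N - 1), z * N / ((z + 1) ^ (N - c) * ((N : ℝ) - c))
    - ((z + 1) ^ (N - 1) - 1) / (z + 1) ^ (N - 1)
    - z * N * Real.log (1 + 1 / z)

namespace Params

variable (p : Params)

open Classical in
/-- The function `F^κ_{α_κ}`. -/
def F (κ : Link) (z : ℝ) : ℝ :=
  if p.α κ = 2 then F2 (p.N κ) z
  else gaussHyp (-2 / p.α κ) (p.N κ) (1 - 2 / p.α κ) (-z) - 1

/-- `Z^κ(s, a, b, G)`. -/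
def Z (κ : Link) (s a b G : ℝ) : ℝ :=
  (a ^ 2 + p.Δh ^ 2) / 2
      * p.F κ (s * p.C κ * G / (p.N κ * (a ^ 2 + p.Δh ^ 2) ^ (p.α κ / 2)))
    - (b ^ 2 + p.Δh ^ 2) / 2
      * p.F κ (s * p.C κ * G / (p.N κ * (b ^ 2 + p.Δh ^ 2) ^ (p.α κ / 2)))

/-- The contribution `p_κ(j) Z^κ(s, j / √(β_a β_b), (j + 1) / √(β_a β_b), o_i)` of level `j`. -/
def ringTerm (κ : Link) (s : ℝ) (i : Fin 4) (j : ℕ) : ℝ :=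
  p.prob κ j * p.Z κ s (j / p.ρ) ((j + 1) / p.ρ) (p.gain i)

/-- `Θ^κ(s, o_i | r₁)`. -/
def Θ (κ : Link) (s : ℝ) (i : Fin 4) (r₁ : ℝ) : ℝ :=
  p.prob κ (p.level r₁) * p.Z κ s r₁ ((p.level r₁ + 1) / p.ρ) (p.gain i)
    + ∑' j : ℕ, p.ringTerm κ s i (p.level r₁ + 1 + j)

/-- The Laplace transform of the interference conditional on `r₁`, in closed form. -/
def laplace (s r₁ : ℝ) : ℝ :=
  Real.exp (-(2 * Real.pi * p.lam
    * ∑ i, p.gainProb i * (p.Θ Link.LOS s i r₁ + p.Θ Link.NLOS s i r₁)))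

/-- `Ψ^κ_down(r₁, Υ)`. -/
def Ψ (κ : Link) (r₁ Υ : ℝ) : ℝ :=
  ∑ n ∈ Finset.Icc 1 (p.N κ), (-1 : ℝ) ^ (n + 1) * (p.N κ).choose n
    * Real.exp (-(n * p.η κ * Υ * p.noise
        / (p.Pv * p.gain 0 * p.C κ * (r₁ ^ 2 + p.Δh ^ 2) ^ (-(p.α κ / 2)))))
    * p.laplace (n * p.η κ * Υ / (p.gain 0 * p.C κ * (r₁ ^ 2 + p.Δh ^ 2) ^ (-(p.α κ / 2)))) r₁
    * p.nearestPDF r₁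

/-- The term of blockage level `γ` at the node `ζ`. -/
def levelTerm (Υ ζ : ℝ) (γ : ℕ) : ℝ :=
  p.prob Link.LOS γ * p.Ψ Link.LOS ((ζ + 2 * γ + 1) / (2 * p.ρ)) Υ
    + p.prob Link.NLOS γ * p.Ψ Link.NLOS ((ζ + 2 * γ + 1) / (2 * p.ρ)) Υ

end Params

/-- The Gauss–Chebyshev nodes `cos ((2k - 1) π / (2m))`, `k = 1, …, m`. -/
def node (m k : ℕ) : ℝ := Real.cos ((2 * (k : ℝ) - 1) / (2 * m) * Real.pi)

/-- The quadrature expression for the coverage probability, with `m` nodes. -/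
def Params.quadrature (p : Params) (Υ : ℝ) (m : ℕ) : ℝ :=
  Real.pi / (2 * m * p.ρ)
    * ∑ k ∈ Finset.Icc 1 m, Real.sqrt (1 - node m k ^ 2)
      * ∑' γ : ℕ, p.levelTerm Υ (node m k) γ

end UAV

end

/-! Alzer's tail `1 - (1 - e^{-ηT})^N` is a finite alternating sum of exponentials `e^{-nηT}`, and
`T` is affine in the interference once the nearest distance and the state of the serving link are
fixed. So the limit of the quadrature needs only one probabilistic input: the Laplace transform of
the interference, jointly with the nearest distance and that state, at a transform variable that
depends on the distance (`lintegral_state_interference_var`).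

This input comes from the generating functional of the Poisson process
(`IsPPP.lintegral_negExp_sum`). Independent marks replace the power of an interferer at distance `u`
by its Laplace transform `1 - meanLoss s u`. No conditioning on the nearest point is used. The
functional over all points, on the event that no point lies within distance `a`, is explicit in `a`;
its derivative in `a` gives the density of the nearest distance weighted with that functional, and
dividing by the factor of the nearest point leaves only the interferers (`lintegral_nearest`).
Letting the transform variable tend to `0` shows that the interference is almost surely finite.

The closed form is the same integral evaluated by antiderivatives. For each path loss exponent, `F`
satisfies one first order differential equation (`hasDerivAt_F`), which makes `Z` the integral of `u
* loss` over a ring (`Z_eq_integral`). The blockage level is constant on rings, so the series in `Θ`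
is the integral over a half line cut at the grid points. It converges since the LOS probability
decays exponentially in the level, which covers the exponent 2, and since the NLOS exponent exceeds
2.

For the quadrature, each blockage cell is mapped affinely to `(-1, 1)` and `ζ = cos θ` is
substituted. The Chebyshev nodes become midpoints of a uniform grid on `[0, π]`, and the square root
becomes the sine in the Jacobian, so the claim is convergence of the midpoint rule for a continuous
function (`tendsto_quadrature`).

The coverage probability is the mean of the Gamma tail at `T`, because the fading of the serving
link can be integrated out (`coverage_eq`). Its difference to the limit is the mean of a difference
of distribution functions: it is bounded by `δ`, has a sign by Alzer's inequality
(`alzer_le_integral_erlangDensity`), and vanishes for shape one. -/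

noncomputable section

namespace UAV

/-! ### Differential equations of the hypergeometric series, and Pfaff's transformation. -/

section Hypergeometric

/-- A scalar power series of radius at least one is differentiable in the open unit interval, and
its derivative is computed term by term. -/
lemma hasSum_ofScalars_of_radius_eq_one {a : ℕ → ℝ}
    (ha : (FormalMultilinearSeries.ofScalars ℝ a).radius = 1) {x : ℝ} (hx : |x| < 1) :
    ∃ d, HasDerivAt (FormalMultilinearSeries.ofScalars ℝ a).sum d x ∧
      HasSum (fun n => a n * x ^ n) ((FormalMultilinearSeries.ofScalars ℝ a).sum x) ∧
      HasSum (fun n : ℕ => (n : ℝ) * (a n * x ^ n)) (x * d) := by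
  set q := FormalMultilinearSeries.ofScalars ℝ a with hq
  have hpos : 0 < q.radius := by rw [ha]; exact one_pos
  have hball := q.hasFPowerSeriesOnBall hpos
  have hmem : x ∈ Metric.eball (0 : ℝ) q.radius := by
    rw [ha]
    simpa [edist_dist, Real.dist_eq, ENNReal.ofReal_lt_one] using hx
  have hfd := hball.fderiv
  have hs := hball.hasSum hmem
  have hd := (hball.differentiableOn.differentiableAt
    (Metric.isOpen_eball.mem_nhds hmem)).hasFDerivAt
  have hs' := hfd.hasSum hmem
  simp only [zero_add] at hs hs'
  refine ⟨fderiv ℝ q.sum x 1, hd.hasDerivAt, ?_, ?_⟩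
  · simpa [hq, FormalMultilinearSeries.ofScalars_apply_eq, mul_comm] using hs
  · have h2 : HasSum (fun n => q.derivSeries n (fun _ => x) x) (fderiv ℝ q.sum x x) :=
      hs'.mapL (ContinuousLinearMap.apply ℝ ℝ x)
    simp only [FormalMultilinearSeries.derivSeries_apply_diag] at h2
    have h3 : fderiv ℝ q.sum x x = x * fderiv ℝ q.sum x 1 := by
      conv_lhs => rw [show x = x • (1 : ℝ) by simp]
      rw [map_smul]; simp
    rw [h3] at h2
    -- The derivative series starts with the linear term of the original one; the weight `n` kills
    -- the term of index zero, so the shift costs nothing.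
    rw [← hasSum_nat_add_iff' 1]
    simpa [hq, FormalMultilinearSeries.ofScalars_apply_eq, mul_comm] using h2

/-- The quotient of the two Pochhammer symbols telescopes because their bases differ by one. Hence
the operator `δ - z d/dz` removes both parameters from the Gauss series and leaves a multiple of a
binomial series. -/
lemma ascPochhammer_eval_neg_div {δ : ℝ} (h1 : δ < 1) (n : ℕ) :
    (δ - n) * ((ascPochhammer ℝ n).eval (-δ) * ((ascPochhammer ℝ n).eval (1 - δ))⁻¹) = δ := by
  have hne : ∀ n : ℕ, (ascPochhammer ℝ n).eval (1 - δ) ≠ 0 := fun n =>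
    (ascPochhammer_pos n _ (by linarith)).ne'
  induction n with
  | zero => simp
  | succ n ih =>
    rw [ascPochhammer_succ_eval, ascPochhammer_succ_eval]
    have h2 : (1 - δ + n) ≠ 0 := by have : (0:ℝ) ≤ n := n.cast_nonneg; linarith
    have h3 := hne n
    field_simp at ih ⊢
    push_cast
    linear_combination (-(1:ℝ)) * (δ - (n + 1)) * ih

lemma ascPochhammer_eval_natCast_div_factorial (m n : ℕ) :
    (n.factorial : ℝ)⁻¹ * (ascPochhammer ℝ n).eval ((m + 1 : ℕ) : ℝ) = ((n + m).choose m : ℝ) := by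
  rw [← ascPochhammer_eval_cast, ascPochhammer_nat_eq_ascFactorial,
    Nat.ascFactorial_eq_factorial_mul_choose]
  have : (n.factorial : ℝ) ≠ 0 := by positivity
  rw [add_comm n m, Nat.choose_symm_add]
  push_cast
  field_simp

/-- The differential equation of the Gauss series that occurs in the interference integrals. -/
lemma hasDerivAt_gaussSeries {δ : ℝ} (h0 : 0 < δ) (h1 : δ < 1) {N : ℕ} (hN : 1 ≤ N) {z : ℝ}
    (hz : |z| < 1) :
    ∃ d, HasDerivAt (fun z : ℝ => ordinaryHypergeometric (-δ) (N : ℝ) (1 - δ) (-z)) d z ∧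
      z * d = δ * (ordinaryHypergeometric (-δ) (N : ℝ) (1 - δ) (-z) - ((1 + z) ^ N)⁻¹) := by
  have hrad : (ordinaryHypergeometricSeries ℝ (-δ) (N : ℝ) (1 - δ)).radius = 1 := by
    refine ordinaryHypergeometricSeries_radius_eq_one ℝ _ _ _ fun k => ⟨?_, ?_, ?_⟩
    · intro h
      rw [neg_neg] at h
      rcases Nat.eq_zero_or_pos k with rfl | hk
      · simp at h; linarith
      · have : (1 : ℝ) ≤ k := by exact_mod_cast hk
        linarith
    · have : (1 : ℝ) ≤ N := by exact_mod_cast hN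
      have hk : (0 : ℝ) ≤ k := k.cast_nonneg
      intro h; linarith
    · have hk : (0 : ℝ) ≤ k := k.cast_nonneg
      intro h; linarith
  obtain ⟨d, hd, hs, hs'⟩ := hasSum_ofScalars_of_radius_eq_one hrad (x := -z) (by simpa using hz)
  refine ⟨-d, ?_, ?_⟩
  · have := HasDerivAt.comp z hd (hasDerivAt_neg z)
    simpa using! this
  · obtain ⟨m, rfl⟩ : ∃ m, N = m + 1 := ⟨N - 1, by omega⟩
    have hbin := (hasSum_choose_mul_geometric_of_norm_lt_one (𝕜 := ℝ) m (r := -z)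
      (by simpa using hz)).mul_left δ
    have hcomb := (hs.mul_left δ).sub hs'
    have heq : (fun n : ℕ => δ * (((n + m).choose m : ℝ) * (-z) ^ n)) = fun n : ℕ =>
        δ * (ordinaryHypergeometricCoefficient (-δ) ((m + 1 : ℕ) : ℝ) (1 - δ) n * (-z) ^ n) -
        n * (ordinaryHypergeometricCoefficient (-δ) ((m + 1 : ℕ) : ℝ) (1 - δ) n * (-z) ^ n) := by
      funext n
      rw [← ascPochhammer_eval_natCast_div_factorial]
      conv_lhs => rw [← ascPochhammer_eval_neg_div h1 n]
      unfold ordinaryHypergeometricCoefficient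
      ring
    rw [heq] at hbin
    have huniq := hbin.unique hcomb
    have hsum : (FormalMultilinearSeries.ofScalars ℝ
        (ordinaryHypergeometricCoefficient (-δ) ((m + 1 : ℕ) : ℝ) (1 - δ))).sum (-z)
        = ordinaryHypergeometric (-δ) ((m + 1 : ℕ) : ℝ) (1 - δ) (-z) := rfl
    rw [hsum, sub_neg_eq_add, one_div] at huniq
    linear_combination huniq

/-- The form that Pfaff's transformation gives to `₂F₁(-δ, N; 1 - δ; -z)`. -/
def pfaffHyp (δ : ℝ) (N : ℕ) (z : ℝ) : ℝ :=
  ((1 + z) ^ N)⁻¹ * ordinaryHypergeometric (1 : ℝ) (N : ℝ) (1 - δ) (z / (1 + z))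

/-- The upper parameter 1 cancels the factorial, so the coefficients obey `(n + 1 - δ) c (n + 1) =
(n + N) c n`. A two-term recursion that is linear in `n` is a first order equation for the sum; its
inhomogeneity `-δ` is the contribution of index zero. -/
lemma hasDerivAt_pfaffSeries {δ : ℝ} (h1 : δ < 1) {N : ℕ} (hN : 1 ≤ N) {w : ℝ}
    (hw : |w| < 1) :
    ∃ d, HasDerivAt (fun w : ℝ => ordinaryHypergeometric (1 : ℝ) (N : ℝ) (1 - δ) w) d w ∧
      w * (1 - w) * d = (δ + N * w) * ordinaryHypergeometric (1 : ℝ) (N : ℝ) (1 - δ) w - δ := by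
  have hrad : (ordinaryHypergeometricSeries ℝ (1 : ℝ) (N : ℝ) (1 - δ)).radius = 1 := by
    have hN' : (1 : ℝ) ≤ N := by exact_mod_cast hN
    refine ordinaryHypergeometricSeries_radius_eq_one ℝ _ _ _ fun k => ?_
    have hk : (0 : ℝ) ≤ k := k.cast_nonneg
    refine ⟨?_, ?_, ?_⟩ <;> intro h <;> linarith
  obtain ⟨d, hd, hs, hs'⟩ := hasSum_ofScalars_of_radius_eq_one hrad hw
  refine ⟨d, hd, ?_⟩
  have hsum : (FormalMultilinearSeries.ofScalars ℝ
      (ordinaryHypergeometricCoefficient 1 (N : ℝ) (1 - δ))).sum w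
      = ordinaryHypergeometric (1 : ℝ) (N : ℝ) (1 - δ) w := rfl
  rw [hsum] at hs
  have hleft := (hasSum_nat_add_iff' 1).2 (hs'.sub (hs.mul_left δ))
  have hright := ((hs.mul_left (N : ℝ)).add hs').mul_left w
  have hone : ∀ n : ℕ, (ascPochhammer ℝ n).eval (1 : ℝ) = n.factorial := fun n =>
    ascPochhammer_eval_one ℝ n
  have heq : (fun n : ℕ => w * (N * (ordinaryHypergeometricCoefficient 1 (N : ℝ) (1 - δ) n * w ^ n)
      + n * (ordinaryHypergeometricCoefficient 1 (N : ℝ) (1 - δ) n * w ^ n))) = fun n : ℕ =>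
      ((n + 1 : ℕ) : ℝ) * (ordinaryHypergeometricCoefficient 1 (N : ℝ) (1 - δ) (n + 1)
        * w ^ (n + 1)) -
      δ * (ordinaryHypergeometricCoefficient 1 (N : ℝ) (1 - δ) (n + 1) * w ^ (n + 1)) := by
    funext n
    unfold ordinaryHypergeometricCoefficient
    rw [hone, hone, ascPochhammer_succ_eval, ascPochhammer_succ_eval]
    have e1 : (n.factorial : ℝ) ≠ 0 := by positivity
    have e2 : ((n + 1).factorial : ℝ) ≠ 0 := by positivity
    have e3 : (ascPochhammer ℝ n).eval (1 - δ) ≠ 0 := (ascPochhammer_pos n _ (by linarith)).ne'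
    have e4 : 1 - δ + n ≠ 0 := by have : (0 : ℝ) ≤ n := n.cast_nonneg; linarith
    push_cast
    field_simp
    ring
  rw [heq] at hright
  have huniq := hright.unique hleft
  simp [ordinaryHypergeometricCoefficient] at huniq
  linear_combination -huniq

/-- This is the equation of the Gauss series again, but on the whole half line: `z / (1 + z)` stays
in the disc of convergence for every `z ≥ 0`. -/
lemma hasDerivAt_pfaffHyp {δ : ℝ} (h1 : δ < 1) {N : ℕ} (hN : 1 ≤ N) {z : ℝ} (hz : 0 ≤ z) :
    ∃ d, HasDerivAt (pfaffHyp δ N) d z ∧ z * d = δ * (pfaffHyp δ N z - ((1 + z) ^ N)⁻¹) := by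
  have hz1 : (1 + z) ≠ 0 := by positivity
  have hw : |z / (1 + z)| < 1 := by
    rw [abs_of_nonneg (by positivity), div_lt_one (by positivity)]; linarith
  obtain ⟨d, hd, hode⟩ := hasDerivAt_pfaffSeries h1 hN hw
  set h := ordinaryHypergeometric (1 : ℝ) (N : ℝ) (1 - δ) (z / (1 + z)) with hh
  have hdiv : HasDerivAt (fun z : ℝ => z / (1 + z)) (1 / (1 + z) ^ 2) z := by
    have := (hasDerivAt_id z).div ((hasDerivAt_id z).const_add 1) hz1
    simpa using! this
  have hpow : HasDerivAt (fun z : ℝ => ((1 + z) ^ N)⁻¹)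
      (-(N * (1 + z) ^ (N - 1)) / ((1 + z) ^ N) ^ 2) z := by
    have := (((hasDerivAt_id z).const_add 1).pow N).inv (pow_ne_zero N hz1)
    simpa using! this
  have hcomp := HasDerivAt.comp z hd hdiv
  refine ⟨_, hpow.mul hcomp, ?_⟩
  obtain ⟨m, rfl⟩ : ∃ m, N = m + 1 := ⟨N - 1, by omega⟩
  simp only [pfaffHyp, ← hh, Nat.add_sub_cancel]
  have hode' : z * d = (1 + z) ^ 2 *
      ((δ + ((m + 1 : ℕ) : ℝ) * (z / (1 + z))) * h - δ) := by
    rw [← hode]; field_simp; ring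
  have : z * (((1 + z) ^ (m + 1))⁻¹ * (d * (1 / (1 + z) ^ 2)))
      = ((1 + z) ^ (m + 1))⁻¹ * (1 / (1 + z) ^ 2) * (z * d) := by ring
  rw [mul_add, this, hode']
  field_simp
  ring

/-- Pfaff's transformation for `₂F₁(-δ, N; 1 - δ; -z)`. -/
lemma gaussSeries_eq_pfaffHyp {δ : ℝ} (h0 : 0 < δ) (h1 : δ < 1) {N : ℕ} (hN : 1 ≤ N) {z : ℝ}
    (hz : 0 ≤ z) (hz1 : z < 1) :
    ordinaryHypergeometric (-δ) (N : ℝ) (1 - δ) (-z) = pfaffHyp δ N z := by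
  set D : ℝ → ℝ := fun z => ordinaryHypergeometric (-δ) (N : ℝ) (1 - δ) (-z) - pfaffHyp δ N z
    with hD
  have hder : ∀ y ∈ Set.Ico (0 : ℝ) 1, ∃ d, HasDerivAt D d y ∧ y * d = δ * D y := by
    intro y hy
    obtain ⟨d, hd, e⟩ := hasDerivAt_gaussSeries h0 h1 hN (z := y)
      (by rw [abs_of_nonneg hy.1]; exact hy.2)
    obtain ⟨d', hd', e'⟩ := hasDerivAt_pfaffHyp h1 hN hy.1
    refine ⟨d - d', hd.sub hd', ?_⟩
    simp only [hD]
    linear_combination e - e'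
  have hD0 : D 0 = 0 := by simp [hD, pfaffHyp]
  rcases hz.eq_or_lt with rfl | hzpos
  · simp [pfaffHyp]
  -- The difference of the two solutions satisfies `y D' = δ D`, so `D y * y ^ (-δ)` is constant.
  -- Since `D` is differentiable at `0` with `D 0 = 0`, it is `O(y)`, and `δ < 1` forces the
  -- constant to be zero.
  set q : ℝ → ℝ := fun y => D y * y ^ (-δ)
  have hq : ∀ y ∈ Set.Ioo (0 : ℝ) 1, HasDerivAt q 0 y := by
    intro y hy
    obtain ⟨d, hd, e⟩ := hder y ⟨hy.1.le, hy.2⟩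
    have hp := Real.hasDerivAt_rpow_const (x := y) (p := -δ) (Or.inl hy.1.ne')
    refine (hd.mul hp).congr_deriv ?_
    have : y ^ (-δ) = y * y ^ (-δ - 1) := by
      rw [Real.rpow_sub_one hy.1.ne', mul_div_cancel₀ _ hy.1.ne']
    rw [this]
    linear_combination (y ^ (-δ - 1)) * e
  have hconst : ∀ y ∈ Set.Ioo (0 : ℝ) 1, q y = q z := by
    intro y hy
    exact isOpen_Ioo.is_const_of_deriv_eq_zero isPreconnected_Ioo
      (fun x hx => (hq x hx).differentiableAt.differentiableWithinAt)
      (fun x hx => (hq x hx).deriv) hy ⟨hzpos, hz1⟩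
  have hlim : Tendsto q (𝓝[>] 0) (𝓝 0) := by
    obtain ⟨d, hd, -⟩ := hder 0 ⟨le_rfl, one_pos⟩
    have hsl := (hasDerivAt_iff_tendsto_slope_zero.1 hd).mono_left
      (nhdsWithin_mono 0 (fun x (hx : 0 < x) => hx.ne'))
    have hpw : Tendsto (fun y : ℝ => y ^ (1 - δ)) (𝓝[>] 0) (𝓝 0) := by
      have := (Real.continuousAt_rpow_const 0 (1 - δ) (Or.inr (by linarith))).tendsto
      rw [Real.zero_rpow (by linarith)] at this
      exact this.mono_left nhdsWithin_le_nhds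
    have := hsl.mul hpw
    rw [mul_zero] at this
    refine this.congr' ?_
    filter_upwards [self_mem_nhdsWithin] with y hy
    have hy : 0 < y := hy
    simp only [zero_add, hD0, sub_zero, smul_eq_mul, q]
    rw [sub_eq_add_neg, Real.rpow_add hy, Real.rpow_one]
    field_simp
  have hqz : q z = 0 := by
    refine tendsto_nhds_unique ?_ hlim
    refine tendsto_const_nhds.congr' ?_
    filter_upwards [Ioo_mem_nhdsGT (zero_lt_one' ℝ)] with y hy
    exact (hconst y hy).symm
  have : D z = 0 := by
    rcases mul_eq_zero.1 hqz with h | h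
    · exact h
    · exact absurd h (Real.rpow_pos_of_pos hzpos _).ne'
  exact sub_eq_zero.1 this

/-- Both branches in the definition of `gaussHyp` take Pfaff's form, so no separate argument is
needed where the series changes at `z = 1`. -/
lemma gaussHyp_eq_pfaffHyp {δ : ℝ} (h0 : 0 < δ) (h1 : δ < 1) {N : ℕ} (hN : 1 ≤ N) {z : ℝ}
    (hz : 0 ≤ z) : gaussHyp (-δ) N (1 - δ) (-z) = pfaffHyp δ N z := by
  unfold gaussHyp
  split_ifs with h
  · rw [abs_neg, abs_of_nonneg hz] at h
    exact gaussSeries_eq_pfaffHyp h0 h1 hN hz h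
  · rw [pfaffHyp, sub_neg_eq_add, Real.rpow_neg (by positivity), Real.rpow_natCast]
    congr 2
    · ring
    · rw [show -z - 1 = -(1 + z) by ring, neg_div_neg_eq]

end Hypergeometric

/-! ### The function `F` for both kinds of path loss exponent. -/

lemma F2_succ_eq (m : ℕ) {z : ℝ} (hz : 0 < z) :
    F2 (m + 1) z = ∑ k ∈ Finset.range m, z / (z + 1) ^ (k + 1) * ((m + 1) / (k + 1))
      - (1 - ((z + 1) ^ m)⁻¹) - z * Real.log (1 + 1 / z) * (m + 1) := by
  have h1 : ∑ c ∈ Finset.Icc 1 (m + 1 - 1),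
      z * ((m + 1 : ℕ) : ℝ) / ((z + 1) ^ (m + 1 - c) * (((m + 1 : ℕ) : ℝ) - c))
      = ∑ k ∈ Finset.range m, z / (z + 1) ^ (k + 1) * ((m + 1) / (k + 1)) := by
    refine Finset.sum_nbij' (fun c => m - c) (fun k => m - k) ?_ ?_ ?_ ?_ ?_
    · intro c hc; simp only [Finset.mem_Icc, Finset.mem_range] at hc ⊢; omega
    · intro k hk; simp only [Finset.mem_Icc, Finset.mem_range] at hk ⊢; omega
    · intro c hc; simp only [Finset.mem_Icc] at hc; omega
    · intro k hk; simp only [Finset.mem_range] at hk; omega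
    · intro c hc
      simp only [Finset.mem_Icc] at hc
      have e1 : m + 1 - c = m - c + 1 := by omega
      have e2 : ((m - c : ℕ) : ℝ) = m - c := by rw [Nat.cast_sub (by omega)]
      rw [e1, e2]
      push_cast
      rw [show (m : ℝ) + 1 - c = m - c + 1 by ring, mul_div_mul_comm]
  rw [F2, h1]
  have : (z + 1) ^ m ≠ 0 := by positivity
  push_cast
  field_simp

lemma sum_geometric_shift (m : ℕ) {z : ℝ} (hz : z + 1 ≠ 0) :
    ∑ k ∈ Finset.range m, z ^ 2 / (z + 1) ^ (k + 2) = z * ((z + 1)⁻¹ - ((z + 1) ^ (m + 1))⁻¹) := by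
  induction m with
  | zero => simp
  | succ m ih =>
    rw [Finset.sum_range_succ, ih]
    field_simp
    ring

/-- The differential equation of `F2`. -/
lemma hasDerivAt_F2 {N : ℕ} (hN : 1 ≤ N) {z : ℝ} (hz : 0 < z) :
    ∃ d, HasDerivAt (F2 N) d z ∧ z * d = F2 N z + 1 - ((1 + z) ^ N)⁻¹ := by
  obtain ⟨m, rfl⟩ : ∃ m, N = m + 1 := ⟨N - 1, by omega⟩
  have hz1 : z + 1 ≠ 0 := by positivity
  have hterm : ∀ k ∈ Finset.range m,
      HasDerivAt (fun z : ℝ => z / (z + 1) ^ (k + 1) * (((m : ℝ) + 1) / (k + 1)))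
        ((1 / (z + 1) ^ (k + 1) - (k + 1) * z / (z + 1) ^ (k + 2)) * ((m + 1) / (k + 1))) z := by
    intro k _
    refine ((((hasDerivAt_id z).div (((hasDerivAt_id z).add_const 1).pow (k + 1))
      (pow_ne_zero _ hz1)).mul_const _)).congr_deriv ?_
    simp only [id, Nat.add_sub_cancel, Pi.pow_apply]
    push_cast
    field_simp
    ring
  have hsum := HasDerivAt.fun_sum hterm
  have hinv : HasDerivAt (fun z : ℝ => 1 - ((z + 1) ^ m)⁻¹) (m / (z + 1) ^ (m + 1)) z := by
    refine (((((hasDerivAt_id z).add_const 1).pow m).inv (pow_ne_zero _ hz1)).const_sub 1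
      ).congr_deriv ?_
    simp only [id, Pi.pow_apply]
    rcases m with _ | m
    · simp
    · rw [Nat.add_sub_cancel]
      push_cast
      field_simp
      ring
  have hlog : HasDerivAt (fun z : ℝ => z * Real.log (1 + 1 / z) * ((m : ℝ) + 1))
      ((Real.log (1 + 1 / z) - 1 / (z + 1)) * (m + 1)) z := by
    have h1 : HasDerivAt (fun z : ℝ => 1 + 1 / z) (-1 / z ^ 2) z := by
      have := ((hasDerivAt_inv hz.ne').const_add 1)
      simp only [one_div]
      exact this.congr_deriv (by ring)
    have h2 := h1.log (by positivity)
    refine (((hasDerivAt_id z).mul h2).mul_const _).congr_deriv ?_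
    simp only [id]
    field_simp
    ring
  refine ⟨_, ((hsum.sub hinv).sub hlog).congr_of_eventuallyEq ?_, ?_⟩
  · filter_upwards [lt_mem_nhds hz] with y hy
    exact F2_succ_eq m hy
  · rw [F2_succ_eq m hz]
    -- In `z` times the derivative, the factor `k + 1` cancels the denominators of the second part;
    -- what is left besides the original sum is geometric.
    have hd : ∑ k ∈ Finset.range m,
        z * ((1 / (z + 1) ^ (k + 1) - (k + 1) * z / (z + 1) ^ (k + 2)) * (((m : ℝ) + 1) / (k + 1)))
        = ∑ k ∈ Finset.range m, z / (z + 1) ^ (k + 1) * (((m : ℝ) + 1) / (k + 1))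
          - (m + 1) * (z * ((z + 1)⁻¹ - ((z + 1) ^ (m + 1))⁻¹)) := by
      rw [← sum_geometric_shift m hz1, Finset.mul_sum, ← Finset.sum_sub_distrib]
      refine Finset.sum_congr rfl fun k _ => ?_
      have : (k : ℝ) + 1 ≠ 0 := by positivity
      field_simp
    rw [mul_sub, mul_sub, Finset.mul_sum, hd, add_comm 1 z]
    field_simp
    ring

namespace Params

variable (p : Params)

lemma two_le_α (κ : Link) : 2 ≤ p.α κ := by
  cases κ
  · exact p.α_LOS
  · exact p.α_NLOS.le

lemma ρ_pos : 0 < p.ρ := Real.sqrt_pos.2 (mul_pos p.βa_pos p.βb_pos)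

lemma N_cast_pos (κ : Link) : (0 : ℝ) < p.N κ := by exact_mod_cast p.N_pos κ

lemma F_zero (κ : Link) : p.F κ 0 = 0 := by
  unfold F
  split_ifs with h
  · simp [F2]
  · simp [gaussHyp]

/-- With `δ = 2 / α`, the logarithmic case `α = 2` satisfies the same equation as the hypergeometric
one. Later arguments need nothing else about `F` at positive arguments. -/
lemma hasDerivAt_F (κ : Link) {z : ℝ} (hz : 0 < z) :
    ∃ d, HasDerivAt (p.F κ) d z ∧
      z * d = 2 / p.α κ * (p.F κ z + 1 - ((1 + z) ^ p.N κ)⁻¹) := by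
  by_cases h : p.α κ = 2
  · have hF : p.F κ = F2 (p.N κ) := by funext z; simp [F, h]
    rw [hF, h]
    simpa using hasDerivAt_F2 (p.N_pos κ) hz
  · have hα : 2 < p.α κ := lt_of_le_of_ne (p.two_le_α κ) (Ne.symm h)
    have h0 : 0 < 2 / p.α κ := by positivity
    have h1 : 2 / p.α κ < 1 := by rw [div_lt_one (by linarith)]; exact hα
    have hF : ∀ z, 0 ≤ z → p.F κ z = pfaffHyp (2 / p.α κ) (p.N κ) z - 1 := by
      intro z hz
      simp only [F, h, if_false]
      rw [neg_div, gaussHyp_eq_pfaffHyp h0 h1 (p.N_pos κ) hz]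
    obtain ⟨d, hd, e⟩ := hasDerivAt_pfaffHyp h1 (p.N_pos κ) hz.le
    refine ⟨d, (hd.sub_const 1).congr_of_eventuallyEq ?_, ?_⟩
    · filter_upwards [lt_mem_nhds hz] with y hy using hF y hy.le
    · rw [e, hF z hz.le]; ring

/-! ### Laplace transform of a single link, and its integral over a ring. -/

/-- The squared length of a link over the horizontal distance `u`. -/
def sqDist (u : ℝ) : ℝ := u ^ 2 + p.Δh ^ 2

lemma sqDist_pos {u : ℝ} (hu : 0 < u) : 0 < p.sqDist u := by unfold sqDist; positivity

/-- The relative power of an interferer at distance `u`, which is the argument of `F`. -/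
def relPower (κ : Link) (s G u : ℝ) : ℝ :=
  s * p.C κ * G / (p.N κ * (u ^ 2 + p.Δh ^ 2) ^ (p.α κ / 2))

/-- One minus the Laplace transform, at `s`, of the power received from a link in state `κ` of
horizontal length `u` and gain `G`. -/
def loss (κ : Link) (s G u : ℝ) : ℝ :=
  1 - ((1 + p.relPower κ s G u) ^ p.N κ)⁻¹

variable {p}

lemma relPower_nonneg {κ : Link} {s G : ℝ} (hs : 0 ≤ s) (hG : 0 ≤ G) (u : ℝ) :
    0 ≤ p.relPower κ s G u := by
  have := (p.C_pos κ).le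
  unfold relPower
  positivity

lemma loss_nonneg {κ : Link} {s G : ℝ} (hs : 0 ≤ s) (hG : 0 ≤ G) (u : ℝ) :
    0 ≤ p.loss κ s G u := by
  have := relPower_nonneg (p := p) (κ := κ) hs hG u
  rw [loss, sub_nonneg]
  exact inv_le_one_of_one_le₀ (one_le_pow₀ (by linarith))

lemma loss_lt_one {κ : Link} {s G : ℝ} (hs : 0 ≤ s) (hG : 0 ≤ G) (u : ℝ) :
    p.loss κ s G u < 1 := by
  have := relPower_nonneg (p := p) (κ := κ) hs hG u
  have : 0 < ((1 + p.relPower κ s G u) ^ p.N κ)⁻¹ := by positivity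
  rw [loss]; linarith

lemma loss_mono {κ : Link} {s t G : ℝ} (hs : 0 ≤ s) (hst : s ≤ t) (hG : 0 ≤ G) (u : ℝ) :
    p.loss κ s G u ≤ p.loss κ t G u := by
  have h0 := relPower_nonneg (p := p) (κ := κ) hs hG u
  have h1 : p.relPower κ s G u ≤ p.relPower κ t G u := by
    have := (p.C_pos κ).le
    unfold relPower
    gcongr
  unfold loss
  gcongr

/-- Bernoulli's inequality gives `1 - (1 + z)^{-N} ≤ N z`, and this `N` cancels the one in
`relPower`; omitting the height difference only enlarges the bound. The power decay gives
integrability at infinity when the exponent exceeds 2. -/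
lemma loss_le {κ : Link} {s G : ℝ} (hs : 0 ≤ s) (hG : 0 ≤ G) {u : ℝ} (hu : 0 < u) :
    p.loss κ s G u ≤ s * p.C κ * G * u ^ (-p.α κ) := by
  have h0 := relPower_nonneg (p := p) (κ := κ) hs hG u
  have hN := p.N_cast_pos κ
  have hC := (p.C_pos κ).le
  have h1 : p.loss κ s G u ≤ p.N κ * p.relPower κ s G u := by
    set z := p.relPower κ s G u
    have hz : (1 + z)⁻¹ = 1 + -(z / (1 + z)) := by field_simp; ring
    have hz1 : z / (1 + z) ≤ z := div_le_self h0 (by linarith)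
    have hz2 : z / (1 + z) ≤ 1 := (div_le_one (by positivity)).2 (by linarith)
    have hb := one_add_mul_le_pow (a := -(z / (1 + z))) (by linarith) (p.N κ)
    rw [← hz, inv_pow] at hb
    have := mul_le_mul_of_nonneg_left hz1 hN.le
    rw [loss]; linarith
  refine h1.trans ?_
  have hx : u ^ p.α κ ≤ (u ^ 2 + p.Δh ^ 2) ^ (p.α κ / 2) := by
    have : u ^ p.α κ = (u ^ 2) ^ (p.α κ / 2) := by
      rw [← Real.rpow_natCast, ← Real.rpow_mul hu.le]; congr 1; push_cast; ring
    rw [this]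
    have := p.two_le_α κ
    exact Real.rpow_le_rpow (by positivity) (by nlinarith [sq_nonneg p.Δh]) (by linarith)
  have hu' : 0 < u ^ p.α κ := Real.rpow_pos_of_pos hu _
  rw [relPower, Real.rpow_neg hu.le, ← div_eq_mul_inv]
  rw [mul_div_assoc', mul_div_mul_left _ _ hN.ne']
  gcongr

lemma continuousAt_relPower {κ : Link} {s G u : ℝ} (hu : 0 < u) :
    ContinuousAt (fun y : ℝ × ℝ => p.relPower κ y.1 G y.2) (s, u) := by
  have hx : u ^ 2 + p.Δh ^ 2 ≠ 0 := (p.sqDist_pos hu).ne'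
  have hx' : (u ^ 2 + p.Δh ^ 2) ^ (p.α κ / 2) ≠ 0 :=
    (Real.rpow_pos_of_pos (p.sqDist_pos hu) _).ne'
  unfold relPower
  refine ContinuousAt.div (by fun_prop) (ContinuousAt.mul continuousAt_const
    (ContinuousAt.rpow_const (by fun_prop) (Or.inl hx))) ?_
  exact mul_ne_zero (p.N_cast_pos κ).ne' hx'

lemma continuousAt_loss {κ : Link} {s G u : ℝ} (hs : 0 ≤ s) (hG : 0 ≤ G) (hu : 0 < u) :
    ContinuousAt (fun y : ℝ × ℝ => p.loss κ y.1 G y.2) (s, u) := by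
  have h0 := relPower_nonneg (p := p) (κ := κ) hs hG u
  unfold loss
  refine continuousAt_const.sub (ContinuousAt.inv₀ ((continuousAt_const.add
    (continuousAt_relPower hu)).pow _) ?_)
  simp only
  positivity

lemma measurable_loss (κ : Link) (G : ℝ) :
    Measurable (fun y : ℝ × ℝ => p.loss κ y.1 G y.2) := by
  unfold loss relPower
  fun_prop

/-- `Z` is the integral of `loss` over a ring. -/
lemma Z_eq_integral (κ : Link) {s G a b : ℝ} (hs : 0 ≤ s) (hG : 0 ≤ G) (ha : 0 < a)
    (hab : a ≤ b) : p.Z κ s a b G = ∫ u in a..b, u * p.loss κ s G u := by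
  have hC := p.C_pos κ
  have hα := p.two_le_α κ
  have hN := p.N_cast_pos κ
  -- The differential equation of `F` is available only for positive arguments; a vanishing relative
  -- power makes both sides zero.
  rcases (mul_nonneg (mul_nonneg hs hC.le) hG).eq_or_lt with h0 | hpos
  · have : ∀ u, p.loss κ s G u = 0 := fun u => by simp [loss, relPower, ← h0]
    simp [Z, ← h0, F_zero, this]
  -- With `x = u² + Δh²` and `z` proportional to `x^{-α/2}`, one has `dz/du = -(α u / x) z`. The
  -- derivative of `-(x / 2) F(z)` is therefore `-u F + (α u / 2) z F'(z)`, where the differential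
  -- equation cancels `F`.
  set Φ : ℝ → ℝ := fun u => -((u ^ 2 + p.Δh ^ 2) / 2 * p.F κ (p.relPower κ s G u)) with hΦ
  have hder : ∀ u, 0 < u → HasDerivAt Φ (u * p.loss κ s G u) u := by
    intro u hu
    have hx := p.sqDist_pos hu
    unfold sqDist at hx
    have hrp : 0 < p.relPower κ s G u := by unfold relPower; positivity
    obtain ⟨d, hd, e⟩ := p.hasDerivAt_F κ hrp
    have h1 : HasDerivAt (fun u : ℝ => u ^ 2 + p.Δh ^ 2) (2 * u) u := by
      simpa using! (hasDerivAt_pow 2 u).add_const (p.Δh ^ 2)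
    have h2 : HasDerivAt (fun u : ℝ => p.relPower κ s G u)
        (-(p.α κ * u / (u ^ 2 + p.Δh ^ 2)) * p.relPower κ s G u) u := by
      have hp := (h1.rpow_const (p := p.α κ / 2) (Or.inl hx.ne')).const_mul (p.N κ : ℝ)
      have hxr : 0 < (u ^ 2 + p.Δh ^ 2) ^ (p.α κ / 2) := Real.rpow_pos_of_pos hx _
      refine ((hasDerivAt_const u (s * p.C κ * G)).div hp (by positivity)).congr_deriv ?_
      rw [Real.rpow_sub_one hx.ne', relPower]
      field_simp
      ring
    have h3 : HasDerivAt (fun u : ℝ => p.F κ (p.relPower κ s G u)) _ u := HasDerivAt.comp u hd h2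
    refine ((h1.div_const 2).mul h3).neg.congr_deriv ?_
    have e2 : d * (-(p.α κ * u / (u ^ 2 + p.Δh ^ 2)) * p.relPower κ s G u)
        = -(p.α κ * u / (u ^ 2 + p.Δh ^ 2)) * (p.relPower κ s G u * d) := by ring
    rw [e2, e, loss]
    field_simp
    ring
  have hsub : Set.uIcc a b ⊆ Set.Ioi 0 := by
    rw [Set.uIcc_of_le hab]; intro x hx; exact ha.trans_le hx.1
  rw [intervalIntegral.integral_eq_sub_of_hasDerivAt (fun u hu => hder u (hsub hu))]
  · simp only [hΦ, Z, relPower]; ring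
  · refine ContinuousOn.intervalIntegrable fun u hu => ContinuousAt.continuousWithinAt ?_
    exact continuousAt_id.mul (ContinuousAt.comp (f := fun u => (s, u))
      (continuousAt_loss hs hG (hsub hu)) (by fun_prop))

/-! ### Blockage probabilities and integrability of the thinned loss. -/

lemma prob_add_prob (j : ℕ) : p.prob Link.LOS j + p.prob Link.NLOS j = 1 := by
  simp [prob]

lemma pLOS_factor_mem (γ n : ℕ) : 1 - Real.exp (-((γ * max p.hv p.hb
    - (n + 1 / 2) * |p.hv - p.hb|) ^ 2 / (2 * p.ε ^ 2 * γ ^ 2))) ∈ Set.Icc (0 : ℝ) 1 := by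
  have h1 := Real.exp_pos (-((γ * max p.hv p.hb
    - (n + 1 / 2) * |p.hv - p.hb|) ^ 2 / (2 * p.ε ^ 2 * γ ^ 2)))
  have h2 : Real.exp (-((γ * max p.hv p.hb
      - (n + 1 / 2) * |p.hv - p.hb|) ^ 2 / (2 * p.ε ^ 2 * γ ^ 2))) ≤ 1 := by
    rw [Real.exp_le_one_iff, neg_nonpos]; positivity
  constructor <;> linarith

lemma pLOS_nonneg (γ : ℕ) : 0 ≤ p.pLOS γ := by
  unfold pLOS
  split_ifs
  · exact zero_le_one
  · exact Finset.prod_nonneg fun n _ => (pLOS_factor_mem γ n).1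

lemma pLOS_le_one (γ : ℕ) : p.pLOS γ ≤ 1 := by
  unfold pLOS
  split_ifs
  · exact le_rfl
  · exact Finset.prod_le_one (fun n _ => (pLOS_factor_mem γ n).1)
      fun n _ => (pLOS_factor_mem γ n).2

lemma prob_nonneg (κ : Link) (γ : ℕ) : 0 ≤ p.prob κ γ := by
  cases κ
  · exact pLOS_nonneg γ
  · exact sub_nonneg.2 (pLOS_le_one γ)

lemma prob_le_one (κ : Link) (γ : ℕ) : p.prob κ γ ≤ 1 := by
  have h := prob_add_prob (p := p) γ
  have h1 := prob_nonneg (p := p) Link.LOS γ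
  have h2 := prob_nonneg (p := p) Link.NLOS γ
  cases κ <;> linarith

/-- The LOS probability decays exponentially with the blockage level. -/
lemma exists_pLOS_le_exp (p : Params) :
    ∃ θ > 0, ∀ γ : ℕ, p.pLOS γ ≤ Real.exp (-(θ * γ)) := by
  -- `B` bounds the exponents of all factors, uniformly in `γ ≥ 1` and `n ≤ γ`, because then `n +
  -- 1/2 ≤ 2γ`. Each of the `γ + 1` factors is at most `1 - e^{-B} ≤ exp (-e^{-B})`, which gives the
  -- rate `e^{-B}`.
  set B := (max p.hv p.hb + 2 * |p.hv - p.hb|) ^ 2 / (2 * p.ε ^ 2) with hB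
  have hε := p.ε_pos
  have hmax : 0 ≤ max p.hv p.hb := le_max_of_le_left p.hv_nonneg
  refine ⟨Real.exp (-B), Real.exp_pos _, fun γ => ?_⟩
  unfold pLOS
  split_ifs with h
  · simp [h]
  have hγ : (1 : ℝ) ≤ γ := by exact_mod_cast Nat.one_le_iff_ne_zero.2 h
  have hfac : ∀ n ∈ Finset.range (γ + 1), 1 - Real.exp (-((γ * max p.hv p.hb
      - (n + 1 / 2) * |p.hv - p.hb|) ^ 2 / (2 * p.ε ^ 2 * γ ^ 2))) ≤
      Real.exp (-Real.exp (-B)) := by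
    intro n hn
    have hn' : (n : ℝ) ≤ γ := by exact_mod_cast Nat.lt_succ_iff.1 (Finset.mem_range.1 hn)
    have hle : (γ * max p.hv p.hb - (n + 1 / 2) * |p.hv - p.hb|) ^ 2 / (2 * p.ε ^ 2 * γ ^ 2)
        ≤ B := by
      rw [hB, div_le_div_iff₀ (by positivity) (by positivity)]
      have habs : |γ * max p.hv p.hb - (n + 1 / 2) * (|p.hv - p.hb|)|
          ≤ γ * (max p.hv p.hb + 2 * |p.hv - p.hb|) := by
        have hd := abs_nonneg (p.hv - p.hb)
        have hn0 : (0 : ℝ) ≤ n := n.cast_nonneg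
        rw [abs_le]
        constructor <;> nlinarith
      have hsq := sq_le_sq' (abs_le.1 habs).1 (abs_le.1 habs).2
      have : 0 ≤ 2 * p.ε ^ 2 := by positivity
      nlinarith [mul_le_mul_of_nonneg_right hsq this]
    have h1 : Real.exp (-B) ≤ Real.exp (-((γ * max p.hv p.hb
      - (n + 1 / 2) * |p.hv - p.hb|) ^ 2 / (2 * p.ε ^ 2 * γ ^ 2))) :=
      Real.exp_le_exp.2 (neg_le_neg hle)
    have h2 := Real.add_one_le_exp (-Real.exp (-B))
    linarith
  refine (Finset.prod_le_prod (fun n _ => (pLOS_factor_mem γ n).1) hfac).trans ?_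
  rw [Finset.prod_const, Finset.card_range, ← Real.exp_nat_mul, Real.exp_le_exp]
  push_cast
  nlinarith [Real.exp_pos (-B)]

lemma measurable_level (p : Params) : Measurable p.level :=
  Nat.measurable_floor.comp (measurable_id.mul_const _)

lemma measurable_prob_level (κ : Link) : Measurable (fun u => p.prob κ (p.level u)) :=
  (measurable_from_nat (f := p.prob κ)).comp p.measurable_level

lemma level_eq {u : ℝ} {j : ℕ} (h1 : j / p.ρ ≤ u) (h2 : u < (j + 1) / p.ρ) : p.level u = j := by
  rw [level, Nat.floor_eq_iff]
  · exact ⟨(div_le_iff₀ p.ρ_pos).1 h1, (lt_div_iff₀ p.ρ_pos).1 h2⟩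
  · have : 0 ≤ u := le_trans (div_nonneg j.cast_nonneg p.ρ_pos.le) h1
    exact mul_nonneg this p.ρ_pos.le

lemma level_div_le {r : ℝ} (hr : 0 ≤ r) : p.level r / p.ρ ≤ r := by
  rw [div_le_iff₀ p.ρ_pos]
  exact Nat.floor_le (mul_nonneg hr p.ρ_pos.le)

lemma lt_level_add_one_div (r : ℝ) : r < (p.level r + 1) / p.ρ := by
  rw [lt_div_iff₀ p.ρ_pos]
  exact Nat.lt_floor_add_one _

/-- The integrand of `Θ`. -/
def thinnedLoss (p : Params) (κ : Link) (s G u : ℝ) : ℝ :=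
  u * (p.prob κ (p.level u) * p.loss κ s G u)

lemma measurable_thinnedLoss (κ : Link) (s G : ℝ) : Measurable (p.thinnedLoss κ s G) :=
  measurable_id.mul ((measurable_prob_level κ).mul
    ((measurable_loss κ G).comp measurable_prodMk_left))

lemma thinnedLoss_nonneg {κ : Link} {s G : ℝ} (hs : 0 ≤ s) (hG : 0 ≤ G) {u : ℝ} (hu : 0 ≤ u) :
    0 ≤ p.thinnedLoss κ s G u :=
  mul_nonneg hu (mul_nonneg (prob_nonneg _ _) (loss_nonneg hs hG u))

/-- The two states converge for different reasons. The LOS exponent may equal 2, where the power law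
alone diverges logarithmically, so the exponential decay of the LOS probability is used; for NLOS
links the exponent above 2 suffices. -/
lemma integrableOn_thinnedLoss (κ : Link) {s G : ℝ} (hs : 0 ≤ s) (hG : 0 ≤ G) :
    IntegrableOn (p.thinnedLoss κ s G) (Set.Ioi 0) := by
  have hmeas := (measurable_thinnedLoss (p := p) κ s G).aestronglyMeasurable
    (μ := volume)
  have hnorm : ∀ u, 0 < u → ‖p.thinnedLoss κ s G u‖ = p.thinnedLoss κ s G u := fun u hu =>
    Real.norm_of_nonneg (thinnedLoss_nonneg hs hG hu.le)
  cases κ with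
  | LOS =>
    obtain ⟨θ, hθ, hle⟩ := exists_pLOS_le_exp p
    have hint := integrableOn_rpow_mul_exp_neg_mul_rpow (p := 1) (s := 1) (b := θ * p.ρ)
      (by norm_num) (by norm_num) (mul_pos hθ p.ρ_pos)
    refine Integrable.mono' (hint.const_mul (Real.exp θ)) hmeas.restrict ?_
    filter_upwards [ae_restrict_mem measurableSet_Ioi] with u hu
    have hu : 0 < u := hu
    rw [hnorm u hu, Real.rpow_one, thinnedLoss]
    -- The level may fall short of `u * ρ` by up to one, hence the factor `exp θ`.
    have h1 : p.prob Link.LOS (p.level u) ≤ Real.exp θ * Real.exp (-(θ * p.ρ) * u) := by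
      refine (hle _).trans ?_
      rw [← Real.exp_add, Real.exp_le_exp]
      have := Nat.lt_floor_add_one (u * p.ρ)
      unfold level
      nlinarith
    have h2 := (loss_lt_one (p := p) (κ := Link.LOS) hs hG u).le
    have h3 := loss_nonneg (p := p) (κ := Link.LOS) hs hG u
    calc u * (p.prob Link.LOS (p.level u) * p.loss Link.LOS s G u)
        ≤ u * ((Real.exp θ * Real.exp (-(θ * p.ρ) * u)) * 1) := by gcongr
      _ = _ := by ring
  | NLOS =>
    have hα := p.α_NLOS
    rw [← Set.Ioc_union_Ioi_eq_Ioi zero_le_one]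
    refine IntegrableOn.union ?_ ?_
    · refine Integrable.mono' (g := fun _ => (1 : ℝ)) (by simp) hmeas.restrict ?_
      filter_upwards [ae_restrict_mem measurableSet_Ioc] with u hu
      rw [hnorm u hu.1, thinnedLoss]
      have h1 := prob_le_one (p := p) Link.NLOS (p.level u)
      have h2 := (loss_lt_one (p := p) (κ := Link.NLOS) hs hG u).le
      have h3 := loss_nonneg (p := p) (κ := Link.NLOS) hs hG u
      exact mul_le_one₀ hu.2 (mul_nonneg (prob_nonneg _ _) h3) (mul_le_one₀ h1 h3 h2)
    · have hint := integrableOn_Ioi_rpow_of_lt (a := 1 - p.α Link.NLOS) (by linarith) one_pos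
      refine Integrable.mono' (hint.const_mul (s * p.C Link.NLOS * G)) hmeas.restrict ?_
      filter_upwards [ae_restrict_mem measurableSet_Ioi] with u hu
      have hu : 0 < u := zero_lt_one.trans hu
      rw [hnorm u hu, thinnedLoss]
      have h1 := prob_le_one (p := p) Link.NLOS (p.level u)
      have h2 := loss_le (p := p) (κ := Link.NLOS) hs hG hu
      have h3 := loss_nonneg (p := p) (κ := Link.NLOS) hs hG u
      calc u * (p.prob Link.NLOS (p.level u) * p.loss Link.NLOS s G u)
          ≤ u * (1 * (s * p.C Link.NLOS * G * u ^ (-p.α Link.NLOS))) := by gcongr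
        _ = s * p.C Link.NLOS * G * u ^ (1 - p.α Link.NLOS) := by
          rw [sub_eq_add_neg, Real.rpow_add hu, Real.rpow_one]; ring

end Params

/-! ### The closed form of the Laplace transform as an integral over a half line. -/

/-- The integral over a half line as the sum of the integrals over the cells of a grid. -/
lemma hasSum_integral_grid {f : ℝ → ℝ} {ρ : ℝ} (hρ : 0 < ρ) (n : ℕ)
    (hf : IntegrableOn f (Set.Ioi (n / ρ))) :
    HasSum (fun j : ℕ => ∫ u in ((n + j : ℕ) : ℝ) / ρ..(((n + j : ℕ) : ℝ) + 1) / ρ, f u)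
      (∫ u in Set.Ioi (n / ρ), f u) := by
  set g : ℕ → ℝ := fun j => ((n + j : ℕ) : ℝ) / ρ with hg
  have hmono : Monotone g := fun i j hij => by
    simp only [hg]
    have : ((n + i : ℕ) : ℝ) ≤ ((n + j : ℕ) : ℝ) := by exact_mod_cast Nat.add_le_add_left hij n
    gcongr
  have hunion : ⋃ j, Set.Ioc (g j) (g (Order.succ j)) = Set.Ioi (n / ρ) := by
    have := iUnion_Ioc_map_succ_eq_Ioi (f := g) (fun j => hmono (Nat.zero_le j)) (fun h => ?_)
    · simpa [hg] using this
    · obtain ⟨x, hx⟩ := h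
      obtain ⟨j, hj⟩ := exists_nat_gt (x * ρ)
      have h1 : g j ≤ x := hx ⟨j, rfl⟩
      simp only [hg] at h1
      rw [div_le_iff₀ hρ] at h1
      push_cast at h1
      have : (0 : ℝ) ≤ n := n.cast_nonneg
      linarith
  have := hasSum_integral_iUnion (μ := volume) (f := f) (fun j => measurableSet_Ioc)
    hmono.pairwise_disjoint_on_Ioc_succ (by rw [hunion]; exact hf)
  rw [hunion] at this
  convert! this using 2 with j
  have hle : g j ≤ g (Order.succ j) := hmono (Order.le_succ j)
  rw [← intervalIntegral.integral_of_le hle]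
  simp [hg, add_assoc]

namespace Params

variable {p : Params}

lemma gain_nonneg (i : Fin 4) : 0 ≤ p.gain i := by
  have := p.Mt_pos.le; have := p.Mr_pos.le; have := p.mt_nonneg; have := p.mr_nonneg
  fin_cases i <;> simp [gain] <;> positivity

lemma gain_zero_pos (p : Params) : 0 < p.gain 0 := mul_pos p.Mt_pos p.Mr_pos

lemma q_mem {a b : ℝ} (ha : a ∈ Set.Icc 0 (2 * Real.pi)) (hb : b ∈ Set.Icc 0 Real.pi) :
    a / (2 * Real.pi) * (b / Real.pi) ∈ Set.Icc (0 : ℝ) 1 := by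
  have hπ := Real.pi_pos
  have h1 : 0 ≤ a / (2 * Real.pi) := div_nonneg ha.1 (by positivity)
  have h2 : 0 ≤ b / Real.pi := div_nonneg hb.1 hπ.le
  exact ⟨mul_nonneg h1 h2, mul_le_one₀ ((div_le_one (by positivity)).2 ha.2) h2
    ((div_le_one hπ).2 hb.2)⟩

lemma gainProb_nonneg (i : Fin 4) : 0 ≤ p.gainProb i := by
  have ht : p.qt ∈ Set.Icc (0 : ℝ) 1 := q_mem p.θta_mem p.θte_mem
  have hr : p.qr ∈ Set.Icc (0 : ℝ) 1 := q_mem p.θra_mem p.θre_mem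
  have h1 := ht.1; have h2 := sub_nonneg.2 ht.2; have h3 := hr.1; have h4 := sub_nonneg.2 hr.2
  fin_cases i <;> simp only [gainProb] <;> first | exact mul_nonneg h1 h3 | exact mul_nonneg h2 h3 | exact mul_nonneg h1 h4 | exact mul_nonneg h2 h4

lemma sum_gainProb (p : Params) : ∑ i, p.gainProb i = 1 := by
  simp [Fin.sum_univ_four, gainProb]; ring

/-- The blockage level is constant inside a ring, so the probability can be moved under the
integral. The level may jump at the right end, which is why both integrals are taken over the open
interval. -/
lemma prob_mul_Z_eq (κ : Link) {s G a b : ℝ} (hs : 0 ≤ s) (hG : 0 ≤ G) (ha : 0 < a)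
    (hab : a ≤ b) {j : ℕ} (hj : j / p.ρ ≤ a) (hb : b ≤ (j + 1) / p.ρ) :
    p.prob κ j * p.Z κ s a b G = ∫ u in a..b, p.thinnedLoss κ s G u := by
  rw [Z_eq_integral κ hs hG ha hab, ← intervalIntegral.integral_const_mul,
    intervalIntegral.integral_of_le hab, intervalIntegral.integral_of_le hab,
    integral_Ioc_eq_integral_Ioo, integral_Ioc_eq_integral_Ioo]
  refine setIntegral_congr_fun measurableSet_Ioo fun u hu => ?_
  simp only [thinnedLoss]
  rw [level_eq (hj.trans hu.1.le) (hu.2.trans_le hb)]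
  ring

lemma ringTerm_eq_integral (κ : Link) {s : ℝ} (hs : 0 ≤ s) (i : Fin 4) {j : ℕ} (hj : 1 ≤ j) :
    p.ringTerm κ s i j = ∫ u in (j : ℝ) / p.ρ..((j : ℝ) + 1) / p.ρ,
      p.thinnedLoss κ s (p.gain i) u := by
  have hj' : (0 : ℝ) < j := by exact_mod_cast hj
  have hρ := p.ρ_pos
  exact prob_mul_Z_eq κ hs (gain_nonneg i) (by positivity) (by gcongr; linarith) le_rfl le_rfl

lemma hasSum_ringTerm (κ : Link) {s : ℝ} (hs : 0 ≤ s) (i : Fin 4) {n : ℕ} (hn : 1 ≤ n) :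
    HasSum (fun j => p.ringTerm κ s i (n + j))
      (∫ u in Set.Ioi (n / p.ρ), p.thinnedLoss κ s (p.gain i) u) := by
  have hint : IntegrableOn (p.thinnedLoss κ s (p.gain i)) (Set.Ioi (n / p.ρ)) :=
    (integrableOn_thinnedLoss κ hs (gain_nonneg i)).mono_set
      (Set.Ioi_subset_Ioi (div_nonneg n.cast_nonneg p.ρ_pos.le))
  have := hasSum_integral_grid p.ρ_pos n hint
  convert! this using 2 with j
  exact ringTerm_eq_integral κ hs i (by omega)

lemma summable_ringTerm (κ : Link) {s : ℝ} (hs : 0 ≤ s) (i : Fin 4) :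
    Summable (p.ringTerm κ s i) := by
  have := (hasSum_ringTerm (p := p) κ hs i le_rfl).summable
  simp only [add_comm 1] at this
  exact (summable_nat_add_iff 1).1 this

/-- The rest of the ring that contains `r`, and the complete rings after it, tile the half line
beyond `r`. Starting the series at `level r + 1 ≥ 1` keeps all left ends positive. -/
lemma Θ_eq_integral (κ : Link) {s : ℝ} (hs : 0 ≤ s) (i : Fin 4) {r : ℝ} (hr : 0 < r) :
    p.Θ κ s i r = ∫ u in Set.Ioi r, p.thinnedLoss κ s (p.gain i) u := by
  have h1 := (hasSum_ringTerm (p := p) κ hs i (n := p.level r + 1) (by omega)).tsum_eq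
  have hlt := (p.lt_level_add_one_div r).le
  have hint := integrableOn_thinnedLoss (p := p) κ hs (gain_nonneg (p := p) i)
  rw [Θ, h1, prob_mul_Z_eq κ hs (gain_nonneg i) hr hlt (level_div_le hr.le) le_rfl]
  push_cast
  exact intervalIntegral.integral_interval_add_Ioi
    (hint.mono_set (Set.Ioi_subset_Ioi hr.le)) (hint.mono_set (Set.Ioi_subset_Ioi (hr.le.trans hlt)))

/-- One minus the Laplace transform, at `s`, of the power received from an interferer at the
horizontal distance `u`. -/
def meanLoss (p : Params) (s u : ℝ) : ℝ :=
  ∑ i, p.gainProb i * (p.prob Link.LOS (p.level u) * p.loss Link.LOS s (p.gain i) u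
    + p.prob Link.NLOS (p.level u) * p.loss Link.NLOS s (p.gain i) u)

lemma mul_meanLoss (s u : ℝ) : u * p.meanLoss s u = ∑ i, p.gainProb i *
    (p.thinnedLoss Link.LOS s (p.gain i) u + p.thinnedLoss Link.NLOS s (p.gain i) u) := by
  simp only [meanLoss, thinnedLoss, Finset.mul_sum]
  exact Finset.sum_congr rfl fun i _ => by ring

lemma integrableOn_mul_meanLoss {s : ℝ} (hs : 0 ≤ s) :
    IntegrableOn (fun u => u * p.meanLoss s u) (Set.Ioi 0) := by
  simp only [mul_meanLoss]
  exact integrable_finsetSum _ fun i _ =>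
    ((integrableOn_thinnedLoss _ hs (gain_nonneg i)).add
      (integrableOn_thinnedLoss _ hs (gain_nonneg i))).const_mul _

/-- `Params.laplace` as an integral. -/
def laplaceIntegral (p : Params) (s r : ℝ) : ℝ :=
  Real.exp (-(2 * Real.pi * p.lam * ∫ u in Set.Ioi r, u * p.meanLoss s u))

lemma laplace_eq {s : ℝ} (hs : 0 ≤ s) {r : ℝ} (hr : 0 < r) :
    p.laplace s r = p.laplaceIntegral s r := by
  have hint := fun κ i => (integrableOn_thinnedLoss (p := p) κ hs (gain_nonneg (p := p) i)).mono_set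
    (Set.Ioi_subset_Ioi hr.le)
  have hsum : ∀ u, u * p.meanLoss s u = ∑ i, p.gainProb i *
      (p.thinnedLoss Link.LOS s (p.gain i) + p.thinnedLoss Link.NLOS s (p.gain i)) u :=
    mul_meanLoss s
  rw [laplace, laplaceIntegral]
  simp only [hsum]
  rw [integral_finsetSum _ fun i _ =>
    ((hint Link.LOS i).add (hint Link.NLOS i)).const_mul (p.gainProb i)]
  congr 3
  refine Finset.sum_congr rfl fun i _ => ?_
  rw [integral_const_mul, integral_add' (hint _ i) (hint _ i), Θ_eq_integral _ hs i hr,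
    Θ_eq_integral _ hs i hr]

lemma meanLoss_nonneg {s : ℝ} (hs : 0 ≤ s) (u : ℝ) : 0 ≤ p.meanLoss s u :=
  Finset.sum_nonneg fun i _ => mul_nonneg (gainProb_nonneg i)
    (add_nonneg (mul_nonneg (prob_nonneg _ _) (loss_nonneg hs (gain_nonneg i) u))
      (mul_nonneg (prob_nonneg _ _) (loss_nonneg hs (gain_nonneg i) u)))

lemma meanLoss_mono {s t : ℝ} (hs : 0 ≤ s) (hst : s ≤ t) (u : ℝ) :
    p.meanLoss s u ≤ p.meanLoss t u :=
  Finset.sum_le_sum fun i _ => mul_le_mul_of_nonneg_left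
    (add_le_add (mul_le_mul_of_nonneg_left (loss_mono hs hst (gain_nonneg i) u) (prob_nonneg _ _))
      (mul_le_mul_of_nonneg_left (loss_mono hs hst (gain_nonneg i) u) (prob_nonneg _ _)))
    (gainProb_nonneg i)

lemma measurable_meanLoss (p : Params) (s : ℝ) : Measurable (p.meanLoss s) :=
  Finset.measurable_fun_sum _ fun _ _ => ((((measurable_prob_level _).mul
    ((measurable_loss _ _).comp measurable_prodMk_left)).add ((measurable_prob_level _).mul
    ((measurable_loss _ _).comp measurable_prodMk_left)))).const_mul _

lemma continuousAt_meanLoss_left {s u : ℝ} (hs : 0 ≤ s) (hu : 0 < u) :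
    ContinuousAt (fun s => p.meanLoss s u) s := by
  have h : ∀ κ i, ContinuousAt (fun s => p.loss κ s (p.gain i) u) s := fun κ i =>
    ContinuousAt.comp (f := fun s => (s, u)) (continuousAt_loss hs (gain_nonneg i) hu)
      (by fun_prop)
  unfold meanLoss
  exact tendsto_finsetSum _ fun i _ => ((((h Link.LOS i).const_mul _).add
    ((h Link.NLOS i).const_mul _)).const_mul _).tendsto

lemma laplaceIntegral_le_one {s r : ℝ} (hs : 0 ≤ s) (hr : 0 ≤ r) :
    p.laplaceIntegral s r ≤ 1 := by
  have h := p.lam_pos.le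
  have hπ := Real.pi_pos.le
  rw [laplaceIntegral, Real.exp_le_one_iff, neg_nonpos]
  refine mul_nonneg (by positivity) (setIntegral_nonneg measurableSet_Ioi fun u hu => ?_)
  exact mul_nonneg (hr.trans (le_of_lt hu)) (meanLoss_nonneg hs u)

lemma laplaceIntegral_pos (s r : ℝ) : 0 < p.laplaceIntegral s r := Real.exp_pos _

/-- Dominated convergence on the fixed half line `(0, ∞)`, with the moving lower limit written as an
indicator that converges except at `u = r₀`. The loss increases with `s`, so its value at `s₀ + 1`
dominates. The general filter covers continuity in the distance as well as sequences of transform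
variables. -/
lemma tendsto_laplaceIntegral {ι : Type*} {l : Filter ι} [l.IsCountablyGenerated] {s r : ι → ℝ}
    {s₀ r₀ : ℝ} (hs : Tendsto s l (𝓝 s₀)) (hr : Tendsto r l (𝓝 r₀)) (hs0 : ∀ᶠ i in l, 0 ≤ s i)
    (hr0 : ∀ᶠ i in l, 0 ≤ r i) (hs₀ : 0 ≤ s₀) (hr₀ : 0 ≤ r₀) :
    Tendsto (fun i => p.laplaceIntegral (s i) (r i)) l (𝓝 (p.laplaceIntegral s₀ r₀)) := by
  have hset : ∀ t y, 0 ≤ y → ∫ u in Set.Ioi y, u * p.meanLoss t u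
      = ∫ u in Set.Ioi 0, (Set.Ioi y).indicator (fun u => u * p.meanLoss t u) u := by
    intro t y hy
    rw [setIntegral_indicator measurableSet_Ioi, Set.inter_eq_right.2 (Set.Ioi_subset_Ioi hy)]
  have key : Tendsto (fun i => ∫ u in Set.Ioi (r i), u * p.meanLoss (s i) u) l
      (𝓝 (∫ u in Set.Ioi r₀, u * p.meanLoss s₀ u)) := by
    rw [hset s₀ r₀ hr₀]
    refine Tendsto.congr' (f₁ := fun i => ∫ u in Set.Ioi 0,
      (Set.Ioi (r i)).indicator (fun u => u * p.meanLoss (s i) u) u) ?_ ?_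
    · filter_upwards [hr0] with i hi using (hset _ _ hi).symm
    refine tendsto_integral_filter_of_dominated_convergence (fun u => u * p.meanLoss (s₀ + 1) u)
      ?_ ?_ (integrableOn_mul_meanLoss (by linarith)) ?_
    · exact Eventually.of_forall fun _ => ((measurable_id.mul
        (p.measurable_meanLoss _)).indicator measurableSet_Ioi).aestronglyMeasurable
    · filter_upwards [hs0, hs.eventually (gt_mem_nhds (lt_add_one s₀))] with i h0 h1
      filter_upwards [ae_restrict_mem measurableSet_Ioi] with u hu
      have hu : 0 < u := hu
      refine (norm_indicator_le_norm_self _ _).trans ?_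
      rw [Real.norm_of_nonneg (mul_nonneg hu.le (meanLoss_nonneg h0 u))]
      exact mul_le_mul_of_nonneg_left (meanLoss_mono h0 h1.le u) hu.le
    · have hne : ∀ᵐ u : ℝ ∂volume.restrict (Set.Ioi 0), u ≠ r₀ :=
        ae_restrict_of_ae (Measure.ae_ne volume r₀)
      filter_upwards [ae_restrict_mem measurableSet_Ioi, hne] with u hu hur
      have hu : 0 < u := hu
      have hc : Tendsto (fun i => u * p.meanLoss (s i) u) l (𝓝 (u * p.meanLoss s₀ u)) :=
        ((continuousAt_meanLoss_left hs₀ hu).tendsto.comp hs).const_mul u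
      rcases lt_or_gt_of_ne hur with h | h
      · have h1 : u ∉ Set.Ioi r₀ := not_lt.2 h.le
        rw [Set.indicator_of_notMem h1]
        refine tendsto_const_nhds.congr' ?_
        filter_upwards [hr.eventually (lt_mem_nhds h)] with i hi
        rw [Set.indicator_of_notMem (show u ∉ Set.Ioi (r i) from not_lt.2 hi.le)]
      · rw [Set.indicator_of_mem (show u ∈ Set.Ioi r₀ from h)]
        refine hc.congr' ?_
        filter_upwards [hr.eventually (gt_mem_nhds h)] with i hi
        rw [Set.indicator_of_mem (show u ∈ Set.Ioi (r i) from hi)]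
  exact ((Real.continuous_exp.tendsto _).comp ((key.const_mul _).neg))

end Params

/-! ### Convergence of the Gauss–Chebyshev sums. -/

/-- The midpoint rule converges for continuous functions. -/
lemma tendsto_midpoint_sum {g : ℝ → ℝ} {b : ℝ} (hb : 0 < b) (hg : ContinuousOn g (Set.Icc 0 b)) :
    Tendsto (fun m : ℕ => b / m * ∑ k ∈ Finset.Icc 1 m, g ((2 * (k : ℝ) - 1) / (2 * m) * b)) atTop
      (𝓝 (∫ x in (0 : ℝ)..b, g x)) := by
  rw [Metric.tendsto_atTop]
  intro ε hε
  have huc := isCompact_Icc.uniformContinuousOn_of_continuous hg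
  rw [Metric.uniformContinuousOn_iff] at huc
  -- An oscillation of `ε / (2b)` on cells of total length `b` adds up to `ε / 2`.
  obtain ⟨δ, hδ, huc⟩ := huc (ε / (2 * b)) (by positivity)
  obtain ⟨M, hM⟩ := exists_nat_gt (b / δ)
  refine ⟨M + 1, fun m hm => ?_⟩
  have hm0 : (0 : ℝ) < m := by exact_mod_cast (show 0 < m by omega)
  have hmδ : b / m < δ := by
    have : (M : ℝ) ≤ m := by exact_mod_cast (show M ≤ m by omega)
    rw [div_lt_iff₀ hm0]
    rw [div_lt_iff₀ hδ] at hM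
    nlinarith
  set a : ℕ → ℝ := fun k => k * b / m with ha
  have hamono : ∀ k, a k ≤ a (k + 1) := fun k => by
    simp only [ha]; push_cast; gcongr; linarith
  have hawidth : ∀ k, a (k + 1) - a k = b / m := fun k => by
    simp only [ha]; push_cast; field_simp; ring
  have hamem : ∀ k, k < m → Set.Icc (a k) (a (k + 1)) ⊆ Set.Icc 0 b := by
    intro k hk x hx
    have hk1 : ((k + 1 : ℕ) : ℝ) ≤ m := by exact_mod_cast hk
    refine ⟨le_trans (by simp only [ha]; positivity) hx.1, hx.2.trans ?_⟩
    simp only [ha]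
    rw [div_le_iff₀ hm0]
    nlinarith
  have hint : ∀ k < m, IntervalIntegrable g volume (a k) (a (k + 1)) := fun k hk =>
    ContinuousOn.intervalIntegrable (by
      rw [Set.uIcc_of_le (hamono k)]; exact hg.mono (hamem k hk))
  have hsum := intervalIntegral.sum_integral_adjacent_intervals hint
  have ha0 : a 0 = 0 := by simp [ha]
  have ham : a m = b := by simp only [ha]; field_simp
  rw [ha0, ham] at hsum
  have hre : ∑ k ∈ Finset.Icc 1 m, g ((2 * (k : ℝ) - 1) / (2 * m) * b)
      = ∑ k ∈ Finset.range m, g ((2 * (k : ℝ) + 1) / (2 * m) * b) := by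
    refine Finset.sum_nbij' (fun k => k - 1) (fun k => k + 1) ?_ ?_ ?_ ?_ ?_
    · intro c hc; simp only [Finset.mem_Icc, Finset.mem_range] at hc ⊢; omega
    · intro k hk; simp only [Finset.mem_Icc, Finset.mem_range] at hk ⊢; omega
    · intro c hc; simp only [Finset.mem_Icc] at hc; omega
    · intro k hk; omega
    · intro c hc
      simp only [Finset.mem_Icc] at hc
      rw [Nat.cast_sub hc.1]
      congr 3
      push_cast
      ring
  rw [hre, Real.dist_eq, ← hsum, Finset.mul_sum, ← Finset.sum_sub_distrib]
  have hcell : ∀ k ∈ Finset.range m,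
      |b / m * g ((2 * (k : ℝ) + 1) / (2 * m) * b) - ∫ x in a k..a (k + 1), g x|
        ≤ ε / (2 * b) * (b / m) := by
    intro k hk
    have hk := Finset.mem_range.1 hk
    set c := (2 * (k : ℝ) + 1) / (2 * m) * b with hc
    have hcmem : c ∈ Set.Icc (a k) (a (k + 1)) := by
      simp only [hc, ha]
      push_cast
      constructor
      · rw [div_mul_eq_mul_div, div_le_div_iff₀ hm0 (by positivity)]; nlinarith [mul_pos hb hm0]
      · rw [div_mul_eq_mul_div, div_le_div_iff₀ (by positivity) hm0]; nlinarith [mul_pos hb hm0]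
    have h1 : b / m * g c = ∫ _ in a k..a (k + 1), g c := by
      rw [intervalIntegral.integral_const, hawidth, smul_eq_mul]
    rw [h1, ← intervalIntegral.integral_sub (by simp) (hint k hk), ← hawidth k,
      ← abs_of_nonneg (sub_nonneg.2 (hamono k)), ← Real.norm_eq_abs]
    refine intervalIntegral.norm_integral_le_of_norm_le_const fun x hx => ?_
    rw [Set.uIoc_of_le (hamono k)] at hx
    refine (huc c (hamem k hk hcmem) x (hamem k hk ⟨hx.1.le, hx.2⟩) ?_).le
    refine lt_of_le_of_lt ?_ hmδ
    rw [← hawidth k]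
    exact Real.dist_le_of_mem_Icc hcmem ⟨hx.1.le, hx.2⟩
  calc _ ≤ ∑ k ∈ Finset.range m, |b / m * g ((2 * (k : ℝ) + 1) / (2 * m) * b)
          - ∫ x in a k..a (k + 1), g x| := Finset.abs_sum_le_sum_abs _ _
    _ ≤ ∑ k ∈ Finset.range m, ε / (2 * b) * (b / m) := Finset.sum_le_sum hcell
    _ = ε / 2 := by
      rw [Finset.sum_const, Finset.card_range, nsmul_eq_mul]; field_simp
    _ < ε := by linarith

namespace Params

variable {p : Params}

/-- The argument of the Laplace transform in `Ψ`. -/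
def laplaceArg (p : Params) (κ : Link) (Υ : ℝ) (n : ℕ) (r : ℝ) : ℝ :=
  n * p.η κ * Υ / (p.gain 0 * p.C κ * (r ^ 2 + p.Δh ^ 2) ^ (-(p.α κ / 2)))

/-- The exponent of the noise term in `Ψ`. -/
def noiseArg (p : Params) (κ : Link) (Υ : ℝ) (n : ℕ) (r : ℝ) : ℝ :=
  n * p.η κ * Υ * p.noise / (p.Pv * p.gain 0 * p.C κ * (r ^ 2 + p.Δh ^ 2) ^ (-(p.α κ / 2)))

lemma η_pos (κ : Link) : 0 < p.η κ := by
  have := p.N_cast_pos κ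
  unfold η
  positivity

lemma laplaceArg_nonneg (κ : Link) {Υ : ℝ} (hΥ : 0 < Υ) (n : ℕ) (r : ℝ) :
    0 ≤ p.laplaceArg κ Υ n r := by
  have := η_pos (p := p) κ; have := p.gain_zero_pos; have := p.C_pos κ
  unfold laplaceArg
  positivity

lemma noiseArg_nonneg (κ : Link) {Υ : ℝ} (hΥ : 0 < Υ) (n : ℕ) (r : ℝ) :
    0 ≤ p.noiseArg κ Υ n r := by
  have := η_pos (p := p) κ; have := p.gain_zero_pos; have := p.C_pos κ
  have := p.noise_pos; have := p.Pv_pos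
  unfold noiseArg
  positivity

lemma continuousAt_laplaceArg (κ : Link) (Υ : ℝ) (n : ℕ) {r : ℝ} (hr : 0 < r) :
    ContinuousAt (p.laplaceArg κ Υ n) r := by
  have hx := p.sqDist_pos hr
  unfold sqDist at hx
  have hx' := Real.rpow_pos_of_pos hx (-(p.α κ / 2))
  have := p.gain_zero_pos; have := p.C_pos κ
  exact continuousAt_const.div (continuousAt_const.mul
    (ContinuousAt.rpow_const (by fun_prop) (Or.inl hx.ne'))) (by positivity)

lemma continuousAt_noiseArg (κ : Link) (Υ : ℝ) (n : ℕ) {r : ℝ} (hr : 0 < r) :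
    ContinuousAt (p.noiseArg κ Υ n) r := by
  have hx := p.sqDist_pos hr
  unfold sqDist at hx
  have hx' := Real.rpow_pos_of_pos hx (-(p.α κ / 2))
  have := p.gain_zero_pos; have := p.C_pos κ; have := p.Pv_pos
  exact continuousAt_const.div (continuousAt_const.mul
    (ContinuousAt.rpow_const (by fun_prop) (Or.inl hx.ne'))) (by positivity)

/-- A term of `Ψ`, without its coefficient. -/
def coverTerm (p : Params) (κ : Link) (Υ : ℝ) (n : ℕ) (r : ℝ) : ℝ :=
  Real.exp (-p.noiseArg κ Υ n r) * p.laplaceIntegral (p.laplaceArg κ Υ n r) r * p.nearestPDF r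

lemma Ψ_eq (κ : Link) {Υ : ℝ} (hΥ : 0 < Υ) {r : ℝ} (hr : 0 < r) :
    p.Ψ κ r Υ = ∑ n ∈ Finset.Icc 1 (p.N κ), (-1 : ℝ) ^ (n + 1) * (p.N κ).choose n
      * p.coverTerm κ Υ n r := by
  refine Finset.sum_congr rfl fun n _ => ?_
  rw [coverTerm, ← laplace_eq (laplaceArg_nonneg κ hΥ n r) hr, noiseArg, laplaceArg]
  ring

lemma nearestPDF_nonneg {r : ℝ} (hr : 0 ≤ r) : 0 ≤ p.nearestPDF r := by
  have := p.lam_pos.le; have := Real.pi_pos.le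
  unfold nearestPDF
  positivity

lemma continuous_nearestPDF (p : Params) : Continuous p.nearestPDF := by
  unfold nearestPDF
  fun_prop

lemma coverTerm_nonneg (κ : Link) (Υ : ℝ) (n : ℕ) {r : ℝ} (hr : 0 ≤ r) :
    0 ≤ p.coverTerm κ Υ n r :=
  mul_nonneg (mul_nonneg (Real.exp_pos _).le (laplaceIntegral_pos _ _).le) (nearestPDF_nonneg hr)

lemma coverTerm_le (κ : Link) {Υ : ℝ} (hΥ : 0 < Υ) (n : ℕ) {r : ℝ} (hr : 0 ≤ r) :
    p.coverTerm κ Υ n r ≤ p.nearestPDF r := by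
  refine mul_le_of_le_one_left (nearestPDF_nonneg hr) (mul_le_one₀ ?_ (laplaceIntegral_pos _ _).le
    (laplaceIntegral_le_one (laplaceArg_nonneg κ hΥ n r) hr))
  rw [Real.exp_le_one_iff, neg_nonpos]
  exact noiseArg_nonneg κ hΥ n r

lemma continuousAt_coverTerm (κ : Link) {Υ : ℝ} (hΥ : 0 < Υ) (n : ℕ) {r : ℝ} (hr : 0 < r) :
    ContinuousAt (p.coverTerm κ Υ n) r := by
  refine ContinuousAt.mul (ContinuousAt.mul ?_ ?_) p.continuous_nearestPDF.continuousAt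
  · exact (continuousAt_noiseArg κ Υ n hr).neg.rexp
  · exact tendsto_laplaceIntegral (continuousAt_laplaceArg κ Υ n hr) tendsto_id
      (Eventually.of_forall fun r => laplaceArg_nonneg κ hΥ n r)
      ((lt_mem_nhds hr).mono fun _ h => h.le) (laplaceArg_nonneg κ hΥ n r) hr.le

lemma continuousAt_Ψ (κ : Link) {Υ : ℝ} (hΥ : 0 < Υ) {r : ℝ} (hr : 0 < r) :
    ContinuousAt (fun r => p.Ψ κ r Υ) r := by
  have h : ContinuousAt (fun r => ∑ n ∈ Finset.Icc 1 (p.N κ), (-1 : ℝ) ^ (n + 1)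
      * (p.N κ).choose n * p.coverTerm κ Υ n r) r :=
    tendsto_finsetSum _ fun n _ => ((continuousAt_coverTerm κ hΥ n hr).const_mul _).tendsto
  refine h.congr ?_
  filter_upwards [lt_mem_nhds hr] with y hy using (Ψ_eq κ hΥ hy).symm

/-- The alternation is ignored and the binomial coefficients are summed. Only the Gaussian decay in
`r` matters, for summation over the levels and for integrability. -/
lemma abs_Ψ_le (κ : Link) {Υ : ℝ} (hΥ : 0 < Υ) {r : ℝ} (hr : 0 < r) :
    |p.Ψ κ r Υ| ≤ 2 ^ p.N κ * p.nearestPDF r := by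
  rw [Ψ_eq κ hΥ hr]
  calc _ ≤ ∑ n ∈ Finset.Icc 1 (p.N κ), |(-1 : ℝ) ^ (n + 1) * (p.N κ).choose n
        * p.coverTerm κ Υ n r| := Finset.abs_sum_le_sum_abs _ _
    _ ≤ ∑ n ∈ Finset.Icc 1 (p.N κ), ((p.N κ).choose n : ℝ) * p.nearestPDF r := by
      refine Finset.sum_le_sum fun n _ => ?_
      rw [abs_mul, abs_mul, abs_pow, abs_neg, abs_one, one_pow, one_mul, Nat.abs_cast,
        abs_of_nonneg (coverTerm_nonneg κ Υ n hr.le)]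
      exact mul_le_mul_of_nonneg_left (coverTerm_le κ hΥ n hr.le) (Nat.cast_nonneg _)
    _ ≤ ∑ n ∈ Finset.range (p.N κ + 1), ((p.N κ).choose n : ℝ) * p.nearestPDF r := by
      refine Finset.sum_le_sum_of_subset_of_nonneg ?_ fun n _ _ =>
        mul_nonneg (Nat.cast_nonneg _) (nearestPDF_nonneg hr.le)
      intro n hn
      simp only [Finset.mem_Icc, Finset.mem_range] at hn ⊢
      omega
    _ = 2 ^ p.N κ * p.nearestPDF r := by
      rw [← Finset.sum_mul, ← Nat.cast_sum, Nat.sum_range_choose]; push_cast; rfl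

/-- The integrand of the coverage probability. -/
def coverDensity (p : Params) (Υ r : ℝ) : ℝ :=
  p.prob Link.LOS (p.level r) * p.Ψ Link.LOS r Υ + p.prob Link.NLOS (p.level r) * p.Ψ Link.NLOS r Υ

/-- The affine map sends `(-1, 1)` onto the interior of the cell of level `γ`, so the index of the
term is the level of its own argument. -/
lemma levelTerm_eq {Υ ζ : ℝ} (hζ : ζ ∈ Set.Ioo (-1 : ℝ) 1) (γ : ℕ) :
    p.levelTerm Υ ζ γ = p.coverDensity Υ ((ζ + 2 * γ + 1) / (2 * p.ρ)) := by
  have hρ := p.ρ_pos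
  have : p.level ((ζ + 2 * γ + 1) / (2 * p.ρ)) = γ := by
    apply level_eq
    · rw [div_le_div_iff₀ hρ (by positivity)]; nlinarith [hζ.1]
    · rw [div_lt_div_iff₀ (by positivity) hρ]; nlinarith [hζ.2]
  rw [levelTerm, coverDensity, this]

lemma node_arg_pos {ζ : ℝ} (hζ : ζ ∈ Set.Ioo (-1 : ℝ) 1) (γ : ℕ) :
    0 < (ζ + 2 * γ + 1) / (2 * p.ρ) := by
  have hρ := p.ρ_pos
  have := hζ.1
  have : (0 : ℝ) ≤ γ := γ.cast_nonneg
  exact div_pos (by linarith) (by positivity)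

lemma abs_coverDensity_le {Υ : ℝ} (hΥ : 0 < Υ) {r : ℝ} (hr : 0 < r) :
    |p.coverDensity Υ r| ≤ (2 ^ p.N Link.LOS + 2 ^ p.N Link.NLOS) * p.nearestPDF r := by
  have h1 := abs_Ψ_le (p := p) Link.LOS hΥ hr
  have h2 := abs_Ψ_le (p := p) Link.NLOS hΥ hr
  have h3 := nearestPDF_nonneg (p := p) hr.le
  rw [add_mul]
  refine (abs_add_le _ _).trans (add_le_add ?_ ?_)
  all_goals
    rw [abs_mul, abs_of_nonneg (prob_nonneg _ _)]
    refine (mul_le_of_le_one_left (abs_nonneg _) (prob_le_one _ _)).trans ?_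
    assumption

/-- A summable bound for the terms of the blockage levels. -/
def levelBound (p : Params) (γ : ℕ) : ℝ :=
  (2 ^ p.N Link.LOS + 2 ^ p.N Link.NLOS) * (2 * Real.pi * p.lam * ((γ + 1) / p.ρ)
    * Real.exp (-(Real.pi * p.lam * (γ / p.ρ) ^ 2)))

/-- In `nearestPDF` the linear factor is taken at the right end of the cell and the Gaussian at the
left end. The bound does not depend on `ζ`, so the sum over the levels is continuous by Weierstrass'
test. -/
lemma abs_levelTerm_le {Υ : ℝ} (hΥ : 0 < Υ) {ζ : ℝ} (hζ : ζ ∈ Set.Ioo (-1 : ℝ) 1) (γ : ℕ) :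
    |p.levelTerm Υ ζ γ| ≤ p.levelBound γ := by
  have hρ := p.ρ_pos
  rw [levelTerm_eq hζ]
  refine (abs_coverDensity_le hΥ (node_arg_pos hζ γ)).trans ?_
  have := p.lam_pos.le; have := Real.pi_pos.le
  unfold levelBound nearestPDF
  have h1 : (ζ + 2 * γ + 1) / (2 * p.ρ) ≤ (γ + 1) / p.ρ := by
    rw [div_le_div_iff₀ (by positivity) hρ]; nlinarith [hζ.2]
  have h2 : γ / p.ρ ≤ (ζ + 2 * γ + 1) / (2 * p.ρ) := by
    rw [div_le_div_iff₀ hρ (by positivity)]; nlinarith [hζ.1]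
  have h3 := (node_arg_pos (p := p) hζ γ).le
  gcongr

lemma summable_levelBound (p : Params) : Summable p.levelBound := by
  have hρ := p.ρ_pos; have hl := p.lam_pos; have hπ := Real.pi_pos
  set c := Real.pi * p.lam / p.ρ ^ 2 with hc
  have hcpos : 0 < c := by positivity
  have h1 := Real.summable_pow_mul_exp_neg_nat_mul 1 hcpos
  have h0 := Real.summable_pow_mul_exp_neg_nat_mul 0 hcpos
  have hs := (h1.add h0).mul_left ((2 ^ p.N Link.LOS + 2 ^ p.N Link.NLOS)
    * (2 * Real.pi * p.lam / p.ρ))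
  refine Summable.of_nonneg_of_le (fun γ => by unfold levelBound; positivity) (fun γ => ?_) hs
  have hexp : Real.exp (-(Real.pi * p.lam * (γ / p.ρ) ^ 2)) ≤ Real.exp (-c * γ) := by
    rw [Real.exp_le_exp, neg_mul, neg_le_neg_iff]
    have e : Real.pi * p.lam * (γ / p.ρ) ^ 2 = c * (γ : ℝ) ^ 2 := by rw [hc]; field_simp
    rw [e]
    refine mul_le_mul_of_nonneg_left ?_ hcpos.le
    exact_mod_cast Nat.le_self_pow two_ne_zero γ
  calc p.levelBound γ ≤ (2 ^ p.N Link.LOS + 2 ^ p.N Link.NLOS) * (2 * Real.pi * p.lam *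
        ((γ + 1) / p.ρ) * Real.exp (-c * γ)) := by unfold levelBound; gcongr
    _ = _ := by rw [pow_one, pow_zero]; field_simp

lemma summable_levelTerm {Υ : ℝ} (hΥ : 0 < Υ) {ζ : ℝ} (hζ : ζ ∈ Set.Ioo (-1 : ℝ) 1) :
    Summable (p.levelTerm Υ ζ) :=
  Summable.of_norm_bounded p.summable_levelBound fun γ => abs_levelTerm_le hΥ hζ γ

lemma continuousAt_levelTerm {Υ : ℝ} (hΥ : 0 < Υ) {ζ : ℝ} (hζ : ζ ∈ Set.Ioo (-1 : ℝ) 1) (γ : ℕ) :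
    ContinuousAt (fun ζ => p.levelTerm Υ ζ γ) ζ := by
  have hpos := node_arg_pos (p := p) hζ γ
  have hc : ContinuousAt (fun ζ : ℝ => (ζ + 2 * γ + 1) / (2 * p.ρ)) ζ := by fun_prop
  have h : ∀ κ, ContinuousAt (fun ζ => p.Ψ κ ((ζ + 2 * γ + 1) / (2 * p.ρ)) Υ) ζ := fun κ =>
    ContinuousAt.comp (f := fun ζ : ℝ => (ζ + 2 * γ + 1) / (2 * p.ρ))
      (continuousAt_Ψ κ hΥ hpos) hc
  exact ((h _).const_mul _).add ((h _).const_mul _)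

/-- The sum over the blockage levels at a node. -/
def nodeSum (p : Params) (Υ ζ : ℝ) : ℝ := ∑' γ : ℕ, p.levelTerm Υ ζ γ

lemma continuousOn_nodeSum {Υ : ℝ} (hΥ : 0 < Υ) :
    ContinuousOn (p.nodeSum Υ) (Set.Ioo (-1) 1) :=
  continuousOn_tsum (fun γ _ hζ => (continuousAt_levelTerm hΥ hζ γ).continuousWithinAt)
    p.summable_levelBound fun γ _ hζ => abs_levelTerm_le hΥ hζ γ

lemma abs_nodeSum_le {Υ : ℝ} (hΥ : 0 < Υ) {ζ : ℝ} (hζ : ζ ∈ Set.Ioo (-1 : ℝ) 1) :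
    |p.nodeSum Υ ζ| ≤ ∑' γ, p.levelBound γ :=
  tsum_of_norm_bounded (f := p.levelTerm Υ ζ) p.summable_levelBound.hasSum
    fun γ => abs_levelTerm_le hΥ hζ γ

lemma integrableOn_nearestPDF (p : Params) : IntegrableOn p.nearestPDF (Set.Ioi 0) := by
  have h := (integrable_mul_exp_neg_mul_sq (mul_pos Real.pi_pos p.lam_pos)).const_mul
    (2 * Real.pi * p.lam)
  refine (h.congr (Eventually.of_forall fun r => ?_)).integrableOn
  simp only [nearestPDF, neg_mul]
  ring

lemma integrableOn_coverDensity {Υ : ℝ} (hΥ : 0 < Υ) :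
    IntegrableOn (p.coverDensity Υ) (Set.Ioi 0) := by
  refine Integrable.mono' (p.integrableOn_nearestPDF.const_mul
    (2 ^ p.N Link.LOS + 2 ^ p.N Link.NLOS)) ?_ ?_
  · have h : ∀ κ, AEStronglyMeasurable (fun r => p.Ψ κ r Υ) (volume.restrict (Set.Ioi 0)) :=
      fun κ => ContinuousOn.aestronglyMeasurable
        (fun r hr => (continuousAt_Ψ κ hΥ hr).continuousWithinAt) measurableSet_Ioi
    exact ((measurable_prob_level _).aestronglyMeasurable.mul (h _)).add
      ((measurable_prob_level _).aestronglyMeasurable.mul (h _))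
  · filter_upwards [ae_restrict_mem measurableSet_Ioi] with r hr
    exact abs_coverDensity_le hΥ hr

/-- Sum and integral are exchanged by domination, each cell is mapped back with Jacobian `2ρ`, and
the cells together make up the half line. -/
lemma integral_nodeSum {Υ : ℝ} (hΥ : 0 < Υ) :
    ∫ ζ in (-1 : ℝ)..1, p.nodeSum Υ ζ = 2 * p.ρ * ∫ r in Set.Ioi 0, p.coverDensity Υ r := by
  have hρ := p.ρ_pos
  have hgrid := hasSum_integral_grid (f := p.coverDensity Υ) hρ 0
    (by simpa using integrableOn_coverDensity hΥ)
  simp only [zero_add, Nat.cast_zero, zero_div] at hgrid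
  have hcell : ∀ γ : ℕ, ∫ ζ in (-1 : ℝ)..1, p.levelTerm Υ ζ γ
      = 2 * p.ρ * ∫ u in (γ : ℝ) / p.ρ..((γ : ℝ) + 1) / p.ρ, p.coverDensity Υ u := by
    intro γ
    have h1 : ∫ ζ in (-1 : ℝ)..1, p.levelTerm Υ ζ γ
        = ∫ ζ in (-1 : ℝ)..1, p.coverDensity Υ (ζ / (2 * p.ρ) + (2 * γ + 1) / (2 * p.ρ)) := by
      rw [intervalIntegral.integral_of_le (by norm_num), intervalIntegral.integral_of_le
        (by norm_num), integral_Ioc_eq_integral_Ioo, integral_Ioc_eq_integral_Ioo]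
      refine setIntegral_congr_fun measurableSet_Ioo fun ζ hζ => ?_
      rw [levelTerm_eq hζ]
      congr 1
      ring
    rw [h1, intervalIntegral.integral_comp_div_add _ (by positivity), smul_eq_mul]
    congr 2 <;> field_simp <;> ring
  have hsum : HasSum (fun γ => ∫ ζ in (-1 : ℝ)..1, p.levelTerm Υ ζ γ)
      (∫ ζ in (-1 : ℝ)..1, p.nodeSum Υ ζ) := by
    have hae : ∀ᵐ ζ : ℝ, ζ ∈ Set.uIoc (-1 : ℝ) 1 → ζ ∈ Set.Ioo (-1 : ℝ) 1 := by
      filter_upwards [Measure.ae_ne volume (1 : ℝ)] with ζ h1 h2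
      rw [Set.uIoc_of_le (by norm_num)] at h2
      exact ⟨h2.1, lt_of_le_of_ne h2.2 h1⟩
    refine intervalIntegral.hasSum_integral_of_dominated_convergence
      (fun γ _ => p.levelBound γ) ?_ ?_ ?_ ?_ ?_
    · intro γ
      rw [Set.uIoc_of_le (by norm_num), ← restrict_Ioo_eq_restrict_Ioc]
      exact ContinuousOn.aestronglyMeasurable
        (fun ζ hζ => (continuousAt_levelTerm hΥ hζ γ).continuousWithinAt) measurableSet_Ioo
    · intro γ
      filter_upwards [hae] with ζ h h2 using abs_levelTerm_le hΥ (h h2) γ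
    · exact Eventually.of_forall fun _ _ => p.summable_levelBound
    · exact intervalIntegrable_const
    · filter_upwards [hae] with ζ h h2 using (summable_levelTerm hΥ (h h2)).hasSum
  simp only [hcell] at hsum
  exact hsum.unique (hgrid.mul_left (2 * p.ρ))

/-- The quadrature sums converge to the integral over the distance of the serving UAV. -/
theorem tendsto_quadrature {Υ : ℝ} (hΥ : 0 < Υ) :
    Tendsto (p.quadrature Υ) atTop (𝓝 (∫ r in Set.Ioi 0, p.coverDensity Υ r)) := by
  have hρ := p.ρ_pos
  have hcos : ∀ θ ∈ Set.Ioo 0 Real.pi, Real.cos θ ∈ Set.Ioo (-1 : ℝ) 1 := by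
    intro θ hθ
    have hs := Real.sin_pos_of_mem_Ioo hθ
    have := Real.sin_sq_add_cos_sq θ
    constructor <;> nlinarith
  set g : ℝ → ℝ := fun θ => Real.sin θ * p.nodeSum Υ (Real.cos θ) with hg
  set B := ∑' γ, p.levelBound γ
  have hbd : ∀ θ ∈ Set.Icc 0 Real.pi, |g θ| ≤ Real.sin θ * B := by
    intro θ hθ
    have hs := Real.sin_nonneg_of_mem_Icc hθ
    rcases hs.eq_or_lt with h | h
    · simp [hg, ← h]
    · have hθ' : θ ∈ Set.Ioo 0 Real.pi := by
        refine ⟨lt_of_le_of_ne hθ.1 ?_, lt_of_le_of_ne hθ.2 ?_⟩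
        · rintro rfl; simp at h
        · rintro rfl; simp at h
      rw [hg, abs_mul, abs_of_nonneg hs]
      exact mul_le_mul_of_nonneg_left (abs_nodeSum_le hΥ (hcos θ hθ')) hs
  -- Continuity of `nodeSum` is known only on the open interval; at the end points its boundedness
  -- there and the zero of the sine are enough.
  have hcont : ContinuousOn g (Set.Icc 0 Real.pi) := by
    intro θ hθ
    by_cases h : Real.sin θ = 0
    · have h0 : g θ = 0 := by simp [hg, h]
      rw [ContinuousWithinAt, h0]
      refine squeeze_zero_norm' (a := fun θ => Real.sin θ * B) ?_ ?_
      · filter_upwards [self_mem_nhdsWithin] with y hy using hbd y hy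
      · have : Tendsto (fun θ => Real.sin θ * B) (𝓝 θ) (𝓝 (Real.sin θ * B)) :=
          (Real.continuous_sin.mul continuous_const).tendsto θ
        rw [h, zero_mul] at this
        exact this.mono_left nhdsWithin_le_nhds
    · have hθ' : θ ∈ Set.Ioo 0 Real.pi := by
        refine ⟨lt_of_le_of_ne hθ.1 ?_, lt_of_le_of_ne hθ.2 ?_⟩
        · rintro rfl; simp at h
        · rintro rfl; simp at h
      have hc := (continuousOn_nodeSum (p := p) hΥ).continuousAt
        (isOpen_Ioo.mem_nhds (hcos θ hθ'))
      exact (Real.continuous_sin.continuousAt.mul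
        (ContinuousAt.comp hc Real.continuous_cos.continuousAt)).continuousWithinAt
  have hmid := (tendsto_midpoint_sum Real.pi_pos hcont).const_mul (1 / (2 * p.ρ))
  have hint : ∫ θ in (0 : ℝ)..Real.pi, g θ = ∫ ζ in (-1 : ℝ)..1, p.nodeSum Υ ζ := by
    have hIoo : IntegrableOn (p.nodeSum Υ) (Set.Icc (-1) 1) := by
      rw [integrableOn_Icc_iff_integrableOn_Ioo]
      refine Integrable.of_bound
        ((continuousOn_nodeSum hΥ).aestronglyMeasurable measurableSet_Ioo) B ?_
      filter_upwards [ae_restrict_mem measurableSet_Ioo] with ζ hζ using abs_nodeSum_le hΥ hζ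
    have hsub := intervalIntegral.integral_comp_mul_deriv''' (a := 0) (b := Real.pi)
      (f := Real.cos) (f' := fun θ => -Real.sin θ) (g := p.nodeSum Υ)
      Real.continuous_cos.continuousOn
      (fun x _ => (Real.hasDerivAt_cos x).hasDerivWithinAt) ?_ ?_ ?_
    · rw [Real.cos_zero, Real.cos_pi, intervalIntegral.integral_symm (-1) 1] at hsub
      rw [← neg_inj, ← hsub, ← intervalIntegral.integral_neg]
      refine intervalIntegral.integral_congr fun θ _ => ?_
      simp only [hg, Function.comp]
      ring
    · rw [min_eq_left Real.pi_pos.le, max_eq_right Real.pi_pos.le]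
      refine (continuousOn_nodeSum hΥ).mono ?_
      rintro _ ⟨θ, hθ, rfl⟩
      exact hcos θ hθ
    · refine hIoo.mono_set ?_
      rintro _ ⟨θ, -, rfl⟩
      exact ⟨Real.neg_one_le_cos θ, Real.cos_le_one θ⟩
    · rw [Set.uIcc_of_le Real.pi_pos.le]
      refine hcont.neg.integrableOn_Icc.congr_fun (fun θ _ => ?_) measurableSet_Icc
      simp only [hg, Function.comp, Pi.neg_apply]
      ring
  rw [hint, integral_nodeSum hΥ, ← mul_assoc, one_div, inv_mul_cancel₀ (by positivity),
    one_mul] at hmid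
  refine hmid.congr' ?_
  filter_upwards [eventually_gt_atTop 0] with m hm
  have hm0 : (0 : ℝ) < m := by exact_mod_cast hm
  have hterm : ∑ k ∈ Finset.Icc 1 m, g ((2 * (k : ℝ) - 1) / (2 * m) * Real.pi)
      = ∑ k ∈ Finset.Icc 1 m, Real.sqrt (1 - node m k ^ 2)
        * ∑' γ : ℕ, p.levelTerm Υ (node m k) γ := by
    refine Finset.sum_congr rfl fun k hk => ?_
    simp only [Finset.mem_Icc] at hk
    have hk1 : (1 : ℝ) ≤ k := by exact_mod_cast hk.1
    have hk2 : (k : ℝ) ≤ m := by exact_mod_cast hk.2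
    have hsin : 0 ≤ Real.sin ((2 * (k : ℝ) - 1) / (2 * m) * Real.pi) := by
      refine Real.sin_nonneg_of_nonneg_of_le_pi ?_ ?_
      · exact mul_nonneg (div_nonneg (by linarith) (by positivity)) Real.pi_pos.le
      · refine mul_le_of_le_one_left Real.pi_pos.le ?_
        rw [div_le_one (by positivity)]
        linarith
    have hsq : Real.sqrt (1 - node m k ^ 2) = Real.sin ((2 * (k : ℝ) - 1) / (2 * m) * Real.pi) := by
      rw [node, ← Real.sin_sq, Real.sqrt_sq hsin]
    rw [hsq]
    rfl
  rw [hterm, quadrature, ← mul_assoc]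
  congr 1
  field_simp

end Params

/-! ### The generating functional of a Poisson process. -/

/-- The function `x ↦ exp (-x)` on the extended nonnegative numbers. -/
def negExp (x : ℝ≥0∞) : ℝ≥0∞ := EReal.exp (-(x : EReal))

lemma negExp_zero : negExp 0 = 1 := by simp [negExp]

lemma negExp_top : negExp ⊤ = 0 := by simp [negExp]

lemma negExp_ofReal {t : ℝ} (ht : 0 ≤ t) :
    negExp (ENNReal.ofReal t) = ENNReal.ofReal (Real.exp (-t)) := by
  rw [negExp, EReal.coe_ennreal_ofReal, max_eq_left ht, ← EReal.coe_neg, EReal.exp_coe]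

lemma negExp_add (x y : ℝ≥0∞) : negExp (x + y) = negExp x * negExp y := by
  rw [negExp, negExp, negExp, EReal.coe_ennreal_add, EReal.neg_add, sub_eq_add_neg, EReal.exp_add]
  · left; simp
  · right; simp

lemma continuous_negExp : Continuous negExp :=
  ENNReal.continuous_exp.comp (continuous_neg.comp continuous_coe_ennreal_ereal)

lemma measurable_negExp : Measurable negExp := continuous_negExp.measurable

lemma negExp_antitone : Antitone negExp := fun _ _ h =>
  EReal.exp_monotone (EReal.neg_le_neg_iff.2 (EReal.coe_ennreal_le_coe_ennreal_iff.2 h))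

lemma negExp_le_one (x : ℝ≥0∞) : negExp x ≤ 1 := negExp_zero ▸ negExp_antitone (zero_le)

lemma negExp_ne_top (x : ℝ≥0∞) : negExp x ≠ ⊤ := ((negExp_le_one x).trans_lt ENNReal.one_lt_top).ne

lemma negExp_nat_mul (n : ℕ) (x : ℝ≥0∞) : negExp (n * x) = negExp x ^ n := by
  induction n with
  | zero => simp [negExp_zero]
  | succ n ih => rw [Nat.cast_add, Nat.cast_one, add_mul, one_mul, negExp_add, ih, pow_succ]

lemma negExp_sum {ι : Type*} (s : Finset ι) (f : ι → ℝ≥0∞) :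
    negExp (∑ i ∈ s, f i) = ∏ i ∈ s, negExp (f i) := by
  classical
  induction s using Finset.induction_on with
  | empty => simp [negExp_zero]
  | insert a s ha ih => rw [Finset.sum_insert ha, Finset.prod_insert ha, negExp_add, ih]

/-- The probability generating function of the Poisson distribution. -/
lemma tsum_poisson (m : ℝ) (hm : 0 ≤ m) (x : ℝ≥0∞) :
    ∑' k : ℕ, negExp (k * x) * ENNReal.ofReal (Real.exp (-m) * m ^ k / k.factorial)
      = negExp ((1 - negExp x) * ENNReal.ofReal m) := by
  obtain ⟨q, hq, hq1, hqx⟩ : ∃ q : ℝ, 0 ≤ q ∧ q ≤ 1 ∧ negExp x = ENNReal.ofReal q := by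
    refine ⟨(negExp x).toReal, ENNReal.toReal_nonneg, ?_, (ENNReal.ofReal_toReal
      (negExp_ne_top x)).symm⟩
    exact ENNReal.toReal_le_of_le_ofReal zero_le_one (by simpa using negExp_le_one x)
  have hterm : ∀ k : ℕ, negExp (k * x) * ENNReal.ofReal (Real.exp (-m) * m ^ k / k.factorial)
      = ENNReal.ofReal (Real.exp (-m) * ((q * m) ^ k / k.factorial)) := by
    intro k
    rw [negExp_nat_mul, hqx, ← ENNReal.ofReal_pow hq, ← ENNReal.ofReal_mul (by positivity)]
    congr 1
    rw [mul_pow]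
    ring
  have hs : HasSum (fun k : ℕ => Real.exp (-m) * ((q * m) ^ k / k.factorial))
      (Real.exp (-m) * Real.exp (q * m)) := by
    refine HasSum.mul_left _ ?_
    rw [Real.exp_eq_exp_ℝ]
    exact NormedSpace.expSeries_div_hasSum_exp (q * m)
  simp only [hterm]
  rw [← ENNReal.ofReal_tsum_of_nonneg (fun k => by positivity) hs.summable, hs.tsum_eq, hqx,
    ← ENNReal.ofReal_one, ← ENNReal.ofReal_sub _ hq, ← ENNReal.ofReal_mul (by linarith),
    negExp_ofReal (mul_nonneg (by linarith) hm), ← Real.exp_add]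
  congr 2
  ring

section PoissonProcess

lemma tsum_indicator_eq_encard {Ω : Type*} {v : ℕ → Ω → Plane} (A : Set Plane) (ω : Ω) :
    ∑' n, A.indicator (fun _ => (1 : ℝ≥0∞)) (v n ω) = {n | v n ω ∈ A}.encard := by
  rw [← ENNReal.tsum_set_one]
  exact (tsum_subtype {n | v n ω ∈ A} (fun _ => (1 : ℝ≥0∞))).symm

variable {Ω : Type*} [MeasurableSpace Ω] {P : Measure Ω} {v : ℕ → Ω → Plane} {lam : ℝ}

lemma measurable_encard (hv : ∀ n, Measurable (v n)) {A : Set Plane} (hA : MeasurableSet A) :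
    Measurable fun ω => ({n | v n ω ∈ A}.encard : ℝ≥0∞) := by
  simp only [← tsum_indicator_eq_encard]
  exact Measurable.tsum fun n => (measurable_const.indicator hA).comp (hv n)

/-- The Laplace transform of the number of points of a Poisson process in a set. -/
lemma IsPPP.lintegral_negExp_encard [IsProbabilityMeasure P] (h : IsPPP P v lam) (hlam : 0 ≤ lam)
    {A : Set Plane} (hA : MeasurableSet A) (hvol : volume A < ∞) (x : ℝ≥0∞) :
    ∫⁻ ω, negExp ({n | v n ω ∈ A}.encard * x) ∂P
      = negExp ((1 - negExp x) * (ENNReal.ofReal lam * volume A)) := by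
  set m := lam * volume.real A with hm
  have hm0 : 0 ≤ m := by positivity
  have hmA : ENNReal.ofReal m = ENNReal.ofReal lam * volume A := by
    rw [hm, ENNReal.ofReal_mul hlam, ofReal_measureReal hvol.ne]
  set S : ℕ → Set Ω := fun k => {ω | {n | v n ω ∈ A}.encard = k} with hS
  have hSm : ∀ k, MeasurableSet (S k) := by
    intro k
    have : S k = (fun ω => ({n | v n ω ∈ A}.encard : ℝ≥0∞)) ⁻¹' {(k : ℝ≥0∞)} := by
      ext ω
      simp only [hS, Set.mem_ofPred_eq, Set.mem_preimage, Set.mem_singleton_iff]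
      rw [← ENat.toENNReal_coe, ENat.toENNReal_inj]
    rw [this]
    exact measurable_encard h.measurable hA (measurableSet_singleton _)
  have hdisj : Pairwise (Function.onFun Disjoint S) := by
    intro i j hij
    refine Set.disjoint_left.2 fun ω h1 h2 => hij ?_
    simp only [hS, Set.mem_ofPred_eq] at h1 h2
    exact_mod_cast h1.symm.trans h2
  have hPS : ∀ k, P (S k) = ENNReal.ofReal (Real.exp (-m) * m ^ k / k.factorial) := fun k =>
    h.poisson A hA hvol k
  -- The Poisson weights have total mass one (the generating function at `x = 0`), so the count is
  -- almost surely finite.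
  have hfull : P (⋃ k, S k) = 1 := by
    rw [measure_iUnion hdisj hSm]
    have := tsum_poisson m hm0 0
    simpa [negExp_zero, hPS] using this
  have hae : ∀ᵐ ω ∂P, ω ∈ ⋃ k, S k := by
    rw [ae_iff]
    exact (prob_compl_eq_zero_iff (MeasurableSet.iUnion hSm)).2 hfull
  have hX : ∀ᵐ ω ∂P, negExp ({n | v n ω ∈ A}.encard * x)
      = ∑' k : ℕ, (S k).indicator (fun _ => negExp (k * x)) ω := by
    filter_upwards [hae] with ω hω
    obtain ⟨k, hk⟩ := Set.mem_iUnion.1 hω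
    rw [tsum_eq_single k, Set.indicator_of_mem hk]
    · have : {n | v n ω ∈ A}.encard = k := hk
      rw [this, ENat.toENNReal_coe]
    · intro j hj
      exact Set.indicator_of_notMem (Set.disjoint_left.1 (hdisj hj.symm) hk) _
  rw [lintegral_congr_ae hX, lintegral_tsum fun k =>
    (measurable_const.indicator (hSm k)).aemeasurable, ← hmA, ← tsum_poisson m hm0 x]
  refine tsum_congr fun k => ?_
  rw [lintegral_indicator (hSm k), setLIntegral_const, hPS]

/-- The generating functional of a Poisson process at a step function. -/
lemma IsPPP.lintegral_negExp_sum_step [IsProbabilityMeasure P] (h : IsPPP P v lam)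
    (hlam : 0 ≤ lam) {l : ℕ} {A : Fin l → Set Plane} (hA : ∀ i, MeasurableSet (A i))
    (hvol : ∀ i, volume (A i) < ∞) (hdisj : Pairwise fun i j => Disjoint (A i) (A j))
    (x : Fin l → ℝ≥0∞) :
    ∫⁻ ω, negExp (∑' n, ∑ i, (A i).indicator (fun _ => x i) (v n ω)) ∂P
      = negExp (∑ i, (1 - negExp (x i)) * (ENNReal.ofReal lam * volume (A i))) := by
  have h1 : ∀ ω, ∑' n, ∑ i, (A i).indicator (fun _ => x i) (v n ω)
      = ∑ i, ({n | v n ω ∈ A i}.encard : ℝ≥0∞) * x i := by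
    intro ω
    rw [Summable.tsum_finsetSum fun _ _ => ENNReal.summable]
    refine Finset.sum_congr rfl fun i _ => ?_
    rw [← tsum_indicator_eq_encard, ← ENNReal.tsum_mul_right]
    refine tsum_congr fun n => ?_
    by_cases hm : v n ω ∈ A i <;> simp [hm]
  simp only [h1, negExp_sum]
  have hind : iIndepFun (fun i ω => negExp (({n | v n ω ∈ A i}.encard : ℝ≥0∞) * x i)) P :=
    (h.indep l A hA hvol hdisj).comp (fun i (k : ℕ∞) => negExp ((k : ℝ≥0∞) * x i))
      fun i => measurable_of_countable _
  rw [lintegral_prod_eq_prod_lintegral_of_indepFun _ _ hind fun i =>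
    measurable_negExp.comp ((measurable_encard h.measurable (hA i)).mul_const _)]
  exact Finset.prod_congr rfl fun i _ => h.lintegral_negExp_encard hlam (hA i) (hvol i) (x i)

/-- The generating functional of a Poisson process at a simple function of bounded support. -/
lemma IsPPP.lintegral_negExp_sum_simple [IsProbabilityMeasure P] (h : IsPPP P v lam)
    (hlam : 0 ≤ lam) (f : SimpleFunc Plane ℝ≥0∞) (hf : volume (Function.support f) < ∞) :
    ∫⁻ ω, negExp (∑' n, f (v n ω)) ∂P
      = negExp (∫⁻ y, (1 - negExp (f y)) ∂(ENNReal.ofReal lam • volume)) := by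
  classical
  set s : Finset ℝ≥0∞ := f.range.filter (· ≠ 0) with hs
  set c : Fin s.card → ℝ≥0∞ := fun i => (s.equivFin.symm i : ℝ≥0∞) with hc
  set A : Fin s.card → Set Plane := fun i => f ⁻¹' {c i} with hAdef
  have hc0 : ∀ i, c i ≠ 0 := fun i => (Finset.mem_filter.1 (s.equivFin.symm i).2).2
  have hcinj : Function.Injective c := fun i j hij =>
    s.equivFin.symm.injective (Subtype.ext hij)
  have hA : ∀ i, MeasurableSet (A i) := fun i => f.measurableSet_preimage _
  have hvol : ∀ i, volume (A i) < ∞ := fun i => by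
    refine (measure_mono fun y hy => ?_).trans_lt hf
    have : f y = c i := hy
    rw [Function.mem_support, this]
    exact hc0 i
  have hdisj : Pairwise fun i j => Disjoint (A i) (A j) := fun i j hij =>
    Set.disjoint_left.2 fun y h1 h2 => hij (hcinj ((show f y = c i from h1).symm.trans h2))
  -- Used twice: for the identity, to write `f` as a step function, and for `1 - negExp`, to split
  -- the integral on the right in the same way.
  have hrep : ∀ (g : ℝ≥0∞ → ℝ≥0∞), g 0 = 0 → ∀ y,
      g (f y) = ∑ i, (A i).indicator (fun _ => g (c i)) y := by
    intro g hg y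
    by_cases h0 : f y = 0
    · rw [h0, hg, Finset.sum_eq_zero]
      intro i _
      refine Set.indicator_of_notMem (fun hy => hc0 i ?_) _
      rw [← h0]
      exact (show f y = c i from hy).symm
    · have hmem : f y ∈ s := Finset.mem_filter.2 ⟨f.mem_range_self y, h0⟩
      set i₀ := s.equivFin ⟨f y, hmem⟩ with hi₀
      have hci : c i₀ = f y := by simp [hc, hi₀]
      rw [Finset.sum_eq_single i₀, Set.indicator_of_mem (show y ∈ A i₀ from hci.symm), hci]
      · intro j _ hj
        refine Set.indicator_of_notMem (fun hy => hj (hcinj ?_)) _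
        rw [hci]
        exact (show f y = c j from hy).symm
      · simp
  have h1 := h.lintegral_negExp_sum_step hlam hA hvol hdisj c
  have h2 : ∀ ω, ∑' n, f (v n ω) = ∑' n, ∑ i, (A i).indicator (fun _ => c i) (v n ω) :=
    fun ω => tsum_congr fun n => hrep id rfl _
  simp only [h2, h1]
  congr 1
  simp only [hrep (fun y => 1 - negExp y) (by simp [negExp_zero])]
  rw [lintegral_finsetSum _ fun i _ => measurable_const.indicator (hA i)]
  refine Finset.sum_congr rfl fun i _ => ?_
  rw [lintegral_indicator (hA i), setLIntegral_const, Measure.smul_apply, smul_eq_mul]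

/-- The generating functional of a Poisson process. -/
theorem IsPPP.lintegral_negExp_sum [IsProbabilityMeasure P] (h : IsPPP P v lam)
    (hlam : 0 ≤ lam) {f : Plane → ℝ≥0∞} (hf : Measurable f) :
    ∫⁻ ω, negExp (∑' n, f (v n ω)) ∂P
      = negExp (∫⁻ y, (1 - negExp (f y)) ∂(ENNReal.ofReal lam • volume)) := by
  -- The counts are Poisson only on sets of finite area, so the approximating simple functions are
  -- also cut off outside growing balls; they remain increasing in `k`.
  set g : ℕ → SimpleFunc Plane ℝ≥0∞ := fun k =>
    (SimpleFunc.eapprox f k).restrict (Metric.ball 0 k) with hg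
  have hgapply : ∀ k y, g k y = (Metric.ball (0 : Plane) k).indicator (SimpleFunc.eapprox f k) y :=
    fun k y => SimpleFunc.restrict_apply _ Metric.isOpen_ball.measurableSet _
  have hmono : ∀ y, Monotone fun k => g k y := by
    intro y i j hij
    simp only [hgapply]
    refine (Set.indicator_le_indicator (SimpleFunc.monotone_eapprox f hij y)).trans ?_
    exact Set.indicator_le_indicator_of_subset
      (Metric.ball_subset_ball (by exact_mod_cast hij)) (fun _ => zero_le) y
  have hlim : ∀ y, Tendsto (fun k => g k y) atTop (𝓝 (f y)) := by
    intro y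
    have h1 : Tendsto (fun k => SimpleFunc.eapprox f k y) atTop (𝓝 (f y)) := by
      rw [← SimpleFunc.iSup_eapprox_apply hf y]
      exact tendsto_atTop_iSup fun i j hij => SimpleFunc.monotone_eapprox f hij y
    refine h1.congr' ?_
    obtain ⟨K, hK⟩ := exists_nat_gt ‖y‖
    filter_upwards [eventually_ge_atTop K] with k hk
    rw [hgapply, Set.indicator_of_mem]
    rw [mem_ball_zero_iff]
    exact hK.trans_le (by exact_mod_cast hk)
  have hsupp : ∀ k, volume (Function.support (g k)) < ∞ := by
    intro k
    refine (measure_mono (t := Metric.ball (0 : Plane) k) fun y hy => ?_).trans_lt measure_ball_lt_top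
    by_contra hn
    rw [Function.mem_support, hgapply, Set.indicator_of_notMem hn] at hy
    exact hy rfl
  have hid := fun k => h.lintegral_negExp_sum_simple hlam (g k) (hsupp k)
  have hsum : ∀ ω, Tendsto (fun k => ∑' n, g k (v n ω)) atTop (𝓝 (∑' n, f (v n ω))) := by
    intro ω
    simp only [← lintegral_count]
    exact lintegral_tendsto_of_tendsto_of_monotone (fun k => measurable_of_countable _ |>.aemeasurable)
      (Eventually.of_forall fun n => hmono _) (Eventually.of_forall fun n => hlim _)
  have hL : Tendsto (fun k => ∫⁻ ω, negExp (∑' n, g k (v n ω)) ∂P) atTop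
      (𝓝 (∫⁻ ω, negExp (∑' n, f (v n ω)) ∂P)) := by
    refine tendsto_lintegral_of_dominated_convergence (fun _ => 1) ?_ ?_ (by simp) ?_
    · exact fun k => measurable_negExp.comp
        (Measurable.tsum fun n => (g k).measurable.comp (h.measurable n))
    · exact fun k => Eventually.of_forall fun ω => negExp_le_one _
    · exact Eventually.of_forall fun ω => (continuous_negExp.tendsto _).comp (hsum ω)
  have hR : Tendsto (fun k => ∫⁻ y, (1 - negExp (g k y)) ∂(ENNReal.ofReal lam • volume)) atTop
      (𝓝 (∫⁻ y, (1 - negExp (f y)) ∂(ENNReal.ofReal lam • volume))) := by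
    refine lintegral_tendsto_of_tendsto_of_monotone ?_ ?_ ?_
    · exact fun k => (measurable_const.sub (measurable_negExp.comp (g k).measurable)).aemeasurable
    · exact Eventually.of_forall fun y i j hij =>
        tsub_le_tsub_left (negExp_antitone (hmono y hij)) 1
    · exact Eventually.of_forall fun y => ENNReal.Tendsto.sub tendsto_const_nhds
        ((continuous_negExp.tendsto _).comp (hlim y)) (Or.inl ENNReal.one_ne_top)
  simp only [hid] at hL
  exact tendsto_nhds_unique hL ((continuous_negExp.tendsto _).comp hR)

end PoissonProcess

/-! ### The nearest point, weighted with the Laplace functional of the other points. -/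

/-- Integration of a radial function over the plane. -/
lemma lintegral_radial {g : ℝ → ℝ} (hg : ∀ r, 0 ≤ g r)
    (hint : IntegrableOn (fun r => r * g r) (Set.Ioi 0)) :
    ∫⁻ y : Plane, ENNReal.ofReal (g ‖y‖)
      = ENNReal.ofReal (2 * Real.pi * ∫ r in Set.Ioi 0, r * g r) := by
  have hdim : Module.finrank ℝ Plane = 2 := by simp [Plane]
  have hi : Integrable (fun y : Plane => g ‖y‖) := by
    rw [integrable_fun_norm_addHaar volume (f := g), hdim]
    simpa using hint
  have hball : (volume : Measure Plane).real (Metric.ball 0 1) = Real.pi := by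
    rw [Measure.real, EuclideanSpace.volume_ball_fin_two]
    simp [Real.pi_pos.le]
  rw [← ofReal_integral_eq_lintegral_ofReal hi (Eventually.of_forall fun y => hg _),
    integral_fun_norm_addHaar volume g, hdim, hball]
  congr 1
  simp
  ring

namespace Params

variable {p : Params}

/-- An average, with weights of total one, of numbers below one. Strictness is essential: `logLoss`
takes the logarithm of `1 - meanLoss`, and the factor of the nearest point is divided out later. -/
lemma meanLoss_lt_one {s : ℝ} (hs : 0 ≤ s) (u : ℝ) : p.meanLoss s u < 1 := by
  have hb : ∀ i, 0 < 1 - (p.prob Link.LOS (p.level u) * p.loss Link.LOS s (p.gain i) u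
      + p.prob Link.NLOS (p.level u) * p.loss Link.NLOS s (p.gain i) u) := by
    intro i
    have h1 := loss_lt_one (p := p) (κ := Link.LOS) hs (gain_nonneg (p := p) i) u
    have h2 := loss_lt_one (p := p) (κ := Link.NLOS) hs (gain_nonneg (p := p) i) u
    have h3 := prob_nonneg (p := p) Link.LOS (p.level u)
    have h4 := prob_nonneg (p := p) Link.NLOS (p.level u)
    have h5 := prob_add_prob (p := p) (p.level u)
    rcases h3.eq_or_lt with h | h
    · rw [← h] at h5 ⊢
      nlinarith
    · nlinarith [mul_pos h (sub_pos.2 h1), mul_nonneg h4 (sub_pos.2 h2).le]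
  obtain ⟨i, -, hi⟩ := Finset.exists_ne_zero_of_sum_ne_zero
    (show ∑ i, p.gainProb i ≠ 0 by rw [sum_gainProb]; exact one_ne_zero)
  have hpos : 0 < ∑ i, p.gainProb i * (1 - (p.prob Link.LOS (p.level u) *
      p.loss Link.LOS s (p.gain i) u + p.prob Link.NLOS (p.level u) *
      p.loss Link.NLOS s (p.gain i) u)) :=
    Finset.sum_pos' (fun j _ => mul_nonneg (gainProb_nonneg j) (hb j).le)
      ⟨i, Finset.mem_univ i, mul_pos (lt_of_le_of_ne (gainProb_nonneg i) hi.symm) (hb i)⟩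
  simp only [mul_sub, mul_one, Finset.sum_sub_distrib, sum_gainProb] at hpos
  unfold meanLoss
  linarith

lemma continuousAt_meanLoss_right {s u : ℝ} (hs : 0 ≤ s) (hu : 0 < u)
    (hgrid : u ∉ Set.range fun j : ℕ => (j : ℝ) / p.ρ) :
    ContinuousAt (p.meanLoss s) u := by
  have h : ∀ κ i, ContinuousAt (fun u => p.loss κ s (p.gain i) u) u := fun κ i =>
    ContinuousAt.comp (f := fun u => (s, u)) (continuousAt_loss hs (gain_nonneg i) hu)
      (by fun_prop)
  set j := p.level u with hj
  have h1 : (j : ℝ) / p.ρ < u := lt_of_le_of_ne (level_div_le hu.le) fun h => hgrid ⟨j, h⟩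
  have hlev : ∀ᶠ y in 𝓝 u, p.level y = j := by
    filter_upwards [lt_mem_nhds h1, gt_mem_nhds (lt_level_add_one_div u)] with y h2 h3
      using level_eq h2.le h3
  have hc : ContinuousAt (fun u => ∑ i, p.gainProb i *
      (p.prob Link.LOS j * p.loss Link.LOS s (p.gain i) u
        + p.prob Link.NLOS j * p.loss Link.NLOS s (p.gain i) u)) u :=
    tendsto_finsetSum _ fun i _ => ((((h Link.LOS i).const_mul _).add
      ((h Link.NLOS i).const_mul _)).const_mul _).tendsto
  refine hc.congr ?_
  filter_upwards [hlev] with y hy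
  rw [meanLoss, hy]

/-- The joint density of the nearest distance and of the Laplace functional of all points. -/
def nearestWeight (p : Params) (s r : ℝ) : ℝ :=
  (1 - p.meanLoss s r) * (p.nearestPDF r * p.laplaceIntegral s r)

/-- The tail of `nearestWeight`. -/
def nearestTail (p : Params) (s a : ℝ) : ℝ :=
  Real.exp (-(Real.pi * p.lam * a ^ 2)) * p.laplaceIntegral s a

lemma nearestWeight_nonneg {s r : ℝ} (hs : 0 ≤ s) (hr : 0 ≤ r) : 0 ≤ p.nearestWeight s r :=
  mul_nonneg (sub_nonneg.2 (meanLoss_lt_one hs r).le)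
    (mul_nonneg (nearestPDF_nonneg hr) (laplaceIntegral_pos _ _).le)

lemma continuousOn_laplaceIntegral_right {s : ℝ} (hs : 0 ≤ s) :
    ContinuousOn (p.laplaceIntegral s) (Set.Ici 0) := fun _ hr =>
  tendsto_laplaceIntegral tendsto_const_nhds (tendsto_id.mono_left nhdsWithin_le_nhds)
    (Eventually.of_forall fun _ => hs) self_mem_nhdsWithin hs hr

lemma integrableOn_nearestWeight {s : ℝ} (hs : 0 ≤ s) :
    IntegrableOn (p.nearestWeight s) (Set.Ioi 0) := by
  refine Integrable.mono' p.integrableOn_nearestPDF ?_ ?_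
  · exact (measurable_const.sub (p.measurable_meanLoss s)).aestronglyMeasurable.mul
      (p.continuous_nearestPDF.aestronglyMeasurable.mul
        (((continuousOn_laplaceIntegral_right hs).mono Set.Ioi_subset_Ici_self).aestronglyMeasurable
          measurableSet_Ioi))
  · filter_upwards [ae_restrict_mem measurableSet_Ioi] with r hr
    have hr : 0 < r := hr
    rw [Real.norm_of_nonneg (nearestWeight_nonneg hs hr.le)]
    have h1 := meanLoss_nonneg (p := p) hs r
    have h2 := laplaceIntegral_le_one (p := p) hs hr.le
    have h3 := nearestPDF_nonneg (p := p) hr.le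
    have h4 := (laplaceIntegral_pos (p := p) s r).le
    exact (mul_le_of_le_one_left (mul_nonneg h3 h4) (by linarith)).trans
      (mul_le_of_le_one_right h3 h2)

/-- The exponent of the tail is `-π λ r² - 2 π λ ∫_r^∞ u meanLoss`, with derivative `-2 π λ r (1 -
meanLoss s r)`. The grid points are excluded because the level, and with it the loss, may jump
there. -/
lemma hasDerivAt_nearestTail {s r : ℝ} (hs : 0 ≤ s) (hr : 0 < r)
    (hgrid : r ∉ Set.range fun j : ℕ => (j : ℝ) / p.ρ) :
    HasDerivAt (p.nearestTail s) (-p.nearestWeight s r) r := by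
  have hint := integrableOn_mul_meanLoss (p := p) hs
  have hprim : HasDerivAt (fun y => ∫ u in Set.Ioi y, u * p.meanLoss s u)
      (-(r * p.meanLoss s r)) r := by
    have h1 : HasDerivAt (fun y => ∫ u in (0 : ℝ)..y, u * p.meanLoss s u)
        (r * p.meanLoss s r) r := by
      refine intervalIntegral.integral_hasDerivAt_right ?_ ?_ ?_
      · rw [intervalIntegrable_iff_integrableOn_Ioc_of_le hr.le]
        exact hint.mono_set Set.Ioc_subset_Ioi_self
      · exact (measurable_id.mul (p.measurable_meanLoss s)).stronglyMeasurable.stronglyMeasurableAtFilter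
      · exact continuousAt_id.mul (continuousAt_meanLoss_right hs hr hgrid)
    refine (h1.const_sub (∫ u in Set.Ioi 0, u * p.meanLoss s u)).congr_of_eventuallyEq ?_
    filter_upwards [lt_mem_nhds hr] with y hy
    rw [eq_sub_iff_add_eq, add_comm]
    exact intervalIntegral.integral_interval_add_Ioi hint
      (hint.mono_set (Set.Ioi_subset_Ioi (le_of_lt hy)))
  have hl : HasDerivAt (p.laplaceIntegral s) _ r := (hprim.const_mul (2 * Real.pi * p.lam)).neg.exp
  have hsq : HasDerivAt (fun a : ℝ => Real.exp (-(Real.pi * p.lam * a ^ 2))) _ r :=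
    ((hasDerivAt_pow 2 r).const_mul (Real.pi * p.lam)).neg.exp
  refine (hsq.mul hl).congr_deriv ?_
  simp only [nearestWeight, nearestPDF, laplaceIntegral, Pi.neg_apply]
  push_cast
  ring

lemma tendsto_nearestTail {s : ℝ} (hs : 0 ≤ s) : Tendsto (p.nearestTail s) atTop (𝓝 0) := by
  have hc : 0 < Real.pi * p.lam := mul_pos Real.pi_pos p.lam_pos
  have h1 : Tendsto (fun a : ℝ => Real.exp (-(Real.pi * p.lam * a ^ 2))) atTop (𝓝 0) :=
    Real.tendsto_exp_neg_atTop_nhds_zero.comp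
      ((tendsto_pow_atTop two_ne_zero).const_mul_atTop hc)
  refine squeeze_zero' ?_ ?_ h1
  · exact Eventually.of_forall fun a =>
      mul_nonneg (Real.exp_pos _).le (laplaceIntegral_pos _ _).le
  · filter_upwards [eventually_ge_atTop 0] with a ha
    exact mul_le_of_le_one_right (Real.exp_pos _).le (laplaceIntegral_le_one hs ha)

/-- The grid is countable and the tail is continuous across it, so the fundamental theorem of
calculus with a countable exceptional set applies; the tail vanishes at infinity. -/
lemma integral_nearestWeight {s a : ℝ} (hs : 0 ≤ s) (ha : 0 ≤ a) :
    ∫ r in Set.Ioi a, p.nearestWeight s r = p.nearestTail s a := by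
  have hint := (integrableOn_nearestWeight (p := p) hs).mono_set (Set.Ioi_subset_Ioi ha)
  have h1 := intervalIntegral_tendsto_integral_Ioi a hint tendsto_id
  have h2 : Tendsto (fun b => p.nearestTail s a - p.nearestTail s b) atTop
      (𝓝 (p.nearestTail s a)) := by
    simpa using tendsto_const_nhds.sub (tendsto_nearestTail (p := p) hs)
  refine tendsto_nhds_unique h1 (h2.congr' ?_)
  filter_upwards [eventually_ge_atTop a] with b hb
  have hcont : ContinuousOn (p.nearestTail s) (Set.Icc a b) :=
    ContinuousOn.mul (by fun_prop) ((continuousOn_laplaceIntegral_right hs).mono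
      fun x hx => ha.trans hx.1)
  have hI : IntervalIntegrable (p.nearestWeight s) volume a b := by
    rw [intervalIntegrable_iff_integrableOn_Ioc_of_le hb]
    exact hint.mono_set Set.Ioc_subset_Ioi_self
  have := integral_eq_of_hasDerivAt_off_countable_of_le (p.nearestTail s)
    (fun r => -p.nearestWeight s r) hb (Set.countable_range fun j : ℕ => (j : ℝ) / p.ρ) hcont
    (fun x hx => hasDerivAt_nearestTail hs (ha.trans_lt hx.1.1) hx.2) hI.neg
  rw [intervalIntegral.integral_neg] at this
  simp only [id]
  linarith

/-- Minus the logarithm of the Laplace transform of the power of an interferer. -/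
def logLoss (p : Params) (s r : ℝ) : ℝ≥0∞ := ENNReal.ofReal (-Real.log (1 - p.meanLoss s r))

lemma measurable_logLoss (p : Params) (s : ℝ) : Measurable (p.logLoss s) :=
  ((Real.measurable_log.comp (measurable_const.sub (p.measurable_meanLoss s))).neg).ennreal_ofReal

lemma negExp_logLoss {s : ℝ} (hs : 0 ≤ s) (r : ℝ) :
    negExp (p.logLoss s r) = ENNReal.ofReal (1 - p.meanLoss s r) := by
  have h1 := meanLoss_nonneg (p := p) hs r
  have h2 := meanLoss_lt_one (p := p) hs r
  rw [logLoss, negExp_ofReal, neg_neg, Real.exp_log (by linarith)]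
  rw [neg_nonneg]
  exact Real.log_nonpos (by linarith) (by linarith)

section Nearest

variable {Ω : Type*} [MeasurableSpace Ω] {P : Measure Ω} {v : ℕ → Ω → Plane} {p : Params}

/-- The Laplace functional of all points on the event that there is no point within distance
`a`. -/
lemma lintegral_nearest_ge [IsProbabilityMeasure P] (h : IsPPP P v p.lam)
    (hrank : ∀ᵐ ω ∂P, StrictMono fun n => ‖v n ω‖) {s a : ℝ} (hs : 0 ≤ s) (ha : 0 ≤ a) :
    ∫⁻ ω, (Set.Ici a).indicator 1 ‖v 0 ω‖ * negExp (∑' n, p.logLoss s ‖v n ω‖) ∂P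
      = ENNReal.ofReal (p.nearestTail s a) := by
  -- Since `negExp ⊤ = 0`, one point within distance `a` annihilates the exponential. The single
  -- function `f` thus encodes both the void event and the Laplace functional; by the ranking, the
  -- event is `a ≤ ‖v 0 ω‖`.
  set f : Plane → ℝ≥0∞ := fun y => (Set.Iio a).indicator (fun _ => ⊤) ‖y‖ + p.logLoss s ‖y‖
    with hf
  have hfm : Measurable f := ((measurable_const.indicator measurableSet_Iio).comp
    measurable_norm).add ((p.measurable_logLoss s).comp measurable_norm)
  have hpg := h.lintegral_negExp_sum p.lam_pos.le hfm
  have hL : ∀ᵐ ω ∂P, negExp (∑' n, f (v n ω))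
      = (Set.Ici a).indicator 1 ‖v 0 ω‖ * negExp (∑' n, p.logLoss s ‖v n ω‖) := by
    filter_upwards [hrank] with ω hω
    by_cases h0 : a ≤ ‖v 0 ω‖
    · rw [Set.indicator_of_mem (show ‖v 0 ω‖ ∈ Set.Ici a from h0), Pi.one_apply, one_mul]
      congr 1
      refine tsum_congr fun n => ?_
      have : ‖v n ω‖ ∉ Set.Iio a := not_lt.2 (h0.trans (hω.monotone (Nat.zero_le n)))
      simp only [hf, Set.indicator_of_notMem this, zero_add]
    · rw [Set.indicator_of_notMem (show ‖v 0 ω‖ ∉ Set.Ici a from h0), zero_mul]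
      have : f (v 0 ω) = ⊤ := by
        simp only [hf, Set.indicator_of_mem (show ‖v 0 ω‖ ∈ Set.Iio a from not_le.1 h0), top_add]
      rw [ENNReal.tsum_eq_top_of_eq_top ⟨0, this⟩, negExp_top]
  rw [← lintegral_congr_ae hL, hpg]
  set g : ℝ → ℝ := fun r => if r < a then 1 else p.meanLoss s r with hg
  have hg0 : ∀ r, 0 ≤ g r := fun r => by
    simp only [hg]; split_ifs
    · exact zero_le_one
    · exact meanLoss_nonneg hs r
  have hfg : ∀ y, 1 - negExp (f y) = ENNReal.ofReal (g ‖y‖) := by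
    intro y
    by_cases hy : ‖y‖ < a
    · simp only [hf, hg, Set.indicator_of_mem (show ‖y‖ ∈ Set.Iio a from hy), hy, top_add,
        negExp_top, if_true, tsub_zero, ENNReal.ofReal_one]
    · simp only [hf, hg, Set.indicator_of_notMem (show ‖y‖ ∉ Set.Iio a from hy), hy, zero_add,
        if_false, negExp_logLoss hs]
      rw [← ENNReal.ofReal_one, ← ENNReal.ofReal_sub _ (sub_nonneg.2 (meanLoss_lt_one hs _).le)]
      congr 1
      ring
  have hint := integrableOn_mul_meanLoss (p := p) hs
  have hinta := hint.mono_set (Set.Ioi_subset_Ioi ha)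
  have hgl : Set.EqOn (fun r => r * g r) (fun r => r) (Set.Ioo 0 a) := fun r hr => by
    simp [hg, hr.2]
  have hgr : Set.EqOn (fun r => r * g r) (fun r => r * p.meanLoss s r) (Set.Ioi a) := fun r hr => by
    simp [hg, not_lt.2 (le_of_lt (show a < r from hr))]
  have hi1 : IntegrableOn (fun r => r * g r) (Set.Ioc 0 a) := by
    rw [integrableOn_Ioc_iff_integrableOn_Ioo]
    refine IntegrableOn.congr_fun ?_ hgl.symm measurableSet_Ioo
    exact (continuous_id.integrableOn_Icc (a := 0) (b := a)).mono_set Set.Ioo_subset_Icc_self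
  have hi2 : IntegrableOn (fun r => r * g r) (Set.Ioi a) :=
    hinta.congr_fun hgr.symm measurableSet_Ioi
  have hi : IntegrableOn (fun r => r * g r) (Set.Ioi 0) := by
    rw [← Set.Ioc_union_Ioi_eq_Ioi ha]; exact hi1.union hi2
  have hval : ∫ r in Set.Ioi 0, r * g r
      = a ^ 2 / 2 + ∫ r in Set.Ioi a, r * p.meanLoss s r := by
    rw [← Set.Ioc_union_Ioi_eq_Ioi ha, setIntegral_union (Set.Ioc_disjoint_Ioi le_rfl)
      measurableSet_Ioi hi1 hi2, setIntegral_congr_fun measurableSet_Ioi hgr,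
      integral_Ioc_eq_integral_Ioo, setIntegral_congr_fun measurableSet_Ioo hgl,
      ← integral_Ioc_eq_integral_Ioo, ← intervalIntegral.integral_of_le ha, integral_id]
    ring
  have hpos : 0 ≤ ∫ r in Set.Ioi a, r * p.meanLoss s r :=
    setIntegral_nonneg measurableSet_Ioi fun r hr =>
      mul_nonneg (ha.trans (le_of_lt hr)) (meanLoss_nonneg hs r)
  have hlam := p.lam_pos.le
  have hπ := Real.pi_pos.le
  simp only [hfg]
  rw [lintegral_smul_measure, lintegral_radial hg0 hi, hval, smul_eq_mul,
    ← ENNReal.ofReal_mul hlam, negExp_ofReal (by positivity), nearestTail,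
    laplaceIntegral, ← Real.exp_add]
  congr 2
  ring

/-- The law of the nearest distance, weighted with the Laplace functional of all points. -/
lemma lintegral_nearest_all [IsProbabilityMeasure P] (h : IsPPP P v p.lam)
    (hrank : ∀ᵐ ω ∂P, StrictMono fun n => ‖v n ω‖) {s : ℝ} (hs : 0 ≤ s) {φ : ℝ → ℝ≥0∞}
    (hφ : Measurable φ) :
    ∫⁻ ω, φ ‖v 0 ω‖ * negExp (∑' n, p.logLoss s ‖v n ω‖) ∂P
      = ∫⁻ r in Set.Ioi 0, φ r * ENNReal.ofReal (p.nearestWeight s r) := by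
  have hvm := h.measurable
  set F : Ω → ℝ≥0∞ := fun ω => negExp (∑' n, p.logLoss s ‖v n ω‖) with hF
  have hFm : Measurable F := measurable_negExp.comp
    (Measurable.tsum fun n => (p.measurable_logLoss s).comp (hvm n).norm)
  have hr0 : Measurable fun ω => ‖v 0 ω‖ := (hvm 0).norm
  set W : ℝ → ℝ≥0∞ := fun r => ENNReal.ofReal (p.nearestWeight s r) with hW
  have hint := integrableOn_nearestWeight (p := p) hs
  have hWm : AEMeasurable W (volume.restrict (Set.Ioi 0)) := hint.aemeasurable.ennreal_ofReal
  set ν₁ : Measure ℝ := (P.withDensity F).map fun ω => ‖v 0 ω‖ with hν₁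
  set ν₂ : Measure ℝ := (volume.restrict (Set.Ioi 0)).withDensity W with hν₂
  have hfin : IsFiniteMeasure (P.withDensity F) := by
    refine isFiniteMeasure_withDensity ((lintegral_mono fun ω => negExp_le_one _).trans_lt ?_).ne
    simp
  -- Finite measures on the line are determined by closed upper half lines. The bound `a` may be
  -- replaced by `max a 0` because neither measure charges the negative numbers.
  have hν : ν₁ = ν₂ := by
    refine Measure.ext_of_Ici ν₁ ν₂ fun a => ?_
    set b := max a 0 with hb
    have hb0 : 0 ≤ b := le_max_right _ _
    have h1 : ν₁ (Set.Ici a) = ENNReal.ofReal (p.nearestTail s b) := by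
      rw [← lintegral_nearest_ge h hrank hs hb0, hν₁, Measure.map_apply hr0 measurableSet_Ici,
        withDensity_apply _ (hr0 measurableSet_Ici), ← lintegral_indicator (hr0 measurableSet_Ici)]
      refine lintegral_congr fun ω => ?_
      have hiff : a ≤ ‖v 0 ω‖ ↔ b ≤ ‖v 0 ω‖ := by simp [hb]
      by_cases hm : a ≤ ‖v 0 ω‖
      · rw [Set.indicator_of_mem (show ω ∈ (fun ω => ‖v 0 ω‖) ⁻¹' Set.Ici a from hm),
          Set.indicator_of_mem (show ‖v 0 ω‖ ∈ Set.Ici b from hiff.1 hm), Pi.one_apply, one_mul]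
      · rw [Set.indicator_of_notMem (show ω ∉ (fun ω => ‖v 0 ω‖) ⁻¹' Set.Ici a from hm),
          Set.indicator_of_notMem (show ‖v 0 ω‖ ∉ Set.Ici b from fun h' => hm (hiff.2 h')),
          zero_mul]
    have h2 : ν₂ (Set.Ici a) = ENNReal.ofReal (p.nearestTail s b) := by
      have hset : (Set.Ici a ∩ Set.Ioi 0 : Set ℝ) =ᵐ[volume] Set.Ioi b := by
        rw [hb, ← Set.Ioi_inter_Ioi]
        exact Ioi_ae_eq_Ici.symm.inter (ae_eq_refl _)
      rw [hν₂, withDensity_apply _ measurableSet_Ici, Measure.restrict_restrict measurableSet_Ici,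
        setLIntegral_congr hset, ← integral_nearestWeight hs hb0,
        ofReal_integral_eq_lintegral_ofReal (hint.mono_set (Set.Ioi_subset_Ioi hb0))]
      filter_upwards [ae_restrict_mem measurableSet_Ioi] with r hr
      exact nearestWeight_nonneg hs (hb0.trans (le_of_lt hr))
    rw [h1, h2]
  have e1 : ∫⁻ r, φ r ∂ν₁ = ∫⁻ ω, φ ‖v 0 ω‖ * F ω ∂P := by
    rw [hν₁, lintegral_map hφ hr0]
    refine (lintegral_withDensity_eq_lintegral_mul _ hFm (hφ.comp hr0)).trans ?_
    exact lintegral_congr fun ω => mul_comm _ _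
  have e2 : ∫⁻ r, φ r ∂ν₂ = ∫⁻ r in Set.Ioi 0, φ r * W r := by
    rw [hν₂, lintegral_withDensity_eq_lintegral_mul₀ hWm hφ.aemeasurable]
    exact lintegral_congr fun r => mul_comm _ _
  rw [← e1, ← e2, hν]

/-- The law of the nearest distance, weighted with the Laplace functional of the other points. -/
theorem lintegral_nearest [IsProbabilityMeasure P] (h : IsPPP P v p.lam)
    (hrank : ∀ᵐ ω ∂P, StrictMono fun n => ‖v n ω‖) {s : ℝ} (hs : 0 ≤ s) {φ : ℝ → ℝ≥0∞}
    (hφ : Measurable φ) :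
    ∫⁻ ω, φ ‖v 0 ω‖ * negExp (∑' n, p.logLoss s ‖v (n + 1) ω‖) ∂P
      = ∫⁻ r in Set.Ioi 0, φ r * ENNReal.ofReal (p.nearestPDF r * p.laplaceIntegral s r) := by
  have hm := p.measurable_meanLoss s
  -- The test function is divided by `1 - meanLoss`, the factor with which the nearest point enters
  -- the functional of all points.
  have hall := lintegral_nearest_all h hrank hs
    (φ := fun r => φ r * (ENNReal.ofReal (1 - p.meanLoss s r))⁻¹) (by fun_prop)
  have hne : ∀ r, ENNReal.ofReal (1 - p.meanLoss s r) ≠ 0 := fun r => by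
    rw [Ne, ENNReal.ofReal_eq_zero, not_le]
    exact sub_pos.2 (meanLoss_lt_one hs r)
  convert hall using 1
  · refine lintegral_congr fun ω => ?_
    rw [tsum_eq_zero_add' (f := fun n => p.logLoss s ‖v n ω‖) ENNReal.summable, negExp_add,
      negExp_logLoss hs, mul_assoc, ← mul_assoc _⁻¹,
      ENNReal.inv_mul_cancel (hne _) ENNReal.ofReal_ne_top, one_mul]
  · refine lintegral_congr fun r => ?_
    rw [nearestWeight, ENNReal.ofReal_mul (sub_nonneg.2 (meanLoss_lt_one hs r).le),
      mul_assoc, ← mul_assoc _⁻¹, ENNReal.inv_mul_cancel (hne _) ENNReal.ofReal_ne_top, one_mul]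

end Nearest

end Params

/-! ### The marks, and the Laplace transform of the power of one interferer. -/

/-- The Laplace transform of the Gamma distribution. -/
lemma lintegral_negExp_gammaMeasure {a r c : ℝ} (ha : 0 < a) (hr : 0 < r) (hc : 0 ≤ c) :
    ∫⁻ x, negExp (ENNReal.ofReal (c * x)) ∂(gammaMeasure a r)
      = ENNReal.ofReal ((r / (r + c)) ^ a) := by
  have hrc : 0 < r + c := by positivity
  have hpdf : Measurable (gammaPDF a r) := (measurable_gammaPDFReal a r).ennreal_ofReal
  have hpdf' : Measurable (gammaPDF a (r + c)) := (measurable_gammaPDFReal a _).ennreal_ofReal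
  have hm : Measurable fun x : ℝ => negExp (ENNReal.ofReal (c * x)) :=
    measurable_negExp.comp (measurable_const.mul measurable_id).ennreal_ofReal
  -- Exponential tilting: the density of rate `r` times `e^{-cx}` is a constant times the density of
  -- rate `r + c`, whose total mass one is inserted on the right.
  rw [gammaMeasure, lintegral_withDensity_eq_lintegral_mul _ hpdf hm,
    ← mul_one (ENNReal.ofReal _), ← lintegral_gammaPDF_eq_one ha hrc, ← lintegral_const_mul _ hpdf']
  refine lintegral_congr fun x => ?_
  simp only [Pi.mul_apply]
  rcases lt_or_ge x 0 with hx | hx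
  · rw [gammaPDF_of_neg hx, gammaPDF_of_neg hx, zero_mul, mul_zero]
  · have hΓ := Real.Gamma_pos_of_pos ha
    rw [gammaPDF_of_nonneg hx, gammaPDF_of_nonneg hx, negExp_ofReal (by positivity),
      ← ENNReal.ofReal_mul (by positivity), ← ENNReal.ofReal_mul (by positivity)]
    congr 1
    have e : Real.exp (-((r + c) * x)) = Real.exp (-(r * x)) * Real.exp (-(c * x)) := by
      rw [← Real.exp_add]; congr 1; ring
    have hp : (r + c) ^ a ≠ 0 := (Real.rpow_pos_of_pos hrc a).ne'
    rw [Real.div_rpow hr.le hrc.le, e]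
    field_simp

namespace Params

variable {p : Params}

lemma isProbabilityMeasure_fadingLaw (p : Params) (κ : Link) :
    IsProbabilityMeasure (p.fadingLaw κ) :=
  isProbabilityMeasure_gammaMeasure (p.N_cast_pos κ) (p.N_cast_pos κ)

lemma lintegral_gainLaw (p : Params) (f : Fin 4 → ℝ≥0∞) :
    ∫⁻ i, f i ∂p.gainLaw = ∑ i, ENNReal.ofReal (p.gainProb i) * f i := by
  simp [gainLaw, lintegral_finsetSum_measure, lintegral_smul_measure, lintegral_dirac]

lemma isProbabilityMeasure_gainLaw (p : Params) : IsProbabilityMeasure p.gainLaw where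
  measure_univ := by
    have := p.lintegral_gainLaw 1
    simp only [Pi.one_apply, lintegral_one, mul_one] at this
    rw [this, ← ENNReal.ofReal_sum_of_nonneg fun i _ => gainProb_nonneg i, sum_gainProb,
      ENNReal.ofReal_one]

lemma isProbabilityMeasure_unitInterval :
    IsProbabilityMeasure (volume.restrict (Set.Icc (0 : ℝ) 1)) where
  measure_univ := by simp

lemma isProbabilityMeasure_markLaw (p : Params) : IsProbabilityMeasure p.markLaw := by
  have := p.isProbabilityMeasure_fadingLaw Link.LOS
  have := p.isProbabilityMeasure_fadingLaw Link.NLOS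
  have := p.isProbabilityMeasure_gainLaw
  have := isProbabilityMeasure_unitInterval
  unfold markLaw
  infer_instance

lemma measurableSet_state_LOS (p : Params) :
    MeasurableSet {y : Plane × Mark | y.2.1 ≤ p.pLOS (p.level ‖y.1‖)} := by
  refine measurableSet_le (measurable_fst.comp measurable_snd) ?_
  exact (measurable_prob_level (p := p) Link.LOS).comp (measurable_norm.comp measurable_fst)

/-- A function of the state and of the location and mark is measurable if it is so for each
state. -/
lemma measurable_of_state {α : Type*} [MeasurableSpace α] {β : Type*} [MeasurableSpace β]
    {g : Link → α → β} (hg : ∀ κ, Measurable (g κ)) {f : α → Plane × Mark} (hf : Measurable f) :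
    Measurable fun a => g (p.state (f a).1 (f a).2) a := by
  classical
  have : (fun a => g (p.state (f a).1 (f a).2) a) = fun a =>
      if f a ∈ {y : Plane × Mark | y.2.1 ≤ p.pLOS (p.level ‖y.1‖)} then g Link.LOS a
      else g Link.NLOS a := by
    funext a
    by_cases h : (f a).2.1 ≤ p.pLOS (p.level ‖(f a).1‖)
    · simp [state, h]
    · simp [state, h]
  rw [this]
  exact Measurable.ite (hf p.measurableSet_state_LOS) (hg _) (hg _)

lemma measurable_fading (κ : Link) : Measurable fun z : Mark => z.fading κ := by
  cases κ
  · exact measurable_fst.comp (measurable_snd.comp measurable_snd)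
  · exact measurable_snd.comp (measurable_snd.comp measurable_snd)

/-- Integration over the mark of a UAV: the state, the gain and the fading that applies. -/
lemma lintegral_markLaw (p : Params) (x : Plane) {g : Link → Fin 4 → ℝ → ℝ≥0∞}
    (hg : ∀ κ i, Measurable (g κ i)) :
    ∫⁻ z, g (p.state x z) z.2.1 (z.fading (p.state x z)) ∂p.markLaw
      = ENNReal.ofReal (p.prob Link.LOS (p.level ‖x‖)) *
          ∑ i, ENNReal.ofReal (p.gainProb i) * ∫⁻ y, g Link.LOS i y ∂p.fadingLaw Link.LOS
        + ENNReal.ofReal (p.prob Link.NLOS (p.level ‖x‖)) *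
          ∑ i, ENNReal.ofReal (p.gainProb i) * ∫⁻ y, g Link.NLOS i y ∂p.fadingLaw Link.NLOS := by
  have := p.isProbabilityMeasure_fadingLaw Link.LOS
  have := p.isProbabilityMeasure_fadingLaw Link.NLOS
  have := p.isProbabilityMeasure_gainLaw
  have := isProbabilityMeasure_unitInterval
  have hgm : ∀ κ, Measurable fun y : Fin 4 × ℝ => g κ y.1 y.2 := fun κ =>
    measurable_from_prod_countable_right (hg κ)
  have hm : Measurable fun z : Mark => g (p.state x z) z.2.1 (z.fading (p.state x z)) :=
    measurable_of_state (g := fun κ z => g κ z.2.1 (z.fading κ)) (f := fun z => (x, z))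
      (fun κ => (hgm κ).comp ((measurable_fst.comp measurable_snd).prodMk (measurable_fading κ)))
      measurable_prodMk_left
  rw [markLaw, lintegral_prod _ hm.aemeasurable]
  set c := p.pLOS (p.level ‖x‖) with hc
  have hc0 : 0 ≤ c := pLOS_nonneg _
  have hc1 : c ≤ 1 := pLOS_le_one _
  have hL : ∫⁻ y, g Link.LOS y.1 y.2.1 ∂(p.gainLaw.prod
      ((p.fadingLaw Link.LOS).prod (p.fadingLaw Link.NLOS)))
      = ∑ i, ENNReal.ofReal (p.gainProb i) * ∫⁻ y, g Link.LOS i y ∂p.fadingLaw Link.LOS := by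
    have hm' : Measurable fun y : Fin 4 × ℝ × ℝ => g Link.LOS y.1 y.2.1 :=
      (hgm _).comp (measurable_fst.prodMk (measurable_fst.comp measurable_snd))
    rw [lintegral_prod _ hm'.aemeasurable, lintegral_gainLaw]
    refine Finset.sum_congr rfl fun i _ => ?_
    have hmi : Measurable fun y : ℝ × ℝ => g Link.LOS i y.1 := (hg _ i).comp measurable_fst
    rw [lintegral_prod _ hmi.aemeasurable]
    simp
  have hN : ∫⁻ y, g Link.NLOS y.1 y.2.2 ∂(p.gainLaw.prod
      ((p.fadingLaw Link.LOS).prod (p.fadingLaw Link.NLOS)))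
      = ∑ i, ENNReal.ofReal (p.gainProb i) * ∫⁻ y, g Link.NLOS i y ∂p.fadingLaw Link.NLOS := by
    have hm' : Measurable fun y : Fin 4 × ℝ × ℝ => g Link.NLOS y.1 y.2.2 :=
      (hgm _).comp (measurable_fst.prodMk (measurable_snd.comp measurable_snd))
    rw [lintegral_prod _ hm'.aemeasurable, lintegral_gainLaw]
    refine Finset.sum_congr rfl fun i _ => ?_
    have hmi : Measurable fun y : ℝ × ℝ => g Link.NLOS i y.2 := (hg _ i).comp measurable_snd
    rw [lintegral_prod _ hmi.aemeasurable]
    simp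
  rw [← hL, ← hN]
  set AL := ∫⁻ y, g Link.LOS y.1 y.2.1 ∂(p.gainLaw.prod
      ((p.fadingLaw Link.LOS).prod (p.fadingLaw Link.NLOS)))
  set AN := ∫⁻ y, g Link.NLOS y.1 y.2.2 ∂(p.gainLaw.prod
      ((p.fadingLaw Link.LOS).prod (p.fadingLaw Link.NLOS)))
  have hinner : ∀ u : ℝ, (∫⁻ y : Fin 4 × ℝ × ℝ, g (p.state x (u, y)) y.1
      (Mark.fading (u, y) (p.state x (u, y))) ∂(p.gainLaw.prod
      ((p.fadingLaw Link.LOS).prod (p.fadingLaw Link.NLOS))))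
      = (Set.Iic c).indicator (fun _ => AL) u + (Set.Ioi c).indicator (fun _ => AN) u := by
    intro u
    by_cases h : u ≤ c
    · rw [Set.indicator_of_mem (show u ∈ Set.Iic c from h),
        Set.indicator_of_notMem (show u ∉ Set.Ioi c from not_lt.2 h), add_zero]
      have hst : ∀ y, p.state x (u, y) = Link.LOS := fun y => by
        simp only [state, ← hc, h, if_true]
      simp only [hst, Mark.fading]
      rfl
    · rw [Set.indicator_of_notMem (show u ∉ Set.Iic c from h),
        Set.indicator_of_mem (show u ∈ Set.Ioi c from not_le.1 h), zero_add]
      have hst : ∀ y, p.state x (u, y) = Link.NLOS := fun y => by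
        simp only [state, ← hc, h, if_false]
      simp only [hst, Mark.fading]
      rfl
  refine (lintegral_congr hinner).trans ?_
  rw [lintegral_add_left (measurable_const.indicator measurableSet_Iic),
    lintegral_indicator measurableSet_Iic, lintegral_indicator measurableSet_Ioi,
    Measure.restrict_restrict measurableSet_Iic, Measure.restrict_restrict measurableSet_Ioi,
    setLIntegral_const, setLIntegral_const]
  have e1 : Set.Iic c ∩ Set.Icc 0 1 = Set.Icc 0 c := by
    ext u; simp only [Set.mem_inter_iff, Set.mem_Iic, Set.mem_Icc]
    constructor
    · rintro ⟨h1, h2, h3⟩; exact ⟨h2, h1⟩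
    · rintro ⟨h1, h2⟩; exact ⟨h2, h1, h2.trans hc1⟩
  have e2 : Set.Ioi c ∩ Set.Icc 0 1 = Set.Ioc c 1 := by
    ext u; simp only [Set.mem_inter_iff, Set.mem_Ioi, Set.mem_Icc, Set.mem_Ioc]
    constructor
    · rintro ⟨h1, h2, h3⟩; exact ⟨h1, h3⟩
    · rintro ⟨h1, h2⟩; exact ⟨h1, hc0.trans h1.le, h2⟩
  rw [e1, e2, Real.volume_Icc, Real.volume_Ioc, sub_zero]
  simp only [prob, ← hc]
  ring

lemma pathLoss_eq (κ : Link) (r : ℝ) :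
    p.pathLoss κ r = p.C κ / (r ^ 2 + p.Δh ^ 2) ^ (p.α κ / 2) := by
  have hx : 0 ≤ r ^ 2 + p.Δh ^ 2 := by positivity
  rw [pathLoss, Real.sqrt_eq_rpow, ← Real.rpow_mul hx]
  ring_nf

lemma pathLoss_nonneg (κ : Link) (r : ℝ) : 0 ≤ p.pathLoss κ r :=
  div_nonneg (p.C_pos κ).le (Real.sqrt_nonneg _)

lemma measurable_pathLoss (κ : Link) : Measurable (p.pathLoss κ) := by
  unfold pathLoss
  fun_prop

/-- The Laplace transform of the power received from an interferer. -/
lemma lintegral_negExp_channelGain {s : ℝ} (hs : 0 ≤ s) (x : Plane) :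
    ∫⁻ z, negExp (ENNReal.ofReal s * ENNReal.ofReal (p.channelGain x z)) ∂p.markLaw
      = ENNReal.ofReal (1 - p.meanLoss s ‖x‖) := by
  set g : Link → Fin 4 → ℝ → ℝ≥0∞ := fun κ i y =>
    negExp (ENNReal.ofReal (s * (p.pathLoss κ ‖x‖ * p.gain i) * y)) with hg
  have hgm : ∀ κ i, Measurable (g κ i) := fun κ i =>
    measurable_negExp.comp (measurable_const.mul measurable_id).ennreal_ofReal
  have hfad : ∀ κ i, ∫⁻ y, g κ i y ∂p.fadingLaw κ
      = ENNReal.ofReal (1 - p.loss κ s (p.gain i) ‖x‖) := by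
    intro κ i
    have hN := p.N_cast_pos κ
    have hp := pathLoss_nonneg (p := p) κ ‖x‖
    have hG := gain_nonneg (p := p) i
    have hrel := relPower_nonneg (p := p) (κ := κ) hs hG ‖x‖
    rw [fadingLaw, lintegral_negExp_gammaMeasure hN hN (by positivity), loss, sub_sub_cancel,
      Real.rpow_natCast, ← inv_pow]
    congr 2
    -- With mean one, the rate of the Gamma law equals its shape `N`, so its transform at `N z` is
    -- `(1 + z)^{-N}`.
    have : s * (p.pathLoss κ ‖x‖ * p.gain i) = p.N κ * p.relPower κ s (p.gain i) ‖x‖ := by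
      rw [pathLoss_eq, relPower, mul_div_mul_comm]
      field_simp
    rw [this]
    field_simp
  have h := p.lintegral_markLaw x hgm
  have hl : ∀ z, negExp (ENNReal.ofReal s * ENNReal.ofReal (p.channelGain x z))
      = g (p.state x z) z.2.1 (z.fading (p.state x z)) := by
    intro z
    rw [← ENNReal.ofReal_mul hs, channelGain]
    simp only [hg]
    congr 2
    ring
  simp only [hl, h, hfad]
  have hnn : ∀ κ i, 0 ≤ 1 - p.loss κ s (p.gain i) ‖x‖ := fun κ i =>
    sub_nonneg.2 (loss_lt_one hs (gain_nonneg i) _).le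
  have hsum : ∀ κ, ∑ i, ENNReal.ofReal (p.gainProb i) * ENNReal.ofReal
      (1 - p.loss κ s (p.gain i) ‖x‖)
      = ENNReal.ofReal (∑ i, p.gainProb i * (1 - p.loss κ s (p.gain i) ‖x‖)) := by
    intro κ
    rw [ENNReal.ofReal_sum_of_nonneg fun i _ => mul_nonneg (gainProb_nonneg i) (hnn κ i)]
    exact Finset.sum_congr rfl fun i _ => (ENNReal.ofReal_mul (gainProb_nonneg i)).symm
  have hsnn : ∀ κ, 0 ≤ ∑ i, p.gainProb i * (1 - p.loss κ s (p.gain i) ‖x‖) := fun κ =>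
    Finset.sum_nonneg fun i _ => mul_nonneg (gainProb_nonneg i) (hnn κ i)
  rw [hsum, hsum, ← ENNReal.ofReal_mul (prob_nonneg _ _), ← ENNReal.ofReal_mul (prob_nonneg _ _),
    ← ENNReal.ofReal_add (mul_nonneg (prob_nonneg _ _) (hsnn _))
      (mul_nonneg (prob_nonneg _ _) (hsnn _))]
  congr 1
  have h1 := p.sum_gainProb
  have h2 := prob_add_prob (p := p) (p.level ‖x‖)
  simp only [meanLoss, Fin.sum_univ_four] at h1 ⊢
  have h3 : p.prob Link.NLOS (p.level ‖x‖) = 1 - p.prob Link.LOS (p.level ‖x‖) := by linarith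
  rw [h3]
  linear_combination h1

lemma measurable_channelGain (p : Params) :
    Measurable fun y : Plane × Mark => p.channelGain y.1 y.2 := by
  refine measurable_of_state (g := fun κ (y : Plane × Mark) => p.pathLoss κ ‖y.1‖ * p.gain y.2.2.1
    * y.2.fading κ) (f := id) (fun κ => ?_) measurable_id
  exact (((measurable_pathLoss κ).comp (measurable_norm.comp measurable_fst)).mul
    ((measurable_of_finite p.gain).comp
      (measurable_fst.comp (measurable_snd.comp measurable_snd)))).mul
    ((measurable_fading κ).comp measurable_snd)

end Params

/-! ### Independence: integrating out the marks of the network. -/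

section Network

variable {Ω : Type*} [MeasurableSpace Ω] {P : Measure Ω} {p : Params}
  {v : ℕ → Ω → Plane} {mark : ℕ → Ω → Mark}

lemma measurable_points (hnet : IsNetwork P p v mark) : Measurable fun ω n => v n ω :=
  measurable_pi_lambda _ hnet.ppp.measurable

lemma measurable_tail_marks (hnet : IsNetwork P p v mark) :
    Measurable fun ω n => mark (n + 1) ω :=
  measurable_pi_lambda _ fun n => hnet.mark_measurable (n + 1)

lemma indepFun_mark_zero_tail (hnet : IsNetwork P p v mark) :
    IndepFun (mark 0) (fun ω n => mark (n + 1) ω) P := by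
  have h := indep_iSup_of_disjoint (fun i => (hnet.mark_measurable i).comap_le)
    hnet.mark_indep.iIndep (S := {0}) (T := {0}ᶜ) (disjoint_compl_right)
  rw [IndepFun_iff_Indep]
  refine indep_of_indep_of_le_left (indep_of_indep_of_le_right h ?_) ?_
  · rw [MeasurableSpace.comap_process_pi]
    refine iSup_le fun n => ?_
    exact le_iSup₂_of_le (n + 1) (by simp) le_rfl
  · exact le_iSup₂_of_le 0 (by simp) le_rfl

lemma measurable_interference (hnet : IsNetwork P p v mark) :
    Measurable (p.interference v mark) :=
  Measurable.tsum fun n => (p.measurable_channelGain.comp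
    ((hnet.ppp.measurable (n + 1)).prodMk (hnet.mark_measurable (n + 1)))).ennreal_ofReal

lemma measurable_tail_interference (p : Params) :
    Measurable fun y : (ℕ → Plane) × (ℕ → Mark) =>
      ∑' n, ENNReal.ofReal (p.channelGain (y.1 (n + 1)) (y.2 n)) := by
  refine Measurable.tsum fun n => ?_
  have h1 : Measurable fun y : (ℕ → Plane) × (ℕ → Mark) => y.1 (n + 1) :=
    (measurable_pi_apply (n + 1)).comp measurable_fst
  have h2 : Measurable fun y : (ℕ → Plane) × (ℕ → Mark) => y.2 n :=
    (measurable_pi_apply n).comp measurable_snd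
  exact (p.measurable_channelGain.comp (h1.prodMk h2)).ennreal_ofReal

variable [IsProbabilityMeasure P]

/-- Independence turns an expectation into an iterated one. -/
lemma lintegral_indepFun {α β : Type*} [MeasurableSpace α] [MeasurableSpace β] {X : Ω → α}
    {Y : Ω → β} (hX : Measurable X) (hY : Measurable Y) (h : IndepFun X Y P)
    {Φ : α × β → ℝ≥0∞} (hΦ : Measurable Φ) :
    ∫⁻ ω, Φ (X ω, Y ω) ∂P = ∫⁻ ω, ∫⁻ ω', Φ (X ω, Y ω') ∂P ∂P := by
  have hmap := (indepFun_iff_map_prod_eq_prod_map_map hX.aemeasurable hY.aemeasurable).1 h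
  have : IsProbabilityMeasure (P.map Y) := Measure.isProbabilityMeasure_map hY.aemeasurable
  rw [← lintegral_map hΦ (hX.prodMk hY), hmap, lintegral_prod _ hΦ.aemeasurable,
    lintegral_map hΦ.lintegral_prod_right' hX]
  refine lintegral_congr fun ω => ?_
  have hm : Measurable fun y => Φ (X ω, y) := hΦ.comp measurable_prodMk_left
  rw [lintegral_map hm hY]

/-- The mark of the serving UAV can be integrated out first. -/
lemma lintegral_mark_zero (hnet : IsNetwork P p v mark)
    {Φ : (ℕ → Plane) × Mark × (ℕ → Mark) → ℝ≥0∞} (hΦ : Measurable Φ) :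
    ∫⁻ ω, Φ (fun n => v n ω, mark 0 ω, fun n => mark (n + 1) ω) ∂P
      = ∫⁻ ω, ∫⁻ z, Φ (fun n => v n ω, z, fun n => mark (n + 1) ω) ∂p.markLaw ∂P := by
  have := p.isProbabilityMeasure_markLaw
  have hX := measurable_points hnet
  have hT := measurable_tail_marks hnet
  have h0 := hnet.mark_measurable 0
  have hi1 : IndepFun (fun ω n => v n ω) (fun ω => (mark 0 ω, fun n => mark (n + 1) ω)) P :=
    hnet.indep.comp (φ := id) (ψ := fun m : ℕ → Mark => (m 0, fun n => m (n + 1)))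
      measurable_id ((measurable_pi_apply 0).prodMk
        (measurable_pi_lambda _ fun n => measurable_pi_apply (n + 1)))
  have hi2 : IndepFun (fun ω n => v n ω) (fun ω n => mark (n + 1) ω) P :=
    hnet.indep.comp (φ := id) (ψ := fun m : ℕ → Mark => fun n => m (n + 1))
      measurable_id (measurable_pi_lambda _ fun n => measurable_pi_apply (n + 1))
  have hΨ : Measurable fun y : (ℕ → Plane) × (ℕ → Mark) => ∫⁻ z, Φ (y.1, z, y.2) ∂p.markLaw := by
    have : Measurable fun y : ((ℕ → Plane) × (ℕ → Mark)) × Mark => Φ (y.1.1, y.2, y.1.2) := by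
      refine hΦ.comp ?_
      fun_prop
    exact this.lintegral_prod_right'
  -- Both sides become iterated integrals with the locations outside. Inside, the serving mark is
  -- independent of the other marks, and Tonelli's theorem exchanges the two.
  rw [lintegral_indepFun hX (h0.prodMk hT) hi1 hΦ]
  rw [lintegral_indepFun (Φ := fun y : (ℕ → Plane) × (ℕ → Mark) =>
    ∫⁻ z, Φ (y.1, z, y.2) ∂p.markLaw) hX hT hi2 hΨ]
  refine lintegral_congr fun ω => ?_
  have hm : Measurable fun y : Mark × (ℕ → Mark) => Φ (fun n => v n ω, y) :=
    hΦ.comp measurable_prodMk_left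
  rw [lintegral_indepFun (Φ := fun y : Mark × (ℕ → Mark) => Φ (fun n => v n ω, y)) h0 hT
    (indepFun_mark_zero_tail hnet) hm]
  have hm2 : Measurable fun z => ∫⁻ ω', Φ (fun n => v n ω, z, fun n => mark (n + 1) ω') ∂P := by
    have : Measurable fun y : Mark × Ω => Φ (fun n => v n ω, y.1, fun n => mark (n + 1) y.2) :=
      hm.comp (measurable_fst.prodMk (hT.comp measurable_snd))
    exact this.lintegral_prod_right'
  rw [← lintegral_map hm2 h0, hnet.mark_law 0]
  refine lintegral_lintegral_swap ?_
  exact (hm.comp (measurable_fst.prodMk (hT.comp measurable_snd))).aemeasurable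

/-- The Laplace transform of the interference when the locations are given. -/
lemma lintegral_negExp_tail (hnet : IsNetwork P p v mark) {s : ℝ} (hs : 0 ≤ s) (x : ℕ → Plane) :
    ∫⁻ ω, negExp (ENNReal.ofReal s * ∑' n, ENNReal.ofReal (p.channelGain (x n) (mark (n + 1) ω))) ∂P
      = negExp (∑' n, p.logLoss s ‖x n‖) := by
  set Y : ℕ → Mark → ℝ≥0∞ := fun n z =>
    negExp (ENNReal.ofReal s * ENNReal.ofReal (p.channelGain (x n) z)) with hY
  have hYm : ∀ n, Measurable (Y n) := fun n => measurable_negExp.comp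
    (((p.measurable_channelGain.comp measurable_prodMk_left).ennreal_ofReal).const_mul _)
  have hind : iIndepFun (fun n ω => Y n (mark (n + 1) ω)) P :=
    (hnet.mark_indep.precomp (add_left_injective 1)).comp (fun n => Y n) hYm
  -- Independence factorizes the partial products; the passage to all interferers needs no
  -- finiteness, since `negExp` is continuous up to `⊤`.
  have hfin : ∀ m, ∫⁻ ω, ∏ n ∈ Finset.range m, Y n (mark (n + 1) ω) ∂P
      = negExp (∑ n ∈ Finset.range m, p.logLoss s ‖x n‖) := by
    intro m
    rw [lintegral_prod_eq_prod_lintegral_of_indepFun _ _ hind fun n =>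
      (hYm n).comp (hnet.mark_measurable _), negExp_sum]
    refine Finset.prod_congr rfl fun n _ => ?_
    rw [Params.negExp_logLoss hs, ← Params.lintegral_negExp_channelGain hs, ← hnet.mark_law (n + 1),
      lintegral_map (hYm n) (hnet.mark_measurable _)]
  have hR : Tendsto (fun m => negExp (∑ n ∈ Finset.range m, p.logLoss s ‖x n‖)) atTop
      (𝓝 (negExp (∑' n, p.logLoss s ‖x n‖))) :=
    (continuous_negExp.tendsto _).comp (ENNReal.tendsto_nat_tsum _)
  have hL : Tendsto (fun m => ∫⁻ ω, ∏ n ∈ Finset.range m, Y n (mark (n + 1) ω) ∂P) atTop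
      (𝓝 (∫⁻ ω, negExp (ENNReal.ofReal s *
        ∑' n, ENNReal.ofReal (p.channelGain (x n) (mark (n + 1) ω))) ∂P)) := by
    refine tendsto_lintegral_of_dominated_convergence (fun _ => 1) ?_ ?_ (by simp) ?_
    · exact fun m => Finset.measurable_fun_prod _ fun n _ =>
        (hYm n).comp (hnet.mark_measurable _)
    · exact fun m => Eventually.of_forall fun ω =>
        Finset.prod_le_one (fun _ _ => zero_le) fun n _ => negExp_le_one _
    · refine Eventually.of_forall fun ω => ?_
      have hprod : ∀ m, ∏ n ∈ Finset.range m, Y n (mark (n + 1) ω)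
          = negExp (∑ n ∈ Finset.range m, ENNReal.ofReal s *
            ENNReal.ofReal (p.channelGain (x n) (mark (n + 1) ω))) := fun m => (negExp_sum _ _).symm
      simp only [hprod]
      rw [← ENNReal.tsum_mul_left]
      exact (continuous_negExp.tendsto _).comp (ENNReal.tendsto_nat_tsum _)
  simp only [hfin] at hL
  exact tendsto_nhds_unique hL hR

/-- The marks of the interferers can be integrated out. -/
lemma lintegral_interference_marks (hnet : IsNetwork P p v mark) {s : ℝ} (hs : 0 ≤ s)
    {ψ : Plane → ℝ≥0∞} (hψ : Measurable ψ) :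
    ∫⁻ ω, ψ (v 0 ω) * negExp (ENNReal.ofReal s * p.interference v mark ω) ∂P
      = ∫⁻ ω, ψ (v 0 ω) * negExp (∑' n, p.logLoss s ‖v (n + 1) ω‖) ∂P := by
  have hi2 : IndepFun (fun ω n => v n ω) (fun ω n => mark (n + 1) ω) P :=
    hnet.indep.comp (φ := id) (ψ := fun m : ℕ → Mark => fun n => m (n + 1))
      measurable_id (measurable_pi_lambda _ fun n => measurable_pi_apply (n + 1))
  have hm : Measurable fun y : (ℕ → Plane) × (ℕ → Mark) => ψ (y.1 0) * negExp (ENNReal.ofReal s *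
      ∑' n, ENNReal.ofReal (p.channelGain (y.1 (n + 1)) (y.2 n))) :=
    (hψ.comp ((measurable_pi_apply 0).comp measurable_fst)).mul
      (measurable_negExp.comp ((measurable_tail_interference p).const_mul _))
  refine (lintegral_indepFun (measurable_points hnet) (measurable_tail_marks hnet) hi2 hm).trans ?_
  refine lintegral_congr fun ω => ?_
  have hm' : Measurable fun ω' => negExp (ENNReal.ofReal s *
      ∑' n, ENNReal.ofReal (p.channelGain (v (n + 1) ω) (mark (n + 1) ω'))) :=
    measurable_negExp.comp (((measurable_tail_interference p).comp
      (measurable_prodMk_left (x := fun n => v n ω) |>.comp (measurable_tail_marks hnet))).const_mul _)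
  simp only
  rw [lintegral_const_mul _ hm', lintegral_negExp_tail hnet hs fun n => v (n + 1) ω]

/-- The indicator of a link state. -/
def stateInd (κ κ' : Link) : ℝ≥0∞ := ({κ} : Set Link).indicator 1 κ'

lemma measurable_stateInd (κ : Link) :
    Measurable fun y : Plane × Mark => stateInd κ (p.state y.1 y.2) :=
  Params.measurable_of_state (g := fun κ' _ => stateInd κ κ') (f := id)
    (fun _ => measurable_const) measurable_id

lemma stateInd_self (κ : Link) : stateInd κ κ = 1 := by simp [stateInd]

lemma stateInd_of_ne {κ κ' : Link} (h : κ' ≠ κ) : stateInd κ κ' = 0 := by simp [stateInd, h]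

lemma stateInd_le_one (κ κ' : Link) : stateInd κ κ' ≤ 1 := Set.indicator_le_self' (by simp) κ'

lemma lintegral_stateInd (κ : Link) (x : Plane) :
    ∫⁻ z, stateInd κ (p.state x z) ∂p.markLaw = ENNReal.ofReal (p.prob κ (p.level ‖x‖)) := by
  have := p.isProbabilityMeasure_fadingLaw Link.LOS
  have := p.isProbabilityMeasure_fadingLaw Link.NLOS
  have h := p.lintegral_markLaw x (g := fun κ' _ _ => stateInd κ κ') fun _ _ => measurable_const
  refine h.trans ?_
  have hs : ∑ i, ENNReal.ofReal (p.gainProb i) = 1 := by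
    rw [← ENNReal.ofReal_sum_of_nonneg fun i _ => Params.gainProb_nonneg i, Params.sum_gainProb,
      ENNReal.ofReal_one]
  simp only [lintegral_const, measure_univ, mul_one, ← Finset.sum_mul, hs, one_mul]
  cases κ
  · rw [stateInd_self, stateInd_of_ne (by simp), mul_one, mul_zero, add_zero]
  · rw [stateInd_self, stateInd_of_ne (by simp), mul_one, mul_zero, zero_add]

/-- The joint law of the nearest distance, of the state of the serving link, and of the
interference. -/
lemma lintegral_state_interference (hnet : IsNetwork P p v mark) {s : ℝ} (hs : 0 ≤ s) (κ : Link)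
    {φ : ℝ → ℝ≥0∞} (hφ : Measurable φ) :
    ∫⁻ ω, φ ‖v 0 ω‖ * stateInd κ (p.state (v 0 ω) (mark 0 ω))
        * negExp (ENNReal.ofReal s * p.interference v mark ω) ∂P
      = ∫⁻ r in Set.Ioi 0, φ r * ENNReal.ofReal (p.prob κ (p.level r))
        * ENNReal.ofReal (p.nearestPDF r * p.laplaceIntegral s r) := by
  have hm : Measurable fun y : (ℕ → Plane) × Mark × (ℕ → Mark) =>
      φ ‖y.1 0‖ * stateInd κ (p.state (y.1 0) y.2.1) * negExp (ENNReal.ofReal s *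
        ∑' n, ENNReal.ofReal (p.channelGain (y.1 (n + 1)) (y.2.2 n))) := by
    have h0 : Measurable fun y : (ℕ → Plane) × Mark × (ℕ → Mark) => y.1 0 :=
      (measurable_pi_apply 0).comp measurable_fst
    refine ((hφ.comp (measurable_norm.comp h0)).mul ((measurable_stateInd κ).comp
      (h0.prodMk (measurable_fst.comp measurable_snd)))).mul (measurable_negExp.comp
      (((measurable_tail_interference p).comp (measurable_fst.prodMk
        (measurable_snd.comp measurable_snd))).const_mul _))
  refine (lintegral_mark_zero hnet hm).trans ?_
  have hstep : ∀ ω, ∫⁻ z, φ ‖v 0 ω‖ * stateInd κ (p.state (v 0 ω) z)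
      * negExp (ENNReal.ofReal s *
        ∑' n, ENNReal.ofReal (p.channelGain (v (n + 1) ω) (mark (n + 1) ω))) ∂p.markLaw
      = φ ‖v 0 ω‖ * ENNReal.ofReal (p.prob κ (p.level ‖v 0 ω‖))
        * negExp (ENNReal.ofReal s * p.interference v mark ω) := by
    intro ω
    have hms : Measurable fun z => stateInd κ (p.state (v 0 ω) z) :=
      (measurable_stateInd (p := p) κ).comp measurable_prodMk_left
    rw [lintegral_mul_const _ (hms.const_mul _), lintegral_const_mul _ hms, lintegral_stateInd]
    rfl
  refine (lintegral_congr hstep).trans ?_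
  have hprob : Measurable fun r => ENNReal.ofReal (p.prob κ (p.level r)) :=
    (Params.measurable_prob_level κ).ennreal_ofReal
  rw [lintegral_interference_marks hnet hs
    (ψ := fun x => φ ‖x‖ * ENNReal.ofReal (p.prob κ (p.level ‖x‖)))
    ((hφ.mul hprob).comp measurable_norm)]
  exact Params.lintegral_nearest hnet.ppp hnet.ranked hs (hφ.mul hprob)

end Network

/-! ### Finite interference, and transform variables that depend on the distance. -/

lemma tendsto_lintegral_laplaceIntegral {p : Params} {w : ℝ → ℝ≥0∞} (hw1 : ∀ r, w r ≤ 1)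
    {σ : ℕ → ℝ → ℝ} {τ : ℝ → ℝ} (hσ0 : ∀ k r, 0 ≤ σ k r) (hτ0 : ∀ r, 0 ≤ τ r)
    (hσ : ∀ r, Tendsto (fun k => σ k r) atTop (𝓝 (τ r)))
    (hm : ∀ k, AEMeasurable (fun r => w r * ENNReal.ofReal
      (p.nearestPDF r * p.laplaceIntegral (σ k r) r)) (volume.restrict (Set.Ioi 0))) :
    Tendsto (fun k => ∫⁻ r in Set.Ioi 0,
        w r * ENNReal.ofReal (p.nearestPDF r * p.laplaceIntegral (σ k r) r)) atTop
      (𝓝 (∫⁻ r in Set.Ioi 0,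
        w r * ENNReal.ofReal (p.nearestPDF r * p.laplaceIntegral (τ r) r))) := by
  refine tendsto_lintegral_of_dominated_convergence'
    (fun r => ENNReal.ofReal (p.nearestPDF r)) hm ?_ ?_ ?_
  · intro k
    filter_upwards [ae_restrict_mem measurableSet_Ioi] with r hr
    refine (mul_le_of_le_one_left zero_le (hw1 r)).trans (ENNReal.ofReal_le_ofReal ?_)
    exact mul_le_of_le_one_right (Params.nearestPDF_nonneg (le_of_lt hr))
      (Params.laplaceIntegral_le_one (hσ0 k r) (le_of_lt hr))
  · have h := p.integrableOn_nearestPDF.lintegral_lt_top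
    exact h.ne
  · filter_upwards [ae_restrict_mem measurableSet_Ioi] with r hr
    refine ENNReal.Tendsto.const_mul (ENNReal.tendsto_ofReal (Tendsto.const_mul _ ?_))
      (Or.inr ((hw1 r).trans_lt ENNReal.one_lt_top).ne)
    exact Params.tendsto_laplaceIntegral (hσ r) tendsto_const_nhds
      (Eventually.of_forall fun k => hσ0 k r) (Eventually.of_forall fun _ => le_of_lt hr)
      (hτ0 r) (le_of_lt hr)

lemma aemeasurable_laplaceIntegral {p : Params} {s : ℝ} (hs : 0 ≤ s) :
    AEMeasurable (fun r => ENNReal.ofReal (p.nearestPDF r * p.laplaceIntegral s r))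
      (volume.restrict (Set.Ioi 0)) :=
  (p.continuous_nearestPDF.measurable.aemeasurable.mul
    (((Params.continuousOn_laplaceIntegral_right hs).mono Set.Ioi_subset_Ici_self).aemeasurable
      measurableSet_Ioi)).ennreal_ofReal

section Network

variable {Ω : Type*} [MeasurableSpace Ω] {P : Measure Ω} [IsProbabilityMeasure P] {p : Params}
  {v : ℕ → Ω → Plane} {mark : ℕ → Ω → Mark}

/-- As `s` decreases to `0`, `e^{-s I}` tends to the indicator of `I < ∞`. By continuity of the
closed form at `s = 0`, the expectations tend to their value at `s = 0`, which is one. -/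
theorem ae_interference_lt_top (hnet : IsNetwork P p v mark) :
    ∀ᵐ ω ∂P, p.interference v mark ω < ∞ := by
  have hI := measurable_interference hnet
  set S : Set Ω := {ω | p.interference v mark ω < ∞} with hS
  have hSm : MeasurableSet S := hI measurableSet_Iio
  have hk : ∀ s : ℝ, 0 ≤ s → ∫⁻ ω, negExp (ENNReal.ofReal s * p.interference v mark ω) ∂P
      = ∫⁻ r in Set.Ioi 0, 1 * ENNReal.ofReal (p.nearestPDF r * p.laplaceIntegral s r) := by
    intro s hs
    have h := lintegral_interference_marks hnet hs (ψ := fun _ => 1) measurable_const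
    have h2 := Params.lintegral_nearest hnet.ppp hnet.ranked hs (φ := fun _ => 1) measurable_const
    simp only [one_mul] at h h2 ⊢
    exact h.trans h2
  have hpos : ∀ k : ℕ, (0 : ℝ) ≤ 1 / (k + 1 : ℝ) := fun k => by positivity
  have hR : Tendsto (fun k : ℕ => ∫⁻ r in Set.Ioi 0,
      1 * ENNReal.ofReal (p.nearestPDF r * p.laplaceIntegral (1 / (k + 1 : ℝ)) r)) atTop
      (𝓝 (∫⁻ r in Set.Ioi 0, 1 * ENNReal.ofReal (p.nearestPDF r * p.laplaceIntegral 0 r))) :=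
    tendsto_lintegral_laplaceIntegral (w := fun _ => 1) (σ := fun k _ => 1 / (k + 1 : ℝ))
      (τ := fun _ => 0) (fun _ => le_rfl) (fun k _ => hpos k) (fun _ => le_rfl)
      (fun _ => tendsto_one_div_add_atTop_nhds_zero_nat)
      fun k => (aemeasurable_laplaceIntegral (hpos k)).const_mul 1
  have hL : Tendsto (fun k : ℕ => ∫⁻ ω,
      negExp (ENNReal.ofReal (1 / (k + 1 : ℝ)) * p.interference v mark ω) ∂P) atTop
      (𝓝 (∫⁻ ω, S.indicator 1 ω ∂P)) := by
    refine tendsto_lintegral_of_dominated_convergence (fun _ => 1)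
      (fun k => measurable_negExp.comp (hI.const_mul _))
      (fun k => Eventually.of_forall fun ω => negExp_le_one _) (by simp)
      (Eventually.of_forall fun ω => ?_)
    by_cases hω : ω ∈ S
    · have h0 : Tendsto (fun k : ℕ => ENNReal.ofReal (1 / (k + 1 : ℝ)) *
          p.interference v mark ω) atTop (𝓝 0) := by
        have h1 : Tendsto (fun k : ℕ => ENNReal.ofReal (1 / (k + 1 : ℝ))) atTop (𝓝 0) := by
          rw [← ENNReal.ofReal_zero]
          exact ENNReal.tendsto_ofReal tendsto_one_div_add_atTop_nhds_zero_nat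
        have h2 := ENNReal.Tendsto.mul_const (b := p.interference v mark ω) h1 (Or.inr (ne_of_lt hω))
        rwa [zero_mul] at h2
      rw [Set.indicator_of_mem hω, Pi.one_apply, ← negExp_zero]
      exact (continuous_negExp.tendsto _).comp h0
    · have htop : p.interference v mark ω = ∞ := not_lt_top_iff.1 hω
      rw [Set.indicator_of_notMem hω]
      refine tendsto_const_nhds.congr fun k => ?_
      have : (0 : ℝ) < 1 / (k + 1 : ℝ) := by positivity
      rw [htop, ENNReal.mul_top (by simpa using this), negExp_top]
  simp only [fun k : ℕ => hk _ (hpos k)] at hL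
  have h1 : ∫⁻ r in Set.Ioi 0, 1 * ENNReal.ofReal (p.nearestPDF r * p.laplaceIntegral 0 r) = 1 := by
    rw [← hk 0 le_rfl]
    simp [negExp_zero]
  have h2 := tendsto_nhds_unique hL hR
  rw [h1, lintegral_indicator_one hSm] at h2
  exact (prob_compl_eq_zero_iff hSm).2 h2

/-- The joint law of the nearest distance, of the state of the serving link, and of the
interference, with a transform variable that depends on the distance. -/
theorem lintegral_state_interference_var (hnet : IsNetwork P p v mark) (κ : Link)
    {φ : ℝ → ℝ≥0∞} (hφ : Measurable φ) (hφ1 : ∀ r, φ r ≤ 1) {τ : ℝ → ℝ} (hτ : Measurable τ)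
    (hτ0 : ∀ r, 0 ≤ τ r) :
    ∫⁻ ω, φ ‖v 0 ω‖ * stateInd κ (p.state (v 0 ω) (mark 0 ω))
        * negExp (ENNReal.ofReal (τ ‖v 0 ω‖) * p.interference v mark ω) ∂P
      = ∫⁻ r in Set.Ioi 0, φ r * ENNReal.ofReal (p.prob κ (p.level r))
        * ENNReal.ofReal (p.nearestPDF r * p.laplaceIntegral (τ r) r) := by
  have hI := measurable_interference hnet
  have hprob : Measurable fun r => ENNReal.ofReal (p.prob κ (p.level r)) :=
    (Params.measurable_prob_level κ).ennreal_ofReal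
  have hr0 : Measurable fun ω => ‖v 0 ω‖ := (hnet.ppp.measurable 0).norm
  have hst : Measurable fun ω => stateInd κ (p.state (v 0 ω) (mark 0 ω)) :=
    (measurable_stateInd κ).comp ((hnet.ppp.measurable 0).prodMk (hnet.mark_measurable 0))
  -- The identity is known for constant transform variables. `σ k` takes countably many values, so
  -- it can be applied on each level set and summed; then `σ k → τ`, and both sides converge by
  -- domination.
  set σ : ℕ → ℝ → ℝ := fun k r => (⌊τ r * k⌋₊ : ℝ) / k with hσ
  have hσ0 : ∀ k r, 0 ≤ σ k r := fun k r => by positivity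
  have hσm : ∀ k, Measurable (σ k) := fun k => by
    have h : Measurable fun r => ⌊τ r * k⌋₊ := Nat.measurable_floor.comp (hτ.mul_const _)
    exact ((measurable_from_nat (f := fun j : ℕ => (j : ℝ))).comp h).div_const _
  have hσt : ∀ r, Tendsto (fun k => σ k r) atTop (𝓝 (τ r)) := fun r =>
    (tendsto_nat_floor_mul_div_atTop (hτ0 r)).comp tendsto_natCast_atTop_atTop
  set A : ℕ → ℕ → Set ℝ := fun k j => {r | ⌊τ r * k⌋₊ = j} with hA
  have hAm : ∀ k j, MeasurableSet (A k j) := fun k j =>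
    (Nat.measurable_floor.comp (hτ.mul_const _)) (measurableSet_singleton j)
  have hdec : ∀ (k : ℕ) (r : ℝ) (f : ℕ → ℝ≥0∞),
      f ⌊τ r * k⌋₊ = ∑' j, (A k j).indicator (fun _ => f j) r := by
    intro k r f
    rw [tsum_eq_single ⌊τ r * k⌋₊]
    · rw [Set.indicator_of_mem (show r ∈ A k ⌊τ r * k⌋₊ from rfl)]
    · intro j hj
      exact Set.indicator_of_notMem (fun h : ⌊τ r * k⌋₊ = j => hj h.symm) _
  have hRdec : ∀ k r, φ r * ENNReal.ofReal (p.prob κ (p.level r))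
        * ENNReal.ofReal (p.nearestPDF r * p.laplaceIntegral (σ k r) r)
      = ∑' j : ℕ, (A k j).indicator φ r * ENNReal.ofReal (p.prob κ (p.level r))
        * ENNReal.ofReal (p.nearestPDF r * p.laplaceIntegral (j / k) r) := by
    intro k r
    rw [hσ, hdec k r fun j => φ r * ENNReal.ofReal (p.prob κ (p.level r))
        * ENNReal.ofReal (p.nearestPDF r * p.laplaceIntegral (j / k) r)]
    refine tsum_congr fun j => ?_
    by_cases h : r ∈ A k j <;> simp [h]
  have hRm : ∀ k j : ℕ, AEMeasurable (fun r => (A k j).indicator φ r *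
      ENNReal.ofReal (p.prob κ (p.level r))
        * ENNReal.ofReal (p.nearestPDF r * p.laplaceIntegral (j / k) r))
      (volume.restrict (Set.Ioi 0)) := fun k j =>
    ((hφ.indicator (hAm k j)).mul hprob).aemeasurable.mul
      (aemeasurable_laplaceIntegral (by positivity))
  have hstep : ∀ k, ∫⁻ ω, φ ‖v 0 ω‖ * stateInd κ (p.state (v 0 ω) (mark 0 ω))
        * negExp (ENNReal.ofReal (σ k ‖v 0 ω‖) * p.interference v mark ω) ∂P
      = ∫⁻ r in Set.Ioi 0, φ r * ENNReal.ofReal (p.prob κ (p.level r))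
        * ENNReal.ofReal (p.nearestPDF r * p.laplaceIntegral (σ k r) r) := by
    intro k
    have hLdec : ∀ ω, φ ‖v 0 ω‖ * stateInd κ (p.state (v 0 ω) (mark 0 ω))
        * negExp (ENNReal.ofReal (σ k ‖v 0 ω‖) * p.interference v mark ω)
        = ∑' j : ℕ, (A k j).indicator φ ‖v 0 ω‖ * stateInd κ (p.state (v 0 ω) (mark 0 ω))
        * negExp (ENNReal.ofReal (j / k) * p.interference v mark ω) := by
      intro ω
      rw [hσ, hdec k ‖v 0 ω‖ fun j => φ ‖v 0 ω‖ * stateInd κ (p.state (v 0 ω) (mark 0 ω))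
        * negExp (ENNReal.ofReal (j / k) * p.interference v mark ω)]
      refine tsum_congr fun j => ?_
      by_cases h : ‖v 0 ω‖ ∈ A k j <;> simp [h]
    simp only [hLdec, hRdec]
    rw [lintegral_tsum fun j => ?_, lintegral_tsum (hRm k)]
    · refine tsum_congr fun j => ?_
      exact lintegral_state_interference hnet (by positivity) κ (hφ.indicator (hAm k j))
    · exact ((((hφ.indicator (hAm k j)).comp hr0).mul hst).mul
        (measurable_negExp.comp (hI.const_mul _))).aemeasurable
  have hR := tendsto_lintegral_laplaceIntegral (p := p)
    (w := fun r => φ r * ENNReal.ofReal (p.prob κ (p.level r))) (σ := σ) (τ := τ)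
    (fun r => mul_le_one' (hφ1 r) (ENNReal.ofReal_le_one.2 (Params.prob_le_one _ _))) hσ0 hτ0 hσt
    (fun k => by simp only [hRdec]; exact AEMeasurable.tsum (hRm k))
  have hL : Tendsto (fun k => ∫⁻ ω, φ ‖v 0 ω‖ * stateInd κ (p.state (v 0 ω) (mark 0 ω))
        * negExp (ENNReal.ofReal (σ k ‖v 0 ω‖) * p.interference v mark ω) ∂P) atTop
      (𝓝 (∫⁻ ω, φ ‖v 0 ω‖ * stateInd κ (p.state (v 0 ω) (mark 0 ω))
        * negExp (ENNReal.ofReal (τ ‖v 0 ω‖) * p.interference v mark ω) ∂P)) := by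
    refine tendsto_lintegral_of_dominated_convergence (fun _ => 1) ?_ ?_ (by simp) ?_
    · exact fun k => ((hφ.comp hr0).mul hst).mul
        (measurable_negExp.comp (((hσm k).comp hr0).ennreal_ofReal.mul hI))
    · exact fun k => Eventually.of_forall fun ω =>
        mul_le_one' (mul_le_one' (hφ1 _) (stateInd_le_one _ _)) (negExp_le_one _)
    · filter_upwards [ae_interference_lt_top hnet] with ω hω
      refine ENNReal.Tendsto.const_mul ((continuous_negExp.tendsto _).comp
        (ENNReal.Tendsto.mul_const (ENNReal.tendsto_ofReal (hσt _)) (Or.inr hω.ne)))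
        (Or.inr ((mul_le_one' (hφ1 _) (stateInd_le_one _ _)).trans_lt ENNReal.one_lt_top).ne)
  simp only [hstep] at hL
  exact tendsto_nhds_unique hL hR

end Network

/-! ### The mean of Alzer's tail as an integral over the nearest distance. -/

lemma one_sub_one_sub_pow (y : ℝ) (N : ℕ) :
    1 - (1 - y) ^ N = ∑ n ∈ Finset.Icc 1 N, (-1 : ℝ) ^ (n + 1) * N.choose n * y ^ n := by
  have h : (1 - y) ^ N = ∑ n ∈ Finset.range (N + 1), (-1 : ℝ) ^ n * N.choose n * y ^ n := by
    rw [sub_eq_neg_add, add_pow]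
    refine Finset.sum_congr rfl fun n _ => ?_
    rw [one_pow, neg_pow]
    ring
  have hI : Finset.Icc 1 N = Finset.Ico 1 (N + 1) := by ext; simp
  rw [h, Finset.range_eq_Ico, Finset.sum_eq_sum_Ico_succ_bot (Nat.succ_pos N), hI]
  simp only [pow_zero, Nat.choose_zero_right, Nat.cast_one, mul_one, zero_add, sub_add_cancel_left,
    ← Finset.sum_neg_distrib]
  refine Finset.sum_congr rfl fun n _ => ?_
  ring

section Network

variable {Ω : Type*} {p : Params} {v : ℕ → Ω → Plane} {mark : ℕ → Ω → Mark}

/-- The required fading gain is affine in the interference. Its exponential therefore splits into a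
noise factor, which depends only on distance and state, and a Laplace integrand with transform
variable `laplaceArg`. -/
lemma nat_mul_required (n : ℕ) (Υ : ℝ) (ω : Ω) :
    n * (p.η (p.state (v 0 ω) (mark 0 ω)) * p.required v mark Υ ω)
      = p.noiseArg (p.state (v 0 ω) (mark 0 ω)) Υ n ‖v 0 ω‖
        + p.laplaceArg (p.state (v 0 ω) (mark 0 ω)) Υ n ‖v 0 ω‖
          * (p.interference v mark ω).toReal := by
  rw [Params.required, Params.pathLoss_eq, Params.noiseArg, Params.laplaceArg,
    Real.rpow_neg (by positivity)]
  simp only [div_eq_mul_inv, mul_inv, inv_inv]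
  ring

/-- A term of Alzer's tail, expanded by the binomial theorem and sorted by the state of the
serving link. -/
def alzerTerm (p : Params) (v : ℕ → Ω → Plane) (mark : ℕ → Ω → Mark) (κ : Link) (Υ : ℝ) (n : ℕ)
    (ω : Ω) : ℝ≥0∞ :=
  ENNReal.ofReal (Real.exp (-p.noiseArg κ Υ n ‖v 0 ω‖)) * stateInd κ (p.state (v 0 ω) (mark 0 ω))
    * negExp (ENNReal.ofReal (p.laplaceArg κ Υ n ‖v 0 ω‖) * p.interference v mark ω)

lemma alzerTerm_le_one (κ : Link) {Υ : ℝ} (hΥ : 0 < Υ) (n : ℕ) (ω : Ω) :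
    alzerTerm p v mark κ Υ n ω ≤ 1 := by
  refine mul_le_one' (mul_le_one' ?_ (stateInd_le_one _ _)) (negExp_le_one _)
  rw [ENNReal.ofReal_le_one, Real.exp_le_one_iff, neg_nonpos]
  exact Params.noiseArg_nonneg κ hΥ n _

lemma toReal_alzerTerm_state {Υ : ℝ} (hΥ : 0 < Υ) (n : ℕ) {ω : Ω}
    (hω : p.interference v mark ω < ∞) :
    (alzerTerm p v mark (p.state (v 0 ω) (mark 0 ω)) Υ n ω).toReal
      = Real.exp (-(p.η (p.state (v 0 ω) (mark 0 ω)) * p.required v mark Υ ω)) ^ n := by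
  have h0 := Params.laplaceArg_nonneg (p := p) (p.state (v 0 ω) (mark 0 ω)) hΥ n ‖v 0 ω‖
  rw [← Real.exp_nat_mul, mul_neg, nat_mul_required, neg_add, Real.exp_add, alzerTerm, stateInd_self,
    mul_one, ENNReal.toReal_mul, ENNReal.toReal_ofReal (Real.exp_pos _).le]
  conv_lhs => rw [← ENNReal.ofReal_toReal hω.ne]
  rw [← ENNReal.ofReal_mul h0, negExp_ofReal (mul_nonneg h0 ENNReal.toReal_nonneg),
    ENNReal.toReal_ofReal (Real.exp_pos _).le]

/-- The binomial expansion for the actual state; the indicator in `alzerTerm` annihilates the sum of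
the other state. Finiteness matters because `required` uses the real value of the interference,
which would be `0` at `⊤`. -/
lemma alzerTail_eq {Υ : ℝ} (hΥ : 0 < Υ) {ω : Ω} (hω : p.interference v mark ω < ∞) :
    p.alzerTail v mark Υ ω
      = ∑ n ∈ Finset.Icc 1 (p.N Link.LOS), (-1 : ℝ) ^ (n + 1) * (p.N Link.LOS).choose n
          * (alzerTerm p v mark Link.LOS Υ n ω).toReal
        + ∑ n ∈ Finset.Icc 1 (p.N Link.NLOS), (-1 : ℝ) ^ (n + 1) * (p.N Link.NLOS).choose n
          * (alzerTerm p v mark Link.NLOS Υ n ω).toReal := by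
  have h := fun n => toReal_alzerTerm_state (p := p) (v := v) (mark := mark) hΥ n hω
  have h0 : ∀ κ, p.state (v 0 ω) (mark 0 ω) ≠ κ → ∀ n,
      (alzerTerm p v mark κ Υ n ω).toReal = 0 := fun κ hκ n => by
    rw [alzerTerm, stateInd_of_ne hκ]; simp
  rw [Params.alzerTail, Params.alzer, one_sub_one_sub_pow]
  simp only [← h]
  cases hκ : p.state (v 0 ω) (mark 0 ω)
  · rw [left_eq_add]
    exact Finset.sum_eq_zero fun n _ => by rw [h0 _ (by rw [hκ]; simp), mul_zero]
  · rw [right_eq_add]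
    exact Finset.sum_eq_zero fun n _ => by rw [h0 _ (by rw [hκ]; simp), mul_zero]

lemma measurable_noiseArg (p : Params) (κ : Link) (Υ : ℝ) (n : ℕ) :
    Measurable (p.noiseArg κ Υ n) := by
  unfold Params.noiseArg
  fun_prop

lemma measurable_laplaceArg (p : Params) (κ : Link) (Υ : ℝ) (n : ℕ) :
    Measurable (p.laplaceArg κ Υ n) := by
  unfold Params.laplaceArg
  fun_prop

lemma integrableOn_prob_mul_coverTerm (κ : Link) {Υ : ℝ} (hΥ : 0 < Υ) (n : ℕ) :
    IntegrableOn (fun r => p.prob κ (p.level r) * p.coverTerm κ Υ n r) (Set.Ioi 0) := by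
  refine Integrable.mono' p.integrableOn_nearestPDF ?_ ?_
  · exact (Params.measurable_prob_level κ).aestronglyMeasurable.mul
      (ContinuousOn.aestronglyMeasurable (fun r hr =>
        (Params.continuousAt_coverTerm κ hΥ n hr).continuousWithinAt) measurableSet_Ioi)
  · filter_upwards [ae_restrict_mem measurableSet_Ioi] with r hr
    have h := Params.coverTerm_nonneg (p := p) κ Υ n (le_of_lt hr)
    rw [Real.norm_of_nonneg (mul_nonneg (Params.prob_nonneg _ _) h)]
    exact (mul_le_of_le_one_left h (Params.prob_le_one _ _)).trans
      (Params.coverTerm_le κ hΥ n (le_of_lt hr))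

variable [MeasurableSpace Ω] {P : Measure Ω}

lemma measurable_alzerTerm (hnet : IsNetwork P p v mark) (κ : Link) (Υ : ℝ) (n : ℕ) :
    Measurable (alzerTerm p v mark κ Υ n) := by
  have hr0 : Measurable fun ω => ‖v 0 ω‖ := (hnet.ppp.measurable 0).norm
  have hst : Measurable fun ω => stateInd κ (p.state (v 0 ω) (mark 0 ω)) :=
    (measurable_stateInd κ).comp ((hnet.ppp.measurable 0).prodMk (hnet.mark_measurable 0))
  have h1 : Measurable fun ω => p.noiseArg κ Υ n ‖v 0 ω‖ := (measurable_noiseArg p κ Υ n).comp hr0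
  have h2 : Measurable fun ω => p.laplaceArg κ Υ n ‖v 0 ω‖ :=
    (measurable_laplaceArg p κ Υ n).comp hr0
  exact (h1.neg.exp.ennreal_ofReal.mul hst).mul
    (measurable_negExp.comp (h2.ennreal_ofReal.mul (measurable_interference hnet)))

variable [IsProbabilityMeasure P]

lemma integrable_alzerTerm (hnet : IsNetwork P p v mark) (κ : Link) {Υ : ℝ} (hΥ : 0 < Υ) (n : ℕ) :
    Integrable (fun ω => (alzerTerm p v mark κ Υ n ω).toReal) P := by
  refine integrable_toReal_of_lintegral_ne_top (measurable_alzerTerm hnet κ Υ n).aemeasurable ?_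
  refine ((lintegral_mono fun ω => alzerTerm_le_one κ hΥ n ω).trans_lt ?_).ne
  simp

/-- The joint law is applied with the noise factor as test function and `laplaceArg` as transform
variable. -/
lemma integral_alzerTerm (hnet : IsNetwork P p v mark) (κ : Link) {Υ : ℝ} (hΥ : 0 < Υ) (n : ℕ) :
    ∫ ω, (alzerTerm p v mark κ Υ n ω).toReal ∂P
      = ∫ r in Set.Ioi 0, p.prob κ (p.level r) * p.coverTerm κ Υ n r := by
  rw [integral_toReal (measurable_alzerTerm hnet κ Υ n).aemeasurable
    (Eventually.of_forall fun ω => (alzerTerm_le_one κ hΥ n ω).trans_lt ENNReal.one_lt_top)]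
  have h := lintegral_state_interference_var hnet κ
    (φ := fun r => ENNReal.ofReal (Real.exp (-p.noiseArg κ Υ n r))) (τ := p.laplaceArg κ Υ n)
    (measurable_noiseArg p κ Υ n).neg.exp.ennreal_ofReal
    (fun r => by
      rw [ENNReal.ofReal_le_one, Real.exp_le_one_iff, neg_nonpos]
      exact Params.noiseArg_nonneg κ hΥ n _)
    (measurable_laplaceArg p κ Υ n) fun r => Params.laplaceArg_nonneg κ hΥ n r
  unfold alzerTerm
  rw [h, integral_eq_lintegral_of_nonneg_ae _
    (integrableOn_prob_mul_coverTerm κ hΥ n).aestronglyMeasurable]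
  · congr 1
    refine setLIntegral_congr_fun measurableSet_Ioi fun r hr => ?_
    have hr0 : 0 ≤ r := le_of_lt hr
    rw [← ENNReal.ofReal_mul (Real.exp_pos _).le, ← ENNReal.ofReal_mul
      (mul_nonneg (Real.exp_pos _).le (Params.prob_nonneg _ _)), Params.coverTerm]
    congr 1
    ring
  · filter_upwards [ae_restrict_mem measurableSet_Ioi] with r hr
    exact mul_nonneg (Params.prob_nonneg _ _) (Params.coverTerm_nonneg κ Υ n (le_of_lt hr))

lemma ae_alzerTail_eq (hnet : IsNetwork P p v mark) {Υ : ℝ} (hΥ : 0 < Υ) :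
    (fun ω => ∑ n ∈ Finset.Icc 1 (p.N Link.LOS), (-1 : ℝ) ^ (n + 1) * (p.N Link.LOS).choose n
          * (alzerTerm p v mark Link.LOS Υ n ω).toReal
        + ∑ n ∈ Finset.Icc 1 (p.N Link.NLOS), (-1 : ℝ) ^ (n + 1) * (p.N Link.NLOS).choose n
          * (alzerTerm p v mark Link.NLOS Υ n ω).toReal) =ᵐ[P] p.alzerTail v mark Υ := by
  filter_upwards [ae_interference_lt_top hnet] with ω hω using (alzerTail_eq hΥ hω).symm

lemma integrable_sum_alzerTerm (hnet : IsNetwork P p v mark) (κ : Link) {Υ : ℝ} (hΥ : 0 < Υ) :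
    Integrable (fun ω => ∑ n ∈ Finset.Icc 1 (p.N κ), (-1 : ℝ) ^ (n + 1) * (p.N κ).choose n
          * (alzerTerm p v mark κ Υ n ω).toReal) P :=
  integrable_finsetSum _ fun n _ => (integrable_alzerTerm hnet κ hΥ n).const_mul _

theorem integrable_alzerTail (hnet : IsNetwork P p v mark) {Υ : ℝ} (hΥ : 0 < Υ) :
    Integrable (p.alzerTail v mark Υ) P :=
  ((integrable_sum_alzerTerm hnet _ hΥ).add (integrable_sum_alzerTerm hnet _ hΥ)).congr
    (ae_alzerTail_eq hnet hΥ)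

lemma integral_sum_alzerTerm (hnet : IsNetwork P p v mark) (κ : Link) {Υ : ℝ} (hΥ : 0 < Υ) :
    ∫ ω, ∑ n ∈ Finset.Icc 1 (p.N κ), (-1 : ℝ) ^ (n + 1) * (p.N κ).choose n
          * (alzerTerm p v mark κ Υ n ω).toReal ∂P
      = ∫ r in Set.Ioi 0, p.prob κ (p.level r) * p.Ψ κ r Υ := by
  rw [integral_finsetSum _ fun n _ => (integrable_alzerTerm hnet κ hΥ n).const_mul _]
  have h : ∫ r in Set.Ioi 0, p.prob κ (p.level r) * p.Ψ κ r Υ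
      = ∫ r in Set.Ioi 0, ∑ n ∈ Finset.Icc 1 (p.N κ), (-1 : ℝ) ^ (n + 1) * (p.N κ).choose n
        * (p.prob κ (p.level r) * p.coverTerm κ Υ n r) := by
    refine setIntegral_congr_fun measurableSet_Ioi fun r hr => ?_
    rw [Params.Ψ_eq κ hΥ hr, Finset.mul_sum]
    exact Finset.sum_congr rfl fun n _ => by ring
  rw [h, integral_finsetSum _ fun n _ => (integrableOn_prob_mul_coverTerm κ hΥ n).const_mul _]
  refine Finset.sum_congr rfl fun n _ => ?_
  rw [integral_const_mul, integral_const_mul, integral_alzerTerm hnet κ hΥ n]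

lemma integrableOn_prob_mul_Ψ (κ : Link) {Υ : ℝ} (hΥ : 0 < Υ) :
    IntegrableOn (fun r => p.prob κ (p.level r) * p.Ψ κ r Υ) (Set.Ioi 0) := by
  have h : IntegrableOn (fun r => ∑ n ∈ Finset.Icc 1 (p.N κ), (-1 : ℝ) ^ (n + 1)
      * (p.N κ).choose n * (p.prob κ (p.level r) * p.coverTerm κ Υ n r)) (Set.Ioi 0) :=
    integrable_finsetSum _ fun n _ => (integrableOn_prob_mul_coverTerm κ hΥ n).const_mul _
  refine h.congr_fun (fun r hr => ?_) measurableSet_Ioi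
  simp only
  rw [Params.Ψ_eq κ hΥ hr, Finset.mul_sum]
  exact Finset.sum_congr rfl fun n _ => by ring

/-- The meeting point of probability and quadrature: the integral on the right is also the limit in
`tendsto_quadrature`. -/
theorem alzerCoverage_eq (hnet : IsNetwork P p v mark) {Υ : ℝ} (hΥ : 0 < Υ) :
    p.alzerCoverage v mark P Υ = ∫ r in Set.Ioi 0, p.coverDensity Υ r := by
  rw [Params.alzerCoverage, ← integral_congr_ae (ae_alzerTail_eq hnet hΥ),
    integral_add (integrable_sum_alzerTerm hnet _ hΥ) (integrable_sum_alzerTerm hnet _ hΥ),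
    integral_sum_alzerTerm hnet _ hΥ, integral_sum_alzerTerm hnet _ hΥ]
  unfold Params.coverDensity
  rw [integral_add (integrableOn_prob_mul_Ψ _ hΥ) (integrableOn_prob_mul_Ψ _ hΥ)]

end Network

/-! ### Alzer's inequality. -/

lemma integral_exp_neg_mul_unit {t : ℝ} (ht : 0 < t) :
    ∫ s in Set.Icc (0 : ℝ) 1, Real.exp (-(t * s)) = (1 - Real.exp (-t)) / t := by
  rw [integral_Icc_eq_integral_Ioc, ← intervalIntegral.integral_of_le zero_le_one]
  have h := intervalIntegral.integral_comp_mul_left (a := 0) (b := 1) Real.exp (neg_ne_zero.2 ht.ne')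
  simp only [neg_mul, mul_zero, mul_one, integral_exp, Real.exp_zero, smul_eq_mul] at h
  rw [h]
  field_simp
  ring

/-- Monotonicity of the `L^t` norm of `s ↦ e^{-s}` on the unit interval, in `t`. -/
lemma rpow_le_one_sub_exp_div {t u : ℝ} (ht : 0 < t) (htu : t ≤ u) :
    ((1 - Real.exp (-t)) / t) ^ (u / t) ≤ (1 - Real.exp (-u)) / u := by
  have hu := ht.trans_le htu
  have hp : IsProbabilityMeasure (volume.restrict (Set.Icc (0 : ℝ) 1)) := ⟨by simp⟩
  have hint : ∀ c : ℝ, IntegrableOn (fun s : ℝ => Real.exp (-(c * s))) (Set.Icc 0 1) := fun c =>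
    (by fun_prop : Continuous fun s : ℝ => Real.exp (-(c * s))).integrableOn_Icc
  have hpow : ∀ s : ℝ, Real.exp (-(t * s)) ^ (u / t) = Real.exp (-(u * s)) := fun s => by
    rw [← Real.exp_mul]
    congr 1
    field_simp
  -- Jensen's inequality for the uniform law on `[0, 1]` and the convex function `x ↦ x^{u/t}`,
  -- where `u/t ≥ 1`.
  have h := (convexOn_rpow ((one_le_div ht).2 htu)).map_integral_le
    (μ := volume.restrict (Set.Icc (0 : ℝ) 1)) (f := fun s => Real.exp (-(t * s)))
    (Real.continuous_rpow_const (by positivity)).continuousOn isClosed_Ici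
    (Eventually.of_forall fun s => (Real.exp_pos _).le) (hint t)
    (by simp only [Function.comp_def, hpow]; exact hint u)
  simpa only [hpow, integral_exp_neg_mul_unit ht, integral_exp_neg_mul_unit hu] using h

/-- A function that vanishes at `0` and at infinity, and whose derivative stays nonpositive once it
has been negative, is nonnegative. -/
lemma nonneg_of_deriv_neg_persists {D D' : ℝ → ℝ} (hD : ∀ x, HasDerivAt D (D' x) x) (h0 : D 0 = 0)
    (htop : Tendsto D atTop (𝓝 0)) (h : ∀ x y, 0 < x → x ≤ y → D' x < 0 → D' y ≤ 0) {x : ℝ}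
    (hx : 0 ≤ x) : 0 ≤ D x := by
  by_contra! hneg
  have hx0 : 0 < x := lt_of_le_of_ne hx fun h => by rw [← h, h0] at hneg; exact lt_irrefl _ hneg
  have hc : Continuous D := continuous_iff_continuousAt.2 fun x => (hD x).continuousAt
  -- A negative value of `D` at `x` forces a negative derivative at some `c` in `(0, x)`. From `c`
  -- on, `D` is antitone, so it cannot return from a negative value to its limit `0`.
  obtain ⟨c, hc1, hc2⟩ := exists_hasDerivAt_eq_slope D D' hx0 hc.continuousOn fun y _ => hD y
  have hc3 : D' c < 0 := by
    rw [hc2, h0, sub_zero, sub_zero]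
    exact div_neg_of_neg_of_pos hneg hx0
  have hanti : AntitoneOn D (Set.Ici c) := by
    refine antitoneOn_of_deriv_nonpos (convex_Ici c) hc.continuousOn
      (fun y _ => (hD y).differentiableAt.differentiableWithinAt) fun y hy => ?_
    rw [interior_Ici] at hy
    rw [(hD y).deriv]
    exact h c y hc1.1 (le_of_lt hy) hc3
  have hle : (0 : ℝ) ≤ D x := by
    refine le_of_tendsto htop ?_
    filter_upwards [eventually_ge_atTop x] with y hy
    exact hanti (le_of_lt hc1.2) ((le_of_lt hc1.2).trans hy) hy
  linarith

/-- The density of the Gamma distribution of shape `m + 1` and mean one, on the half line. -/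
def erlangDensity (m : ℕ) (t : ℝ) : ℝ :=
  ((m : ℝ) + 1) ^ (m + 1) / m.factorial * t ^ m * Real.exp (-((m + 1) * t))

lemma gammaMeasure_real_Iic (m : ℕ) {x : ℝ} (hx : 0 ≤ x) :
    (gammaMeasure ((m : ℝ) + 1) ((m : ℝ) + 1)).real (Set.Iic x)
      = ∫ t in (0 : ℝ)..x, erlangDensity m t := by
  have hm : (0 : ℝ) < (m : ℝ) + 1 := by positivity
  have := isProbabilityMeasure_gammaMeasure hm hm
  rw [← cdf_eq_real, cdf_gammaMeasure_eq_integral hm hm]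
  have hpdf : gammaPDFReal ((m : ℝ) + 1) ((m : ℝ) + 1)
      = (Set.Ici 0).indicator (erlangDensity m) := by
    ext t
    rw [gammaPDFReal, Set.indicator_apply]
    simp only [Set.mem_Ici, erlangDensity]
    rw [Real.Gamma_nat_eq_factorial, add_sub_cancel_right, Real.rpow_natCast]
    congr 4
    exact_mod_cast Real.rpow_natCast ((m : ℝ) + 1) (m + 1)
  rw [hpdf, setIntegral_indicator measurableSet_Ici, Set.inter_comm, Set.Ici_inter_Iic,
    integral_Icc_eq_integral_Ioc, intervalIntegral.integral_of_le hx]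

lemma tendsto_integral_erlangDensity (m : ℕ) :
    Tendsto (fun x => ∫ t in (0 : ℝ)..x, erlangDensity m t) atTop (𝓝 1) := by
  have hm : (0 : ℝ) < (m : ℝ) + 1 := by positivity
  have := isProbabilityMeasure_gammaMeasure hm hm
  refine (tendsto_cdf_atTop (gammaMeasure ((m : ℝ) + 1) ((m : ℝ) + 1))).congr' ?_
  filter_upwards [eventually_ge_atTop 0] with x hx
  rw [cdf_eq_real, gammaMeasure_real_Iic m hx]

/-- Alzer's inequality. -/
theorem alzer_le_integral_erlangDensity (m : ℕ) {η : ℝ} (hη : 0 < η)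
    (hηm : η ^ (m + 1) * (m + 1).factorial = ((m : ℝ) + 1) ^ (m + 1)) {x : ℝ} (hx : 0 ≤ x) :
    (1 - Real.exp (-(η * x))) ^ (m + 1) ≤ ∫ t in (0 : ℝ)..x, erlangDensity m t := by
  set K : ℝ := ((m : ℝ) + 1) ^ (m + 1) / m.factorial with hK
  have hKpos : 0 < K := by positivity
  -- This is where the value of `η` enters: both derivatives then have the same leading coefficient
  -- at the origin, and `K` is a common factor of `D'`.
  have hKη : ((m : ℝ) + 1) * η ^ (m + 1) = K := by
    rw [hK, ← hηm, Nat.factorial_succ]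
    push_cast
    field_simp
  have hcont : Continuous (erlangDensity m) := by unfold erlangDensity; fun_prop
  set D : ℝ → ℝ := fun x => (∫ t in (0 : ℝ)..x, erlangDensity m t)
    - (1 - Real.exp (-(η * x))) ^ (m + 1) with hDdef
  set D' : ℝ → ℝ := fun x => erlangDensity m x
    - ((m : ℝ) + 1) * (1 - Real.exp (-(η * x))) ^ m * (Real.exp (-(η * x)) * η) with hD'def
  have hD : ∀ x, HasDerivAt D (D' x) x := by
    intro x
    have h1 : HasDerivAt (fun x => ∫ t in (0 : ℝ)..x, erlangDensity m t) (erlangDensity m x) x :=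
      intervalIntegral.integral_hasDerivAt_right (hcont.intervalIntegrable _ _)
        hcont.stronglyMeasurable.stronglyMeasurableAtFilter hcont.continuousAt
    have h2 : HasDerivAt (fun x => 1 - Real.exp (-(η * x))) (Real.exp (-(η * x)) * η) x := by
      have h3 : HasDerivAt (fun x => -(η * x)) (-η) x := by
        simpa using! ((hasDerivAt_id x).const_mul η).neg
      exact (h3.exp.const_sub 1).congr_deriv (by ring)
    refine (h1.sub (h2.fun_pow (m + 1))).congr_deriv ?_
    simp [hD'def]
  have hfac : ∀ y, 0 < y → D' y = K * y ^ m * Real.exp (-(η * y))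
      * (Real.exp (-((m + 1 - η) * y)) - ((1 - Real.exp (-(η * y))) / (η * y)) ^ m) := by
    intro y hy
    have e1 : Real.exp (-(((m : ℝ) + 1) * y))
        = Real.exp (-(η * y)) * Real.exp (-((m + 1 - η) * y)) := by
      rw [← Real.exp_add]; congr 1; ring
    simp only [hD'def, erlangDensity, e1]
    rw [← hK, ← hKη, div_pow]
    field_simp
    ring
  -- The sign of `D'` is that of the bracket in `hfac`. Raising the inequality at `x` to the power
  -- `y / x` carries the exponential exactly to `y`, while the mean `(1 - e^{-ηx}) / (ηx)` becomes
  -- at most its value at `y`, by `rpow_le_one_sub_exp_div`.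
  have key : ∀ x y, 0 < x → x ≤ y → D' x < 0 → D' y ≤ 0 := by
    intro x y hx hxy hneg
    have hy := hx.trans_le hxy
    rw [hfac x hx] at hneg
    rw [hfac y hy]
    have hxle : Real.exp (-((m + 1 - η) * x)) ≤ ((1 - Real.exp (-(η * x))) / (η * x)) ^ m := by
      by_contra! hlt
      have : 0 < K * x ^ m * Real.exp (-(η * x)) := by positivity
      nlinarith [mul_pos this (sub_pos.2 hlt)]
    have hM0 : ∀ z, 0 < z → 0 ≤ (1 - Real.exp (-(η * z))) / (η * z) := fun z hz =>
      div_nonneg (sub_nonneg.2 (Real.exp_le_one_iff.2 (by nlinarith))) (by positivity)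
    have hmono := rpow_le_one_sub_exp_div (t := η * x) (u := η * y) (by positivity)
      (mul_le_mul_of_nonneg_left hxy hη.le)
    rw [mul_div_mul_left _ _ hη.ne'] at hmono
    refine mul_nonpos_of_nonneg_of_nonpos (by positivity) (sub_nonpos.2 ?_)
    calc Real.exp (-((m + 1 - η) * y)) = Real.exp (-((m + 1 - η) * x)) ^ (y / x) := by
          rw [← Real.exp_mul]; congr 1; field_simp
      _ ≤ (((1 - Real.exp (-(η * x))) / (η * x)) ^ m) ^ (y / x) :=
          Real.rpow_le_rpow (Real.exp_pos _).le hxle (by positivity)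
      _ = (((1 - Real.exp (-(η * x))) / (η * x)) ^ (y / x)) ^ m := by
          rw [← Real.rpow_natCast_mul (hM0 x hx), mul_comm (m : ℝ), Real.rpow_mul_natCast (hM0 x hx)]
      _ ≤ _ := pow_le_pow_left₀ (Real.rpow_nonneg (hM0 x hx) _) hmono m
  have htop : Tendsto D atTop (𝓝 0) := by
    have h1 : Tendsto (fun x : ℝ => Real.exp (-(η * x))) atTop (𝓝 0) :=
      Real.tendsto_exp_neg_atTop_nhds_zero.comp (tendsto_id.const_mul_atTop hη)
    have h2 := (tendsto_integral_erlangDensity m).sub ((h1.const_sub 1).pow (m + 1))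
    simpa using h2
  have := nonneg_of_deriv_neg_persists hD (by simp [hDdef]) htop key hx
  exact sub_nonneg.1 this

namespace Params

variable {p : Params}

lemma η_pow_mul_factorial (κ : Link) :
    p.η κ ^ p.N κ * (p.N κ).factorial = (p.N κ : ℝ) ^ p.N κ := by
  have hN := (p.N_cast_pos κ).ne'
  have hf : (0 : ℝ) < (p.N κ).factorial := by positivity
  rw [η, mul_pow, ← Real.rpow_mul_natCast hf.le, div_mul_cancel₀ _ hN, Real.rpow_neg_one, mul_assoc,
    inv_mul_cancel₀ hf.ne', mul_one]

/-- Alzer's inequality for the fading power gain. -/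
theorem alzer_le_fadingLaw (κ : Link) {x : ℝ} (hx : 0 ≤ x) :
    p.alzer κ x ≤ (p.fadingLaw κ).real (Set.Iic x) := by
  have h := η_pow_mul_factorial (p := p) κ
  have hη := η_pos (p := p) κ
  obtain ⟨m, hm⟩ := Nat.exists_eq_add_of_le' (p.N_pos κ)
  rw [alzer, fadingLaw]
  rw [hm] at h ⊢
  push_cast at h ⊢
  rw [gammaMeasure_real_Iic m hx]
  exact alzer_le_integral_erlangDensity m hη h hx

/-- For shape one, `η = 1` and the Gamma law is the exponential law of mean one. -/
lemma fadingLaw_eq_alzer {κ : Link} (hN : p.N κ = 1) {x : ℝ} (hx : 0 ≤ x) :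
    (p.fadingLaw κ).real (Set.Iic x) = p.alzer κ x := by
  have h := gammaMeasure_real_Iic 0 hx
  have hd : erlangDensity 0 = fun t => Real.exp (-t) := by ext t; simp [erlangDensity]
  rw [hd, intervalIntegral.integral_comp_neg] at h
  simp only [Nat.cast_zero, zero_add, neg_zero, integral_exp, Real.exp_zero] at h
  simpa [fadingLaw, alzer, η, hN] using h

end Params

/-! ### The coverage probability compared with Alzer's expression. -/

section Network

variable {Ω : Type*} {p : Params} {v : ℕ → Ω → Plane} {mark : ℕ → Ω → Mark}

lemma pathLoss_pos (κ : Link) {r : ℝ} (hr : 0 < r) : 0 < p.pathLoss κ r := by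
  have := p.C_pos κ
  unfold Params.pathLoss
  positivity

lemma required_nonneg {Υ : ℝ} (hΥ : 0 < Υ) (ω : Ω) : 0 ≤ p.required v mark Υ ω := by
  have := p.noise_pos; have := p.Pv_pos; have := p.gain_zero_pos
  have := Params.pathLoss_nonneg (p := p) (p.state (v 0 ω) (mark 0 ω)) ‖v 0 ω‖
  unfold Params.required
  positivity

/-- Coverage means that the fading power gain exceeds the required value. -/
lemma lt_sinr_iff {Υ : ℝ} (hΥ : 0 < Υ) {ω : Ω} (hI : p.interference v mark ω < ∞)
    (hr : 0 < ‖v 0 ω‖) :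
    ENNReal.ofReal Υ < p.sinr v mark ω ↔
      p.required v mark Υ ω < (mark 0 ω).fading (p.state (v 0 ω) (mark 0 ω)) := by
  have h1 := p.noise_pos; have h2 := p.Pv_pos
  have hc : 0 < p.pathLoss (p.state (v 0 ω) (mark 0 ω)) ‖v 0 ω‖ * p.gain 0 :=
    mul_pos (pathLoss_pos _ hr) p.gain_zero_pos
  have hd : 0 < (p.interference v mark ω).toReal + p.noise / p.Pv := by positivity
  rw [Params.sinr, Params.desiredGain, Params.required]
  conv_lhs => rw [← ENNReal.ofReal_toReal hI.ne]
  rw [← ENNReal.ofReal_add ENNReal.toReal_nonneg (by positivity), ← ENNReal.ofReal_div_of_pos hd,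
    ENNReal.ofReal_lt_ofReal_iff_of_nonneg hΥ.le, lt_div_iff₀ hd, div_lt_iff₀' hc]

/-- The value that the fading power gain has to exceed, as a function of the state of the serving
link, of the locations and of the marks of the interferers. -/
def threshold (p : Params) (Υ : ℝ) (κ : Link) (x : ℕ → Plane) (m : ℕ → Mark) : ℝ :=
  Υ * ((∑' n, ENNReal.ofReal (p.channelGain (x (n + 1)) (m n))).toReal + p.noise / p.Pv) /
    (p.pathLoss κ ‖x 0‖ * p.gain 0)

/-- The locations, the mark of the serving UAV, and the marks of the interferers. -/
abbrev Config : Type := (ℕ → Plane) × Mark × (ℕ → Mark)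

lemma measurable_threshold (p : Params) (Υ : ℝ) (κ : Link) :
    Measurable fun y : Config => threshold p Υ κ y.1 y.2.2 := by
  have h1 : Measurable fun y : Config => (y.1, y.2.2) :=
    measurable_fst.prodMk (measurable_snd.comp measurable_snd)
  have h2 : Measurable fun y : Config => ‖y.1 0‖ :=
    ((measurable_pi_apply 0).comp measurable_fst).norm
  have h3 : Measurable fun y : Config =>
      (∑' n, ENNReal.ofReal (p.channelGain (y.1 (n + 1)) (y.2.2 n))).toReal :=
    ((measurable_tail_interference p).comp h1).ennreal_toReal
  have h4 : Measurable fun y : Config => p.pathLoss κ ‖y.1 0‖ :=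
    (Params.measurable_pathLoss κ).comp h2
  exact ((h3.add_const _).const_mul Υ).div (h4.mul_const _)

/-- A function of the state of the serving link, the required power gain, and the fading power
gain. -/
def ofConfig (p : Params) (Υ : ℝ) (h : Link → ℝ → ℝ → ℝ≥0∞) (y : Config) : ℝ≥0∞ :=
  h (p.state (y.1 0) y.2.1) (threshold p Υ (p.state (y.1 0) y.2.1) y.1 y.2.2)
    (y.2.1.fading (p.state (y.1 0) y.2.1))

lemma measurable_ofConfig (p : Params) (Υ : ℝ) {h : Link → ℝ → ℝ → ℝ≥0∞}
    (hh : ∀ κ, Measurable fun t : ℝ × ℝ => h κ t.1 t.2) : Measurable (ofConfig p Υ h) := by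
  have h0 : Measurable fun y : Config => y.1 0 := (measurable_pi_apply 0).comp measurable_fst
  have hst : Measurable fun y : Config => (y.1 0, y.2.1) :=
    h0.prodMk (measurable_fst.comp measurable_snd)
  have hg : ∀ κ, Measurable fun y : Config => h κ (threshold p Υ κ y.1 y.2.2) (y.2.1.fading κ) := by
    intro κ
    have hfad : Measurable fun y : Config => y.2.1.fading κ :=
      (Params.measurable_fading κ).comp (measurable_fst.comp measurable_snd)
    exact (hh κ).comp ((measurable_threshold p Υ κ).prodMk hfad)
  exact Params.measurable_of_state (p := p) hg hst

lemma measurable_fadingLaw_Ioi (p : Params) (κ : Link) :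
    Measurable fun t => p.fadingLaw κ (Set.Ioi t) :=
  Antitone.measurable fun _ _ h => measure_mono (Set.Ioi_subset_Ioi h)

/-- The configuration of the network. -/
def config (v : ℕ → Ω → Plane) (mark : ℕ → Ω → Mark) (ω : Ω) : Config :=
  (fun n => v n ω, mark 0 ω, fun n => mark (n + 1) ω)

lemma ofConfig_config (Υ : ℝ) (h : Link → ℝ → ℝ → ℝ≥0∞) (ω : Ω) :
    ofConfig p Υ h (config v mark ω) = h (p.state (v 0 ω) (mark 0 ω)) (p.required v mark Υ ω)
      ((mark 0 ω).fading (p.state (v 0 ω) (mark 0 ω))) := rfl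

/-- Both comparisons are pointwise before taking the mean: the difference of the tails is that of
the distribution functions at one random point. -/
lemma alzerTail_sub_fadingLaw (Υ : ℝ) (ω : Ω) :
    p.alzerTail v mark Υ ω - (p.fadingLaw (p.state (v 0 ω) (mark 0 ω))).real
        (Set.Ioi (p.required v mark Υ ω))
      = (p.fadingLaw (p.state (v 0 ω) (mark 0 ω))).real (Set.Iic (p.required v mark Υ ω))
        - p.alzer (p.state (v 0 ω) (mark 0 ω)) (p.required v mark Υ ω) := by
  have := p.isProbabilityMeasure_fadingLaw (p.state (v 0 ω) (mark 0 ω))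
  rw [← Set.compl_Iic, probReal_compl_eq_one_sub measurableSet_Iic, Params.alzerTail]
  ring

variable [MeasurableSpace Ω] {P : Measure Ω}

lemma measurable_config (hnet : IsNetwork P p v mark) : Measurable (config v mark) :=
  (measurable_points hnet).prodMk ((hnet.mark_measurable 0).prodMk (measurable_tail_marks hnet))

lemma measurable_fadingLaw_required (hnet : IsNetwork P p v mark) (Υ : ℝ) :
    Measurable fun ω =>
      p.fadingLaw (p.state (v 0 ω) (mark 0 ω)) (Set.Ioi (p.required v mark Υ ω)) := by
  have h := (measurable_ofConfig p Υ (h := fun κ t _ => p.fadingLaw κ (Set.Ioi t)) fun κ =>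
    (measurable_fadingLaw_Ioi p κ).comp measurable_fst).comp (measurable_config hnet)
  exact h

variable [IsProbabilityMeasure P]

/-- The Laplace identity at `s = 0` shows that the nearest distance has a density on `(0, ∞)`, so it
does not charge `0`. There, with equal altitudes, `pathLoss` is a division by zero and `lt_sinr_iff`
could fail. -/
lemma ae_norm_pos (hnet : IsNetwork P p v mark) : ∀ᵐ ω ∂P, 0 < ‖v 0 ω‖ := by
  have hφ : Measurable (({0} : Set ℝ).indicator (1 : ℝ → ℝ≥0∞)) :=
    measurable_one.indicator (measurableSet_singleton 0)
  have h1 := lintegral_interference_marks hnet le_rfl (hφ.comp measurable_norm)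
  have h2 := Params.lintegral_nearest hnet.ppp hnet.ranked le_rfl hφ
  have h3 : ∫⁻ r in Set.Ioi 0, ({0} : Set ℝ).indicator (1 : ℝ → ℝ≥0∞) r
      * ENNReal.ofReal (p.nearestPDF r * p.laplaceIntegral 0 r) = 0 := by
    rw [setLIntegral_congr_fun (g := fun _ => 0) measurableSet_Ioi, lintegral_zero]
    intro r hr
    simp [(ne_of_gt hr : r ≠ 0)]
  have h4 := h1.trans (h2.trans h3)
  simp only [ENNReal.ofReal_zero, zero_mul, negExp_zero, mul_one] at h4
  have hm : Measurable fun ω => (({0} : Set ℝ).indicator (1 : ℝ → ℝ≥0∞) ∘ norm) (v 0 ω) :=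
    (hφ.comp measurable_norm).comp (hnet.ppp.measurable 0)
  rw [lintegral_eq_zero_iff hm] at h4
  filter_upwards [h4] with ω hω
  refine lt_of_le_of_ne (norm_nonneg _) fun h => ?_
  simp [← h] at hω

/-- The fading of the serving link can be integrated out. -/
lemma lintegral_ofConfig (hnet : IsNetwork P p v mark) (Υ : ℝ) {h : Link → ℝ → ℝ → ℝ≥0∞}
    (hh : ∀ κ, Measurable fun t : ℝ × ℝ => h κ t.1 t.2) :
    ∫⁻ ω, ofConfig p Υ h (config v mark ω) ∂P
      = ∫⁻ ω, ofConfig p Υ (fun κ t _ => ∫⁻ y, h κ t y ∂p.fadingLaw κ) (config v mark ω) ∂P := by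
  have h1 := p.isProbabilityMeasure_fadingLaw
  have hh' : ∀ κ, Measurable fun t : ℝ × ℝ => ∫⁻ y, h κ t.1 y ∂p.fadingLaw κ := fun κ =>
    (hh κ).lintegral_prod_right'.comp measurable_fst
  refine (lintegral_mark_zero hnet (measurable_ofConfig p Υ hh)).trans
    (Eq.trans ?_ (lintegral_mark_zero hnet (measurable_ofConfig p Υ hh')).symm)
  refine lintegral_congr fun ω => ?_
  set x : ℕ → Plane := fun n => v n ω
  set m : ℕ → Mark := fun n => mark (n + 1) ω
  have e1 := p.lintegral_markLaw (x 0) (g := fun κ _ y => h κ (threshold p Υ κ x m) y)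
    fun κ _ => (hh κ).comp measurable_prodMk_left
  have e2 := p.lintegral_markLaw (x 0) (g := fun κ _ _ =>
    ∫⁻ y, h κ (threshold p Υ κ x m) y ∂p.fadingLaw κ) fun κ _ => measurable_const
  refine e1.trans (Eq.trans ?_ e2.symm)
  simp only [lintegral_const, measure_univ, mul_one]

/-- The mark of the serving UAV enters the coverage probability only through the tail of its
fading law. -/
lemma lintegral_fading_gt_required (hnet : IsNetwork P p v mark) (Υ : ℝ) :
    P {ω | p.required v mark Υ ω < (mark 0 ω).fading (p.state (v 0 ω) (mark 0 ω))}
      = ∫⁻ ω, p.fadingLaw (p.state (v 0 ω) (mark 0 ω)) (Set.Ioi (p.required v mark Υ ω)) ∂P := by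
  set A : Set (ℝ × ℝ) := {a | a.1 < a.2}
  have hA : MeasurableSet A := measurableSet_lt measurable_fst measurable_snd
  set S : Set Ω := {ω | p.required v mark Υ ω < (mark 0 ω).fading (p.state (v 0 ω) (mark 0 ω))}
  have hh : ∀ κ : Link, Measurable fun t : ℝ × ℝ => A.indicator (1 : ℝ × ℝ → ℝ≥0∞) (t.1, t.2) :=
    fun _ => measurable_one.indicator hA
  have e := lintegral_ofConfig hnet Υ
    (h := fun _ t y => A.indicator (1 : ℝ × ℝ → ℝ≥0∞) (t, y)) hh
  have hind : ∀ κ t, ∫⁻ y, A.indicator (1 : ℝ × ℝ → ℝ≥0∞) (t, y) ∂p.fadingLaw κ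
      = p.fadingLaw κ (Set.Ioi t) := fun κ t =>
    lintegral_indicator_one (μ := p.fadingLaw κ) (s := Set.Ioi t) measurableSet_Ioi
  simp only [hind, ofConfig_config] at e
  rw [← e]
  have hm : Measurable fun ω => A.indicator (1 : ℝ × ℝ → ℝ≥0∞) (p.required v mark Υ ω,
      (mark 0 ω).fading (p.state (v 0 ω) (mark 0 ω))) := by
    have h := (measurable_ofConfig p Υ (h := fun _ t y => A.indicator (1 : ℝ × ℝ → ℝ≥0∞) (t, y))
      hh).comp (measurable_config hnet)
    simpa only [Function.comp_def, ofConfig_config] using h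
  have hS : (fun ω => A.indicator (1 : ℝ × ℝ → ℝ≥0∞) (p.required v mark Υ ω,
      (mark 0 ω).fading (p.state (v 0 ω) (mark 0 ω)))) = S.indicator 1 := rfl
  have hSm : MeasurableSet S := by
    rw [hS] at hm
    exact (measurable_indicator_const_iff (1 : ℝ≥0∞)).1 hm
  rw [hS, lintegral_indicator_one hSm]

/-- Coverage is the event that the fading gain exceeds the required value. Given the state, that
value depends only on the locations and on the marks of the interferers, so the fading can be
averaged first. -/
theorem coverage_eq (hnet : IsNetwork P p v mark) {Υ : ℝ} (hΥ : 0 < Υ) :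
    p.coverage v mark P Υ = ∫ ω, (p.fadingLaw (p.state (v 0 ω) (mark 0 ω))).real
      (Set.Ioi (p.required v mark Υ ω)) ∂P := by
  have hset : P {ω | ENNReal.ofReal Υ < p.sinr v mark ω} = P {ω | p.required v mark Υ ω
      < (mark 0 ω).fading (p.state (v 0 ω) (mark 0 ω))} := by
    refine measure_congr ?_
    filter_upwards [ae_interference_lt_top hnet, ae_norm_pos hnet] with ω h1 h2
    exact propext (lt_sinr_iff hΥ h1 h2)
  rw [Params.coverage, Measure.real, hset, lintegral_fading_gt_required hnet]
  refine (integral_toReal (measurable_fadingLaw_required hnet Υ).aemeasurable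
    (Eventually.of_forall fun ω => ?_)).symm
  have := p.isProbabilityMeasure_fadingLaw (p.state (v 0 ω) (mark 0 ω))
  exact measure_lt_top _ _

lemma integrable_fadingLaw_required (hnet : IsNetwork P p v mark) (Υ : ℝ) :
    Integrable (fun ω => (p.fadingLaw (p.state (v 0 ω) (mark 0 ω))).real
      (Set.Ioi (p.required v mark Υ ω))) P := by
  refine integrable_toReal_of_lintegral_ne_top
    (measurable_fadingLaw_required hnet Υ).aemeasurable ?_
  rw [← lintegral_fading_gt_required hnet]
  exact measure_ne_top _ _

theorem coverage_le_alzerCoverage (hnet : IsNetwork P p v mark) {Υ : ℝ} (hΥ : 0 < Υ) :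
    p.coverage v mark P Υ ≤ p.alzerCoverage v mark P Υ := by
  rw [coverage_eq hnet hΥ, Params.alzerCoverage]
  refine integral_mono (integrable_fadingLaw_required hnet Υ) (integrable_alzerTail hnet hΥ)
    fun ω => sub_nonneg.1 ?_
  rw [alzerTail_sub_fadingLaw]
  exact sub_nonneg.2 (Params.alzer_le_fadingLaw _ (required_nonneg hΥ ω))

theorem abs_coverage_sub_alzerCoverage_le (hnet : IsNetwork P p v mark) {Υ : ℝ} (hΥ : 0 < Υ)
    {δ : ℝ} (hδ : ∀ (κ : Link) (x : ℝ), 0 ≤ x →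
      |(p.fadingLaw κ).real (Set.Iic x) - p.alzer κ x| ≤ δ) :
    |p.coverage v mark P Υ - p.alzerCoverage v mark P Υ| ≤ δ := by
  rw [abs_sub_comm, coverage_eq hnet hΥ, Params.alzerCoverage,
    ← integral_sub (integrable_alzerTail hnet hΥ) (integrable_fadingLaw_required hnet Υ)]
  have h := norm_integral_le_of_norm_le_const (μ := P) (C := δ) (f := fun ω =>
    p.alzerTail v mark Υ ω - (p.fadingLaw (p.state (v 0 ω) (mark 0 ω))).real
        (Set.Ioi (p.required v mark Υ ω))) (Eventually.of_forall fun ω => by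
      rw [alzerTail_sub_fadingLaw, Real.norm_eq_abs]
      exact hδ _ _ (required_nonneg hΥ ω))
  simpa using h

/-- The error bound with `δ = 0`. -/
theorem coverage_eq_alzerCoverage (hnet : IsNetwork P p v mark) {Υ : ℝ} (hΥ : 0 < Υ)
    (hN : ∀ κ, p.N κ = 1) : p.coverage v mark P Υ = p.alzerCoverage v mark P Υ := by
  have h := abs_coverage_sub_alzerCoverage_le hnet hΥ (δ := 0) fun κ x hx => by
    rw [Params.fadingLaw_eq_alzer (hN κ) hx, sub_self, abs_zero]
  exact sub_eq_zero.1 (abs_nonpos_iff.1 h)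

end Network

end UAV

end

theorem theorem1 {Ω : Type*} [MeasurableSpace Ω] (P : Measure Ω) [IsProbabilityMeasure P]
    (p : UAV.Params) (v : ℕ → Ω → UAV.Plane) (mark : ℕ → Ω → UAV.Mark)
    (hnet : UAV.IsNetwork P p v mark) (Υ : ℝ) (hΥ : 0 < Υ) :
    -- the interference and all the series in the closed form are finite
    (∀ᵐ ω ∂P, p.interference v mark ω < ∞) ∧
    (∀ (κ : UAV.Link) (s : ℝ) (i : Fin 4), 0 ≤ s → Summable (p.ringTerm κ s i)) ∧
    (∀ ζ ∈ Set.Ioo (-1 : ℝ) 1, Summable (p.levelTerm Υ ζ)) ∧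
    -- as `m → ∞` the quadrature sum attains the coverage probability taken with Alzer's expression
    Integrable (p.alzerTail v mark Υ) P ∧
    Tendsto (p.quadrature Υ) atTop (𝓝 (p.alzerCoverage v mark P Υ)) ∧
    -- this limit is an upper bound, and its error is at most that of Alzer's expression
    p.coverage v mark P Υ ≤ p.alzerCoverage v mark P Υ ∧
    (∀ δ : ℝ, (∀ (κ : UAV.Link) (x : ℝ), 0 ≤ x →
        |(p.fadingLaw κ).real (Set.Iic x) - p.alzer κ x| ≤ δ) →
      |p.coverage v mark P Υ - p.alzerCoverage v mark P Υ| ≤ δ) ∧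
    -- for Rayleigh fading there is no error
    ((∀ κ, p.N κ = 1) →
      Tendsto (p.quadrature Υ) atTop (𝓝 (p.coverage v mark P Υ))) := by
  have hquad := UAV.alzerCoverage_eq hnet hΥ ▸ UAV.Params.tendsto_quadrature (p := p) hΥ
  exact ⟨UAV.ae_interference_lt_top hnet, fun κ _ i hs => UAV.Params.summable_ringTerm κ hs i,
    fun _ hζ => UAV.Params.summable_levelTerm hΥ hζ, UAV.integrable_alzerTail hnet hΥ, hquad,
    UAV.coverage_le_alzerCoverage hnet hΥ,
    fun _ hδ => UAV.abs_coverage_sub_alzerCoverage_le hnet hΥ hδ,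
    fun hN => UAV.coverage_eq_alzerCoverage hnet hΥ hN ▸ hquad⟩
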